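/- **Setting.** Let $(Y_i,X_i,W_i)_{i\ge 1}$ be i.i.d. with values in $\mathbb R\times\mathcal X\times\mathcal W$, $\mathcal X\subseteq\mathbb R^d$, $\mathcal W\subseteq\mathbb R^{d_w}$, such that $Y_i=h_0(X_i)+u_i$ and $E[u_i\mid W_i]=0$, with $u_i$ integrable and $h_0\in L^2(X)$. Let $T:L^2(X)\to L^2(W)$ be the conditional expectation operator $Th(w)=E[h(X_i)\mid W_i=w]$. For all $J,K\ge 1$ let $\psi^J=(\psi_{J1},\dots,\psi_{JJ})'$ and $b^K=(b_{K1},\dots,b_{KK})'$ be vectors of measurable functions in $L^2(X)$ and $L^2(W)$, spanning $\Psi_J\subset L^2(X)$ and $B_K\subset L^2(W)$, and let $\Pi_J$ and $\Pi_K$ be the orthogonal projections of $L^2(X)$ onto $\Psi_J$ and of $L^2(W)$ onto $B_K$. The dimensions $J=J_n$ and $K=K_n$ are deterministic functions of $n$ with $J_n\le K_n=O(J_n)$ and $J_n\ge 2$ for all large $n$ (as holds when $J_n\to\infty$). Assume that $G_\psi=E[\psi^J(X_i)\psi^J(X_i)']$ and $G_b=E[b^K(W_i)b^K(W_i)']$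 are positive definite for $J=J_n$, $K=K_n$. Put $$\tau_J=\sup_{h\in\Psi_J,\,h\ne0}\frac{\|h\|_{L^2(X)}}{\|Th\|_{L^2(W)}},\qquad \zeta=\max\Big\{\sup_{w\in\mathcal W}\|G_b^{-1/2}b^K(w)\|_{\ell^2},\ \sup_{x\in\mathcal X}\|G_\psi^{-1/2}\psi^J(x)\|_{\ell^2}\Big\}.$$ With $\Psi=(\psi^J(X_1),\dots,\psi^J(X_n))'$, $B=(b^K(W_1),\dots,b^K(W_n))'$, $\mathbf Y=(Y_1,\dots,Y_n)'$, $H_0=(h_0(X_1),\dots,h_0(X_n))'$, and $A\mapsto A^-$ any choice of generalized inverse of square matrices ($AA^-A=A$), define $$\hat h(x)=\psi^J(x)'[\Psi'B(B'B)^-B'\Psi]^-\Psi'B(B'B)^-B'\mathbf Y,\qquad \tilde h(x)=\psi^J(x)'[\Psi'B(B'B)^-B'\Psi]^-\Psi'B(B'B)^-B'H_0 .$$ **Theorem 2.3.** Suppose that $T$ is injective and that, as $n\to\infty$ with $J=J_n$, $K=K_n$, (i) $\displaystyle\sup_{h\in\Psi_J,\ \|h\|_{L^2(X)}=1}\|(\Pi_KT-T)h\|_{L^2(W)}=o(\tau_J^{-1})$;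 (ii) $\tau_J\,\|T(h_0-\Pi_Jh_0)\|_{L^2(W)}\le C\,\|h_0-\Pi_Jh_0\|_{L^2(X)}$ for all $n$, with a finite constant $C$; (iii) $\tau_J\,\zeta\,\sqrt{(\log J)/n}=o(1)$. Then: (1) $\|\tilde h-h_0\|_{L^2(X)}\le O_p(1)\times\|h_0-\Pi_Jh_0\|_{L^2(X)}$. (2) If in addition $E[u_i^2\mid W_i]\le\bar\sigma^2<\infty$ almost surely for a constant $\bar\sigma$, then $$\|\hat h-h_0\|_{L^2(X)}=O_p\big(\|h_0-\Pi_Jh_0\|_{L^2(X)}+\tau_J\sqrt{J/n}\big).$$ Here, for a deterministic sequence $a_n\ge0$, both "$Z_n\le O_p(1)\times a_n$" and "$Z_n=O_p(a_n)$" mean: for every $\varepsilon>0$ there is $M<\infty$ with $P(Z_n>Ma_n)\le\varepsilon$ for all large $n$. -/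

import Mathlib

open MeasureTheory ProbabilityTheory Filter Topology Matrix
open scoped ENNReal NNReal

noncomputable section

namespace NPIV

section Probability

variable {Ω α β : Type*} [MeasurableSpace Ω] [MeasurableSpace α] [MeasurableSpace β]

/-- `Z n = O_p(a n)` for nonnegative (possibly infinite) random quantities `Z n` and
deterministic `a n`: for every `ε > 0` there is a finite `M` such that
`P (Z n > M * a n) ≤ ε` for all large `n`. -/
def IsBigOP (P : Measure Ω) (Z : ℕ → Ω → ℝ≥0∞) (a : ℕ → ℝ≥0∞) : Prop :=
  ∀ ε : ℝ≥0∞, 0 < ε → ∃ M : ℝ≥0, ∀ᶠ n in atTop, P {ω | (M : ℝ≥0∞) * a n < Z n ω} ≤ ε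

/-- `(Y i, X i, W i)`, `i = 0, 1, 2, …`, is a random sample (i.i.d.) from the model
`Y i = h₀ (X i) + u i`, `E[u i | W i] = 0`, with `h₀ ∈ L²(X)`. -/
structure IsNPIVSample (P : Measure Ω) (Y : ℕ → Ω → ℝ) (X : ℕ → Ω → α) (W : ℕ → Ω → β)
    (h₀ : α → ℝ) : Prop where
  measurable_Y : ∀ i, Measurable (Y i)
  measurable_X : ∀ i, Measurable (X i)
  measurable_W : ∀ i, Measurable (W i)
  indep : iIndepFun (fun i ω => (Y i ω, X i ω, W i ω)) P
  ident : ∀ i, IdentDistrib (fun ω => (Y i ω, X i ω, W i ω)) (fun ω => (Y 0 ω, X 0 ω, W 0 ω)) P P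
  measurable_h₀ : Measurable h₀
  memLp_h₀ : MemLp h₀ 2 (P.map (X 0))
  integrable_u : ∀ i, Integrable (fun ω => Y i ω - h₀ (X i ω)) P
  condExp_u : ∀ i,
    P[fun ω => Y i ω - h₀ (X i ω) | MeasurableSpace.comap (W i) inferInstance] =ᵐ[P] 0

/-- `E[u i ^ 2 | W i] ≤ σ²` almost surely, for a finite constant `σ`. -/
def BoundedCondVariance (P : Measure Ω) (Y : ℕ → Ω → ℝ) (X : ℕ → Ω → α) (W : ℕ → Ω → β)
    (h₀ : α → ℝ) : Prop :=
  ∃ σ : ℝ, ∀ i, MemLp (fun ω => Y i ω - h₀ (X i ω)) 2 P ∧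
    P[fun ω => (Y i ω - h₀ (X i ω)) ^ 2 | MeasurableSpace.comap (W i) inferInstance]
      ≤ᵐ[P] fun _ => σ ^ 2

end Probability

section Operator

variable {Ω α β : Type*} [MeasurableSpace Ω] [MeasurableSpace α] [MeasurableSpace β]
  [StandardBorelSpace α] [Nonempty α]

/-- `w ↦ E[h(X) | W = w]`, through the regular conditional distribution of `X` given `W`. -/
def condExpFun (P : Measure Ω) [IsFiniteMeasure P] (X : Ω → α) (W : Ω → β) (h : α → ℝ) :
    β → ℝ :=
  fun w => ∫ x, h x ∂(condDistrib X W P w)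

theorem memLp_condExpFun (P : Measure Ω) [IsFiniteMeasure P] {X : Ω → α} {W : Ω → β}
    (hX : Measurable X) (hW : Measurable W) {h : α → ℝ} (hh : MemLp h 2 (P.map X)) :
    MemLp (condExpFun P X W h) 2 (P.map W) := by
  have hXW : MeasurePreserving X P (P.map X) := ⟨hX, rfl⟩
  have hj : Measurable fun ω => (W ω, X ω) := hW.prodMk hX
  have hsnd : MeasurePreserving (Prod.snd : β × α → α) (P.map fun ω => (W ω, X ω)) (P.map X) :=
    ⟨measurable_snd, by rw [Measure.map_map measurable_snd hj]; rfl⟩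
  have hf : Integrable (fun p : β × α => h p.2) (P.map fun ω => (W ω, X ω)) :=
    (hh.comp_measurePreserving hsnd).integrable one_le_two
  have hmeas : AEStronglyMeasurable (condExpFun P X W h) (P.map W) :=
    AEStronglyMeasurable.integral_condDistrib_map hX.aemeasurable hf.1
  rw [memLp_map_measure_iff hmeas hW.aemeasurable]
  exact ((hh.comp_measurePreserving hXW).condExp one_le_two).ae_eq
    (condExp_prod_ae_eq_integral_condDistrib' hW hX.aemeasurable hf)

/-- The conditional expectation operator `T : L²(X) → L²(W)`, `T h (w) = E[h(X) | W = w]`. -/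
def condExpOp (P : Measure Ω) [IsFiniteMeasure P] {X : Ω → α} {W : Ω → β}
    (hX : Measurable X) (hW : Measurable W) (h : Lp ℝ 2 (P.map X)) : Lp ℝ 2 (P.map W) :=
  (memLp_condExpFun P hX hW (Lp.memLp h)).toLp (condExpFun P X W h)

end Operator

section Sieve

variable {α : Type*} [MeasurableSpace α] {J : ℕ}

/-- The linear sieve space spanned in `L²(μ)` by the basis functions `ψ j`. -/
def sieveSpace {μ : Measure α} (ψ : Fin J → α → ℝ) (hψ : ∀ j, MemLp (ψ j) 2 μ) :
    Submodule ℝ (Lp ℝ 2 μ) :=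
  Submodule.span ℝ (Set.range fun j => (hψ j).toLp (ψ j))

instance {μ : Measure α} (ψ : Fin J → α → ℝ) (hψ : ∀ j, MemLp (ψ j) 2 μ) :
    FiniteDimensional ℝ (sieveSpace ψ hψ) :=
  FiniteDimensional.span_of_finite ℝ (Set.finite_range _)

/-- The Gram matrix `E[ψ(X) ψ(X)']`, where `μ` is the law of `X`. -/
def gram (μ : Measure α) (ψ : Fin J → α → ℝ) : Matrix (Fin J) (Fin J) ℝ :=
  Matrix.of fun j k => ∫ x, ψ j x * ψ k x ∂μ

/-- `G^{-1/2}` for a positive definite matrix `G`, by the functional calculus. -/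
def invSqrt (G : Matrix (Fin J) (Fin J) ℝ) : Matrix (Fin J) (Fin J) ℝ :=
  cfc (fun t : ℝ => (√t)⁻¹) G

/-- `sup_{x ∈ s} ‖G^{-1/2} ψ(x)‖` with the Euclidean norm and `G = E[ψ(X) ψ(X)']`. -/
def zeta (μ : Measure α) (s : Set α) (ψ : Fin J → α → ℝ) : ℝ≥0∞ :=
  ⨆ x ∈ s, ‖WithLp.toLp 2 (invSqrt (gram μ ψ) *ᵥ fun j => ψ j x)‖ₑ

/-- The sieve measure of ill-posedness `sup_{h ∈ V, h ≠ 0} ‖h‖ / ‖T h‖`. -/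
def illPosedness {E F : Type*} [NormedAddCommGroup E] [NormedSpace ℝ E] [NormedAddCommGroup F]
    (T : E → F) (V : Submodule ℝ E) : ℝ≥0∞ :=
  ⨆ h ∈ V, ⨆ _ : h ≠ 0, ‖h‖ₑ / ‖T h‖ₑ

/-- `sup_{h ∈ V, ‖h‖ = 1} ‖(Π_U T - T) h‖`, with `Π_U` the orthogonal projection onto `U`. -/
def projectionGap {E F : Type*} [NormedAddCommGroup E] [NormedSpace ℝ E]
    [NormedAddCommGroup F] [InnerProductSpace ℝ F]
    (T : E → F) (V : Submodule ℝ E) (U : Submodule ℝ F) [U.HasOrthogonalProjection] : ℝ≥0∞ :=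
  ⨆ h ∈ V, ⨆ _ : ‖h‖ = 1, ‖U.starProjection (T h) - T h‖ₑ

end Sieve

section Estimator

variable {Ω α β : Type*}

/-- A choice of generalized inverse `A ↦ A⁻` of square real matrices: `A A⁻ A = A`. -/
def IsGeneralizedInverse
    (ginv : (k : ℕ) → Matrix (Fin k) (Fin k) ℝ → Matrix (Fin k) (Fin k) ℝ) : Prop :=
  ∀ (k : ℕ) (A : Matrix (Fin k) (Fin k) ℝ), A * ginv k A * A = A

/-- The `n × J` matrix with rows `ψ(X₁)', …, ψ(Xₙ)'`. -/
def design (n : ℕ) {J : ℕ} (ψ : Fin J → α → ℝ) (X : ℕ → Ω → α) (ω : Ω) :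
    Matrix (Fin n) (Fin J) ℝ :=
  Matrix.of fun i j => ψ j (X i ω)

/-- The two-stage least squares coefficient vector
`[Ψ'B(B'B)⁻B'Ψ]⁻ Ψ'B(B'B)⁻B' y`. -/
def tslsCoef (ginv : (k : ℕ) → Matrix (Fin k) (Fin k) ℝ → Matrix (Fin k) (Fin k) ℝ)
    {n J K : ℕ} (Ψ : Matrix (Fin n) (Fin J) ℝ) (B : Matrix (Fin n) (Fin K) ℝ) (y : Fin n → ℝ) :
    Fin J → ℝ :=
  (ginv J (Ψᵀ * B * ginv K (Bᵀ * B) * Bᵀ * Ψ) * (Ψᵀ * B * ginv K (Bᵀ * B) * Bᵀ)) *ᵥ y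

/-- The series two-stage least squares fit, as a function on `α`, of the responses
`Z 1, …, Z n` on the regressor basis `ψ` with the instrument basis `b`.
The sieve NPIV estimator is the case `Z i = Y i`; the case `Z i = h₀ (X i)` is its noiseless
counterpart. -/
def sieveFit (ginv : (k : ℕ) → Matrix (Fin k) (Fin k) ℝ → Matrix (Fin k) (Fin k) ℝ)
    (n : ℕ) {J K : ℕ} (ψ : Fin J → α → ℝ) (b : Fin K → β → ℝ)
    (Z : ℕ → Ω → ℝ) (X : ℕ → Ω → α) (W : ℕ → Ω → β) (ω : Ω) : α → ℝ :=
  fun x => ∑ j, ψ j x * tslsCoef ginv (design n ψ X ω) (design n b W ω) (fun i => Z i ω) j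

end Estimator

/-- The sieve NPIV setting: a random sample from the model, the supports (or any sets that contain
the data almost surely), basis functions `ψ^J = (ψ_{J1}, …, ψ_{JJ})` in `L²(X)` and
`b^K = (b_{K1}, …, b_{KK})` in `L²(W)` with positive definite Gram matrices, deterministic sieve
dimensions `J n ≤ K n = O(J n)` for the sample size `n`, and the generalized inverse used by the
estimator. -/
structure Setting {Ω : Type*} [MeasurableSpace Ω] (P : Measure Ω) (d dw : ℕ) where
  Y : ℕ → Ω → ℝ
  X : ℕ → Ω → EuclideanSpace ℝ (Fin d)
  W : ℕ → Ω → EuclideanSpace ℝ (Fin dw)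
  h₀ : EuclideanSpace ℝ (Fin d) → ℝ
  sample : IsNPIVSample P Y X W h₀
  suppX : Set (EuclideanSpace ℝ (Fin d))
  suppW : Set (EuclideanSpace ℝ (Fin dw))
  mem_suppX : ∀ i, ∀ᵐ ω ∂P, X i ω ∈ suppX
  mem_suppW : ∀ i, ∀ᵐ ω ∂P, W i ω ∈ suppW
  ψ : (J : ℕ) → Fin J → EuclideanSpace ℝ (Fin d) → ℝ
  b : (K : ℕ) → Fin K → EuclideanSpace ℝ (Fin dw) → ℝ
  measurable_ψ : ∀ J j, Measurable (ψ J j)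
  measurable_b : ∀ K k, Measurable (b K k)
  memLp_ψ : ∀ J j, MemLp (ψ J j) 2 (P.map (X 0))
  memLp_b : ∀ K k, MemLp (b K k) 2 (P.map (W 0))
  J : ℕ → ℕ
  K : ℕ → ℕ
  eventually_two_le_J : ∀ᶠ n in atTop, 2 ≤ J n
  J_le_K : ∀ n, J n ≤ K n
  K_isBigO : (fun n => (K n : ℝ)) =O[atTop] fun n => (J n : ℝ)
  gram_ψ_posDef : ∀ n, (gram (P.map (X 0)) (ψ (J n))).PosDef
  gram_b_posDef : ∀ n, (gram (P.map (W 0)) (b (K n))).PosDef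
  ginv : (k : ℕ) → Matrix (Fin k) (Fin k) ℝ → Matrix (Fin k) (Fin k) ℝ
  isGeneralizedInverse : IsGeneralizedInverse ginv

namespace Setting

variable {Ω : Type*} [MeasurableSpace Ω] {P : Measure Ω} {d dw : ℕ} (M : Setting P d dw)

/-- The law of `X`; `Lp ℝ 2 M.lawX` is `L²(X)`. -/
abbrev lawX : Measure (EuclideanSpace ℝ (Fin d)) := P.map (M.X 0)

/-- The law of `W`; `Lp ℝ 2 M.lawW` is `L²(W)`. -/
abbrev lawW : Measure (EuclideanSpace ℝ (Fin dw)) := P.map (M.W 0)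

/-- The conditional expectation operator `T : L²(X) → L²(W)`. -/
def T [IsFiniteMeasure P] : Lp ℝ 2 M.lawX → Lp ℝ 2 M.lawW :=
  condExpOp P (M.sample.measurable_X 0) (M.sample.measurable_W 0)

/-- `Ψ_J` for `J = J n`. -/
def sieveX (n : ℕ) : Submodule ℝ (Lp ℝ 2 M.lawX) := sieveSpace (M.ψ (M.J n)) (M.memLp_ψ (M.J n))

/-- `B_K` for `K = K n`. -/
def sieveW (n : ℕ) : Submodule ℝ (Lp ℝ 2 M.lawW) := sieveSpace (M.b (M.K n)) (M.memLp_b (M.K n))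

instance (n : ℕ) : FiniteDimensional ℝ (M.sieveX n) :=
  inferInstanceAs (FiniteDimensional ℝ (sieveSpace (M.ψ (M.J n)) (M.memLp_ψ (M.J n))))

instance (n : ℕ) : FiniteDimensional ℝ (M.sieveW n) :=
  inferInstanceAs (FiniteDimensional ℝ (sieveSpace (M.b (M.K n)) (M.memLp_b (M.K n))))

/-- `h₀` as an element of `L²(X)`. -/
def h₀L : Lp ℝ 2 M.lawX := M.sample.memLp_h₀.toLp M.h₀

/-- `h₀ - Π_J h₀` in `L²(X)` for `J = J n`, with `Π_J` the orthogonal projection onto `Ψ_J`. -/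
def approxError (n : ℕ) : Lp ℝ 2 M.lawX := M.h₀L - (M.sieveX n).starProjection M.h₀L

/-- `τ_J` for `J = J n`. -/
def tau [IsFiniteMeasure P] (n : ℕ) : ℝ≥0∞ := illPosedness M.T (M.sieveX n)

/-- `ζ = ζ_{b,K} ∨ ζ_{ψ,J}` for `J = J n` and `K = K n`. -/
def zetaMax (n : ℕ) : ℝ≥0∞ :=
  max (zeta M.lawW M.suppW (M.b (M.K n))) (zeta M.lawX M.suppX (M.ψ (M.J n)))

/-- The sieve NPIV estimator of `h₀` from the first `n` observations. -/
def hHat (n : ℕ) (ω : Ω) : EuclideanSpace ℝ (Fin d) → ℝ :=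
  sieveFit M.ginv n (M.ψ (M.J n)) (M.b (M.K n)) M.Y M.X M.W ω

/-- The noiseless counterpart of the estimator, with `h₀ (X i)` in place of `Y i`. -/
def hTilde (n : ℕ) (ω : Ω) : EuclideanSpace ℝ (Fin d) → ℝ :=
  sieveFit M.ginv n (M.ψ (M.J n)) (M.b (M.K n)) (fun i ω => M.h₀ (M.X i ω)) M.X M.W ω

end Setting

end NPIV

end

open MeasureTheory ProbabilityTheory Filter Topology Matrix
open scoped ENNReal NNReal

noncomputable section

namespace NPIV

/-! ### Trace inequalities for powers of symmetric matrices. -/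

section MatrixTrace

variable {ι : Type*} [Fintype ι] [DecidableEq ι]

/-! Whiten both bases, so that L² norms on the sieve spaces become Euclidean norms of coordinates.
Let `S` be the population cross moment matrix of the whitened instruments and regressors. If `q` is
the coordinate vector of `h ∈ Ψ_J`, then `S q` is the vector of Fourier coefficients of `T h`, and
its length bounds `‖Π_K T h‖` from above. Since `‖h‖ ≤ τ ‖T h‖` and `τ ‖(Π_K T - T) h‖` is
eventually at most `‖h‖ / 4`, the matrix satisfies `(3/4) |q| ≤ τ |S q|`
(`euclNorm_le_tau_mul_crossMoment`).

On the event that the empirical instrument Gram matrix and the empirical cross moment matrix are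
within `1 / (8 τ)` of their means in operator norm, this lower bound survives. Two-stage least
squares, for any generalized inverse, then has coefficient error at most `4 τ / n` times the length
of the instrumented residual (`tslsCoef_stability`, `tslsCoef_error_le`).

With `r = h₀ - Π_J h₀`, that residual splits into three pieces. The mean is `n` times the Fourier
coefficients of `T r`; by Bessel and the stability assumption it contributes `O(‖r‖)`. The centered
part has mean square at most `n ζ² ‖r‖²`, and `τ² ζ² ≤ n` eventually, so it contributes `O_p(‖r‖)`.
The noise has mean square at most `n σ² K`, and `K = O(J)` turns this into `O_p(τ √(J/n))`.

The good event has probability tending to one by a matrix concentration bound for the stacked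
whitened vectors, proved by the moment method. Exchanging one summand with an independent copy
bounds `E tr X^(2m+2)` by a multiple of `E tr X^(2m)` (`integral_trace_pow_succ_le`). Iterating up
to a power of the order of the logarithm of the dimension and applying Markov's inequality turns `τ
ζ √(log J / n) → 0` into the required tail bound (`eventually_measure_compl_goodEvent_le`). -/

theorem exists_diagonalization {X : Matrix ι ι ℝ} (hX : X.IsSymm) :
    ∃ (U : Matrix ι ι ℝ) (l : ι → ℝ), Uᵀ * U = 1 ∧ U * Uᵀ = 1 ∧ X = U * diagonal l * Uᵀ := by
  have hH : X.IsHermitian := by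
    rw [Matrix.IsHermitian, Matrix.conjTranspose_eq_transpose_of_trivial]; exact hX
  refine ⟨hH.eigenvectorUnitary, hH.eigenvalues, ?_, ?_, ?_⟩
  · have := Unitary.coe_star_mul_self hH.eigenvectorUnitary
    rwa [Matrix.star_eq_conjTranspose, Matrix.conjTranspose_eq_transpose_of_trivial] at this
  · have := Unitary.coe_mul_star_self hH.eigenvectorUnitary
    rwa [Unitary.coe_star, Matrix.star_eq_conjTranspose, Matrix.conjTranspose_eq_transpose_of_trivial] at this
  · have := hH.spectral_theorem
    rw [Unitary.conjStarAlgAut_apply, Matrix.star_eq_conjTranspose,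
      Matrix.conjTranspose_eq_transpose_of_trivial] at this
    exact this

theorem diagonalization_pow {U : Matrix ι ι ℝ} (l : ι → ℝ) (h1 : Uᵀ * U = 1) (h2 : U * Uᵀ = 1)
    (q : ℕ) : (U * diagonal l * Uᵀ) ^ q = U * diagonal (l ^ q) * Uᵀ := by
  induction q with
  | zero => simp [h2]
  | succ q ih =>
    rw [pow_succ, ih]
    calc U * diagonal (l ^ q) * Uᵀ * (U * diagonal l * Uᵀ)
        = U * diagonal (l ^ q) * (Uᵀ * U) * diagonal l * Uᵀ := by simp only [Matrix.mul_assoc]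
      _ = U * (diagonal (l ^ q) * diagonal l) * Uᵀ := by
          rw [h1, Matrix.mul_one]; simp only [Matrix.mul_assoc]
      _ = _ := by rw [diagonal_mul_diagonal]; rfl

/-- The weights on the right are squares, so an inequality between such traces reduces to a scalar
inequality for each pair of eigenvalues. -/
theorem trace_mul_diagonalizations {U V D : Matrix ι ι ℝ} (hD : D.IsSymm) (l m : ι → ℝ) :
    (D * (U * diagonal l * Uᵀ) * D * (V * diagonal m * Vᵀ)).trace
      = ∑ i, ∑ j, l i * m j * ((Uᵀ * D * V) i j) ^ 2 := by
  have hE : (Uᵀ * D * V)ᵀ = Vᵀ * D * U := by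
    simp only [transpose_mul, transpose_transpose, hD.eq, Matrix.mul_assoc]
  have : (D * (U * diagonal l * Uᵀ) * D * (V * diagonal m * Vᵀ)).trace
      = (diagonal l * (Uᵀ * D * V) * (diagonal m * (Uᵀ * D * V)ᵀ)).trace := by
    rw [hE, show D * (U * diagonal l * Uᵀ) * D * (V * diagonal m * Vᵀ)
      = (D * U) * (diagonal l * Uᵀ * D * V * diagonal m * Vᵀ) by simp only [Matrix.mul_assoc],
      trace_mul_comm]
    simp only [Matrix.mul_assoc]
  rw [this, trace]
  refine Finset.sum_congr rfl fun i _ => ?_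
  simp only [diag_apply, Matrix.mul_apply (M := diagonal l * _), diagonal_mul, transpose_apply]
  exact Finset.sum_congr rfl fun j _ => by ring

theorem pow_mul_pow_add_le (x y : ℝ) {q r m : ℕ} (h : q + r = 2 * m) :
    x ^ q * y ^ r + x ^ r * y ^ q ≤ x ^ (2 * m) + y ^ (2 * m) := by
  have habs : x ^ q * y ^ r + x ^ r * y ^ q ≤ |x| ^ q * |y| ^ r + |x| ^ r * |y| ^ q := by
    refine add_le_add ?_ ?_ <;>
    · rw [← abs_pow, ← abs_pow, ← abs_mul]; exact le_abs_self _
  -- Evenness of the total degree permits absolute values; both powers are then monotone in them, so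
  -- the product of the two differences is nonnegative.
  have hx : x ^ (2 * m) = |x| ^ q * |x| ^ r := by
    rw [← pow_add, h, pow_mul, pow_mul, sq_abs]
  have hy : y ^ (2 * m) = |y| ^ q * |y| ^ r := by
    rw [← pow_add, h, pow_mul, pow_mul, sq_abs]
  rw [hx, hy]
  refine habs.trans ?_
  have key : 0 ≤ (|x| ^ q - |y| ^ q) * (|x| ^ r - |y| ^ r) := by
    rcases le_total |x| |y| with hxy | hxy
    · exact mul_nonneg_of_nonpos_of_nonpos
        (sub_nonpos.2 (pow_le_pow_left₀ (abs_nonneg _) hxy _))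
        (sub_nonpos.2 (pow_le_pow_left₀ (abs_nonneg _) hxy _))
    · exact mul_nonneg
        (sub_nonneg.2 (pow_le_pow_left₀ (abs_nonneg _) hxy _))
        (sub_nonneg.2 (pow_le_pow_left₀ (abs_nonneg _) hxy _))
  nlinarith [key]

/-- A trace form of the rearrangement inequality for powers of symmetric matrices. -/
theorem trace_mul_pow_mul_pow_add_le {X Y D : Matrix ι ι ℝ} (hX : X.IsSymm) (hY : Y.IsSymm)
    (hD : D.IsSymm) {q r m : ℕ} (h : q + r = 2 * m) :
    (D * X ^ q * D * Y ^ r).trace + (D * X ^ r * D * Y ^ q).trace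
      ≤ (D * X ^ (2 * m) * D).trace + (D * Y ^ (2 * m) * D).trace := by
  obtain ⟨U, l, hU1, hU2, rfl⟩ := exists_diagonalization hX
  obtain ⟨V, k, hV1, hV2, rfl⟩ := exists_diagonalization hY
  -- A zeroth power of the other matrix is inserted so that all four traces have the diagonalized
  -- form.
  have e1 : (D * (U * diagonal l * Uᵀ) ^ (2 * m) * D).trace
      = (D * (U * diagonal l * Uᵀ) ^ (2 * m) * D * (V * diagonal k * Vᵀ) ^ 0).trace := by
    rw [pow_zero, Matrix.mul_one]
  have e2 : (D * (V * diagonal k * Vᵀ) ^ (2 * m) * D).trace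
      = (D * (U * diagonal l * Uᵀ) ^ 0 * D * (V * diagonal k * Vᵀ) ^ (2 * m)).trace := by
    rw [pow_zero, Matrix.mul_one, trace_mul_comm, ← Matrix.mul_assoc]
  rw [e1, e2]
  simp only [diagonalization_pow _ hU1 hU2, diagonalization_pow _ hV1 hV2,
    trace_mul_diagonalizations hD, ← Finset.sum_add_distrib, ← add_mul]
  refine Finset.sum_le_sum fun i _ => Finset.sum_le_sum fun j _ => ?_
  refine mul_le_mul_of_nonneg_right ?_ (sq_nonneg _)
  simpa using pow_mul_pow_add_le (l i) (k j) h

theorem pow_sub_pow_eq_sum {R : Type*} [Ring R] (X Y : R) (N : ℕ) :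
    X ^ N - Y ^ N = ∑ q ∈ Finset.range N, X ^ q * (X - Y) * Y ^ (N - 1 - q) := by
  induction N with
  | zero => simp
  | succ N ih =>
    rw [Finset.sum_range_succ]
    have : ∑ q ∈ Finset.range N, X ^ q * (X - Y) * Y ^ (N + 1 - 1 - q)
        = (∑ q ∈ Finset.range N, X ^ q * (X - Y) * Y ^ (N - 1 - q)) * Y := by
      rw [Finset.sum_mul]
      refine Finset.sum_congr rfl fun q hq => ?_
      have hq' := Finset.mem_range.1 hq
      rw [show N + 1 - 1 - q = (N - 1 - q) + 1 by omega, pow_succ]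
      simp only [mul_assoc]
    rw [this, ← ih, Nat.add_sub_cancel, Nat.sub_self, pow_zero, mul_one, pow_succ, pow_succ]
    noncomm_ring

/-- A mean value inequality under the trace. The difference of powers telescopes into `2 m + 1`
terms; each is paired with its reflection `q ↦ 2 m - q`, and the rearrangement inequality bounds
every pair. -/
theorem two_mul_trace_mul_pow_sub_pow_le {X Y : Matrix ι ι ℝ} (hX : X.IsSymm) (hY : Y.IsSymm)
    (m : ℕ) :
    2 * ((X - Y) * (X ^ (2 * m + 1) - Y ^ (2 * m + 1))).trace
      ≤ (2 * m + 1) * (((X - Y) * X ^ (2 * m) * (X - Y)).trace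
          + ((X - Y) * Y ^ (2 * m) * (X - Y)).trace) := by
  set D := X - Y with hDdef
  have hD : D.IsSymm := hX.sub hY
  have h1 : (D * (X ^ (2 * m + 1) - Y ^ (2 * m + 1))).trace
      = ∑ q ∈ Finset.range (2 * m + 1), (D * X ^ q * D * Y ^ (2 * m - q)).trace := by
    rw [pow_sub_pow_eq_sum, Finset.mul_sum, trace_sum]
    refine Finset.sum_congr rfl fun q _ => ?_
    simp only [← hDdef, Nat.add_sub_cancel, Matrix.mul_assoc]
  have h2 : (D * (X ^ (2 * m + 1) - Y ^ (2 * m + 1))).trace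
      = ∑ q ∈ Finset.range (2 * m + 1), (D * X ^ (2 * m - q) * D * Y ^ q).trace := by
    rw [h1, ← Finset.sum_range_reflect]
    refine Finset.sum_congr rfl fun q hq => ?_
    have := Finset.mem_range.1 hq
    rw [show 2 * m + 1 - 1 - q = 2 * m - q by omega, show 2 * m - (2 * m - q) = q by omega]
  rw [two_mul]
  nth_rewrite 1 [h1]
  rw [h2, ← Finset.sum_add_distrib]
  refine (Finset.sum_le_card_nsmul _ _
    ((D * X ^ (2 * m) * D).trace + (D * Y ^ (2 * m) * D).trace) fun q hq => ?_).trans (le_of_eq ?_)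
  · have := Finset.mem_range.1 hq
    exact trace_mul_pow_mul_pow_add_le hX hY hD (by omega)
  · simp [mul_add]

theorem trace_transpose_mul_self_nonneg {ι κ : Type*} [Fintype ι] [Fintype κ] (A : Matrix ι κ ℝ) :
    0 ≤ (Aᵀ * A).trace := by
  refine Finset.sum_nonneg fun i _ => ?_
  rw [diag_apply, Matrix.mul_apply]
  exact Finset.sum_nonneg fun j _ => by rw [transpose_apply]; exact mul_self_nonneg _

theorem isSymm_pow {X : Matrix ι ι ℝ} (hX : X.IsSymm) (k : ℕ) : (X ^ k).IsSymm := by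
  rw [Matrix.IsSymm, transpose_pow, hX.eq]

theorem trace_pow_even_nonneg {X : Matrix ι ι ℝ} (hX : X.IsSymm) (m : ℕ) :
    0 ≤ (X ^ (2 * m)).trace := by
  have := trace_transpose_mul_self_nonneg (X ^ m)
  rwa [transpose_pow, hX.eq, ← pow_add, ← two_mul] at this

/-- The matrix `X ^ (2 m) (X - θ)²` has nonnegative trace. This removes odd powers from the moment
recursion. -/
theorem trace_pow_odd_le {X : Matrix ι ι ℝ} (hX : X.IsSymm) (m : ℕ) (θ : ℝ) :
    2 * θ * (X ^ (2 * m + 1)).trace ≤ (X ^ (2 * m + 2)).trace + θ ^ 2 * (X ^ (2 * m)).trace := by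
  have h := trace_transpose_mul_self_nonneg (X ^ m * (X - θ • 1))
  have e : (X ^ m * (X - θ • 1))ᵀ * (X ^ m * (X - θ • 1))
      = X ^ (2 * m + 2) - (2 * θ) • X ^ (2 * m + 1) + θ ^ 2 • X ^ (2 * m) := by
    rw [transpose_mul, transpose_pow, hX.eq, transpose_sub, hX.eq, transpose_smul, transpose_one,
      show 2 * m + 2 = (m + 1) + (m + 1) by ring, show 2 * m + 1 = m + (m + 1) by ring, two_mul m,
      pow_add X (m + 1), pow_add X m (m + 1), pow_add X m m, pow_succ']
    have hc : X * X ^ m = X ^ m * X := (Commute.self_pow X m).eq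
    simp only [Matrix.sub_mul, Matrix.mul_sub, Matrix.smul_mul, Matrix.mul_smul, Matrix.one_mul,
      Matrix.mul_one, hc, Matrix.mul_assoc]
    module
  rw [e, trace_add, trace_sub, trace_smul, trace_smul, smul_eq_mul, smul_eq_mul] at h
  linarith

/-- The operator norm of a symmetric matrix is controlled by the traces of its even powers. -/
theorem mulVec_dotProduct_le_of_trace_pow_le {X : Matrix ι ι ℝ} (hX : X.IsSymm) {p : ℕ}
    (hp : p ≠ 0) {t : ℝ} (h : (X ^ (2 * p)).trace ≤ t ^ (2 * p)) (u : ι → ℝ) :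
    (X *ᵥ u) ⬝ᵥ (X *ᵥ u) ≤ t ^ 2 * (u ⬝ᵥ u) := by
  obtain ⟨U, l, hU1, hU2, rfl⟩ := exists_diagonalization hX
  rw [diagonalization_pow _ hU1 hU2, trace_mul_comm, ← Matrix.mul_assoc, hU1, Matrix.one_mul,
    trace_diagonal] at h
  have hl : ∀ i, (l i) ^ 2 ≤ t ^ 2 := fun i => by
    have h1 : (l i) ^ (2 * p) ≤ t ^ (2 * p) := by
      refine le_trans ?_ h
      refine Finset.single_le_sum (f := fun i => (l ^ (2 * p)) i) (fun j _ => ?_)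
        (Finset.mem_univ i)
      simp only [Pi.pow_apply, pow_mul]
      positivity
    rw [pow_mul, pow_mul] at h1
    exact (pow_le_pow_iff_left₀ (sq_nonneg _) (sq_nonneg _) hp).1 h1
  have iso : ∀ (V : Matrix ι ι ℝ), Vᵀ * V = 1 → ∀ w : ι → ℝ, (V *ᵥ w) ⬝ᵥ (V *ᵥ w) = w ⬝ᵥ w := by
    intro V hV w
    rw [dotProduct_mulVec, ← mulVec_transpose, mulVec_mulVec, hV, one_mulVec]
  have hu : u ⬝ᵥ u = (Uᵀ *ᵥ u) ⬝ᵥ (Uᵀ *ᵥ u) := (iso Uᵀ (by rw [transpose_transpose, hU2]) u).symm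
  rw [hu, Matrix.mul_assoc, ← mulVec_mulVec, iso U hU1, ← mulVec_mulVec]
  simp only [dotProduct, mulVec_diagonal, Finset.mul_sum]
  refine Finset.sum_le_sum fun i _ => ?_
  nlinarith [mul_le_mul_of_nonneg_right (hl i) (mul_self_nonneg ((Uᵀ *ᵥ u) i))]

end MatrixTrace

/-! ### Bounded measurable random matrices, whose polynomial traces are integrable. -/

section BoundedMatrix

/-- A matrix-valued function all of whose entries are measurable and bounded. -/
def IsBoundedMeasurable {Ω m n : Type*} [MeasurableSpace Ω] (F : Ω → Matrix m n ℝ) : Prop :=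
  ∀ a b, Measurable (fun ω => F ω a b) ∧ ∃ C, ∀ ω, |F ω a b| ≤ C

namespace IsBoundedMeasurable

variable {Ω Ω' m n k : Type*} [MeasurableSpace Ω] [MeasurableSpace Ω']

theorem const (A : Matrix m n ℝ) : IsBoundedMeasurable fun _ : Ω => A :=
  fun a b => ⟨measurable_const, |A a b|, fun _ => le_rfl⟩

theorem sub {F G : Ω → Matrix m n ℝ} (hF : IsBoundedMeasurable F) (hG : IsBoundedMeasurable G) :
    IsBoundedMeasurable fun ω => F ω - G ω := fun a b => by
  obtain ⟨h1, C1, hC1⟩ := hF a b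
  obtain ⟨h2, C2, hC2⟩ := hG a b
  exact ⟨h1.sub h2, C1 + C2, fun ω => (abs_sub _ _).trans (add_le_add (hC1 ω) (hC2 ω))⟩

theorem sum {κ : Type*} (s : Finset κ) {F : κ → Ω → Matrix m n ℝ}
    (hF : ∀ i ∈ s, IsBoundedMeasurable (F i)) :
    IsBoundedMeasurable fun ω => ∑ i ∈ s, F i ω := fun a b => by
  choose C hC using fun i : s => ((hF i.1 i.2) a b).2
  refine ⟨?_, ∑ i : s, C i, fun ω => ?_⟩
  · simp only [Matrix.sum_apply]
    exact Finset.measurable_sum _ fun i hi => (hF i hi a b).1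
  · beta_reduce
    rw [Matrix.sum_apply, ← Finset.sum_coe_sort s]
    exact (Finset.abs_sum_le_sum_abs _ _).trans (Finset.sum_le_sum fun i _ => hC i ω)

theorem mul [Fintype n] {F : Ω → Matrix m n ℝ} {G : Ω → Matrix n k ℝ}
    (hF : IsBoundedMeasurable F) (hG : IsBoundedMeasurable G) :
    IsBoundedMeasurable fun ω => F ω * G ω := fun a b => by
  choose C1 hC1 using fun j => (hF a j).2
  choose C2 hC2 using fun j => (hG j b).2
  refine ⟨?_, ∑ j, C1 j * C2 j, fun ω => ?_⟩
  · simp only [Matrix.mul_apply]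
    exact Finset.measurable_sum _ fun j _ => (hF a j).1.mul (hG j b).1
  · beta_reduce
    rw [Matrix.mul_apply]
    refine (Finset.abs_sum_le_sum_abs _ _).trans (Finset.sum_le_sum fun j _ => ?_)
    rw [abs_mul]
    exact mul_le_mul (hC1 j ω) (hC2 j ω) (abs_nonneg _) ((abs_nonneg _).trans (hC1 j ω))

theorem pow [Fintype n] [DecidableEq n] {F : Ω → Matrix n n ℝ} (hF : IsBoundedMeasurable F)
    (q : ℕ) : IsBoundedMeasurable fun ω => F ω ^ q := by
  induction q with
  | zero => simpa using const (Ω := Ω) (1 : Matrix n n ℝ)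
  | succ q ih => simpa only [pow_succ] using ih.mul hF

theorem comp {F : Ω → Matrix m n ℝ} (hF : IsBoundedMeasurable F) {g : Ω' → Ω}
    (hg : Measurable g) : IsBoundedMeasurable fun ω => F (g ω) := fun a b =>
  ⟨(hF a b).1.comp hg, (hF a b).2.imp fun _ h ω => h (g ω)⟩

theorem integrable {μ : Measure Ω} [IsFiniteMeasure μ] {F : Ω → Matrix m n ℝ}
    (hF : IsBoundedMeasurable F) (a : m) (b : n) : Integrable (fun ω => F ω a b) μ := by
  obtain ⟨h, C, hC⟩ := hF a b
  exact Integrable.of_bound h.aestronglyMeasurable C (ae_of_all _ fun ω => hC ω)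

theorem integrable_trace [Fintype n] {μ : Measure Ω} [IsFiniteMeasure μ]
    {F : Ω → Matrix n n ℝ} (hF : IsBoundedMeasurable F) :
    Integrable (fun ω => (F ω).trace) μ :=
  integrable_finsetSum _ fun i _ => hF.integrable i i

end IsBoundedMeasurable

end BoundedMatrix

/-! ### Trace moments of centered sums of rank-one matrices. -/

section MomentRecursion

variable {S ι : Type*} [MeasurableSpace S] [Fintype ι] [DecidableEq ι]

/-- The second moment matrix `E[c(z) c(z)']`. -/
def secondMoment (ν : Measure S) (c : S → ι → ℝ) : Matrix ι ι ℝ :=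
  Matrix.of fun a b => ∫ z, c z a * c z b ∂ν

/-- The centered sum `∑ i, (c(zᵢ) c(zᵢ)' - E[c c'])`. -/
def centeredSum (ν : Measure S) (c : S → ι → ℝ) {n : ℕ} (z : Fin n → S) : Matrix ι ι ℝ :=
  ∑ i, (vecMulVec (c (z i)) (c (z i)) - secondMoment ν c)

omit [Fintype ι] [DecidableEq ι] in
theorem isSymm_vecMulVec_self (v : ι → ℝ) : (vecMulVec v v).IsSymm := transpose_vecMulVec v v

omit [Fintype ι] [DecidableEq ι] in
theorem isSymm_secondMoment (ν : Measure S) (c : S → ι → ℝ) : (secondMoment ν c).IsSymm := by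
  ext a b
  simp only [secondMoment, transpose_apply, of_apply, mul_comm]

omit [Fintype ι] [DecidableEq ι] in
theorem isSymm_centeredSum (ν : Measure S) (c : S → ι → ℝ) {n : ℕ} (z : Fin n → S) :
    (centeredSum ν c z).IsSymm := by
  rw [centeredSum, Matrix.IsSymm, transpose_sum]
  exact Finset.sum_congr rfl fun i _ =>
    ((isSymm_vecMulVec_self _).sub (isSymm_secondMoment ν c)).eq

omit [DecidableEq ι] in
theorem isBoundedMeasurable_vecMulVec {c : S → ι → ℝ} (hc : ∀ a, Measurable fun z => c z a)
    {R : ℝ} (hR : ∀ z, c z ⬝ᵥ c z ≤ R) :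
    IsBoundedMeasurable fun z => vecMulVec (c z) (c z) := fun a b => by
  refine ⟨(hc a).mul (hc b), R, fun z => ?_⟩
  have h : ∀ a, c z a * c z a ≤ R := fun a => by
    refine le_trans ?_ (hR z)
    exact Finset.single_le_sum (f := fun a => c z a * c z a) (fun a _ => mul_self_nonneg _)
      (Finset.mem_univ a)
  beta_reduce
  rw [vecMulVec_apply, abs_le]
  constructor
  · nlinarith [h a, h b, mul_self_nonneg (c z a + c z b)]
  · nlinarith [h a, h b, mul_self_nonneg (c z a - c z b)]

omit [DecidableEq ι] in
theorem isBoundedMeasurable_centeredSum (ν : Measure S) {c : S → ι → ℝ}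
    (hc : ∀ a, Measurable fun z => c z a) {R : ℝ} (hR : ∀ z, c z ⬝ᵥ c z ≤ R) (n : ℕ) :
    IsBoundedMeasurable fun z : Fin n → S => centeredSum ν c z :=
  IsBoundedMeasurable.sum _ fun i _ =>
    ((isBoundedMeasurable_vecMulVec hc hR).comp (measurable_pi_apply i)).sub (.const _)

/-- The parallelogram identity, with the nonnegative term in `H + H'` dropped. -/
theorem trace_conj_sub_le {X H H' : Matrix ι ι ℝ} (hX : X.IsSymm) (hH : H.IsSymm)
    (hH' : H'.IsSymm) (m : ℕ) :
    ((H - H') * X ^ (2 * m) * (H - H')).trace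
      ≤ 2 * ((H * X ^ (2 * m) * H).trace + (H' * X ^ (2 * m) * H').trace) := by
  have h := trace_transpose_mul_self_nonneg (X ^ m * (H + H'))
  rw [transpose_mul, transpose_add, hH.eq, hH'.eq, transpose_pow, hX.eq,
    show (H + H') * X ^ m * (X ^ m * (H + H')) = (H + H') * (X ^ m * X ^ m) * (H + H') by
      simp only [Matrix.mul_assoc], ← pow_add, ← two_mul] at h
  have e : (H - H') * X ^ (2 * m) * (H - H') + (H + H') * X ^ (2 * m) * (H + H')
      = (2 : ℝ) • (H * X ^ (2 * m) * H + H' * X ^ (2 * m) * H') := by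
    simp only [Matrix.sub_mul, Matrix.mul_sub, Matrix.add_mul, Matrix.mul_add]
    module
  have e' := congrArg trace e
  rw [trace_add, trace_smul, trace_add, smul_eq_mul] at e'
  linarith

theorem trace_vecMulVec_mul_pow_nonneg {X : Matrix ι ι ℝ} (hX : X.IsSymm) (v : ι → ℝ) (m : ℕ) :
    0 ≤ (vecMulVec v v * X ^ (2 * m)).trace := by
  rw [trace_mul_comm, mul_vecMulVec, trace_vecMulVec, two_mul, pow_add, ← mulVec_mulVec,
    dotProduct_comm, dotProduct_mulVec, ← mulVec_transpose, transpose_pow, hX.eq]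
  exact Finset.sum_nonneg fun i _ => mul_self_nonneg _

/-- Since `(v v')² = |v|² v v'`, the quadratic expression collapses to one linear in `v v'`, which
can then be averaged to the second moment matrix. -/
theorem trace_vecMulVec_conj_le {X : Matrix ι ι ℝ} (hX : X.IsSymm) (v : ι → ℝ) (m : ℕ) {R : ℝ}
    (hR : v ⬝ᵥ v ≤ R) :
    (vecMulVec v v * X ^ (2 * m) * vecMulVec v v).trace
      ≤ R * (vecMulVec v v * X ^ (2 * m)).trace := by
  have h : (vecMulVec v v * X ^ (2 * m) * vecMulVec v v).trace
      = (v ⬝ᵥ v) * (vecMulVec v v * X ^ (2 * m)).trace := by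
    rw [trace_mul_comm, ← Matrix.mul_assoc, vecMulVec_mul_vecMulVec, vecMulVec_smul,
      Matrix.smul_mul, trace_smul, smul_eq_mul]
  rw [h]
  exact mul_le_mul_of_nonneg_right hR (trace_vecMulVec_mul_pow_nonneg hX v m)

/-- The trace is the sum of the quadratic form of `G` over the rows of `X ^ m`. -/
theorem trace_mul_pow_even_le {G X : Matrix ι ι ℝ} (hX : X.IsSymm) {s : ℝ}
    (hG : ∀ x : ι → ℝ, x ⬝ᵥ (G *ᵥ x) ≤ s * (x ⬝ᵥ x)) (m : ℕ) :
    (G * X ^ (2 * m)).trace ≤ s * (X ^ (2 * m)).trace := by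
  have hZ := (isSymm_pow hX m).eq
  have e1 : (G * X ^ (2 * m)).trace = (X ^ m * (G * (X ^ m)ᵀ)).trace := by
    rw [hZ, two_mul, pow_add, ← Matrix.mul_assoc, trace_mul_comm]
  have e2 : (X ^ (2 * m)).trace = (X ^ m * (X ^ m)ᵀ).trace := by
    rw [hZ, two_mul, pow_add]
  rw [e1, e2, trace, trace, Finset.mul_sum]
  refine Finset.sum_le_sum fun i _ => ?_
  exact hG ((X ^ m) i)

variable (ν : Measure S) [IsProbabilityMeasure ν]

omit [Fintype ι] [DecidableEq ι] in
theorem measurePreserving_comp_perm {κ : Type*} [Fintype κ] (σ : Equiv.Perm κ) :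
    MeasurePreserving (fun z : κ → S => z ∘ σ) (Measure.pi fun _ => ν)
      (Measure.pi fun _ => ν) := by
  convert measurePreserving_piCongrLeft (fun _ : κ => ν) σ.symm using 1
  ext z i
  simp [MeasurableEquiv.piCongrLeft, Equiv.piCongrLeft, Equiv.piCongrLeft']

theorem integral_comp_perm {κ : Type*} [Fintype κ] (σ : Equiv.Perm κ) {f : (κ → S) → ℝ}
    (hf : Measurable f) :
    ∫ z, f (z ∘ σ) ∂(Measure.pi fun _ : κ => ν) = ∫ z, f z ∂(Measure.pi fun _ : κ => ν) := by
  have h := measurePreserving_comp_perm ν σ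
  conv_rhs => rw [← h.map_eq]
  rw [integral_map h.measurable.aemeasurable hf.aestronglyMeasurable]

/-- The last of `n + 1` coordinates plays the independent copy of a sample of size `n`. -/
theorem integral_last_mul_init {n : ℕ} (f : S → ℝ) (g : (Fin n → S) → ℝ) :
    ∫ z, f (z (Fin.last n)) * g (fun j => z j.castSucc) ∂(Measure.pi fun _ : Fin (n + 1) => ν)
      = (∫ z, f z ∂ν) * ∫ z, g z ∂(Measure.pi fun _ : Fin n => ν) := by
  have h := (measurePreserving_piFinSuccAbove (fun _ : Fin (n + 1) => ν) (Fin.last n)).integral_comp'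
    (fun p => f p.1 * g p.2)
  rw [integral_prod_mul] at h
  rw [← h]
  refine integral_congr_ae (ae_of_all _ fun z => ?_)
  simp [MeasurableEquiv.piFinSuccAbove, Fin.insertNthEquiv, Fin.init_def]

theorem integral_init {n : ℕ} (g : (Fin n → S) → ℝ) :
    ∫ z, g (fun j => z j.castSucc) ∂(Measure.pi fun _ : Fin (n + 1) => ν)
      = ∫ z, g z ∂(Measure.pi fun _ : Fin n => ν) := by
  simpa using integral_last_mul_init ν (fun _ => 1) g

omit [DecidableEq ι] in
/-- Replacing an independent copy by its second moment matrix inside a trace. -/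
theorem integral_trace_ghost_mul {c : S → ι → ℝ} (hc : ∀ a, Measurable fun z => c z a) {R : ℝ}
    (hR : ∀ z, c z ⬝ᵥ c z ≤ R) {n : ℕ} {K : (Fin n → S) → Matrix ι ι ℝ}
    (hK : IsBoundedMeasurable K) :
    ∫ z, (vecMulVec (c (z (Fin.last n))) (c (z (Fin.last n))) * K fun j => z j.castSucc).trace
        ∂(Measure.pi fun _ : Fin (n + 1) => ν)
      = ∫ z, (secondMoment ν c * K z).trace ∂(Measure.pi fun _ : Fin n => ν) := by
  have hcast : Measurable fun (z : Fin (n + 1) → S) (j : Fin n) => z j.castSucc :=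
    measurable_pi_lambda _ fun j => measurable_pi_apply _
  have hH := (isBoundedMeasurable_vecMulVec hc hR)
  simp only [trace, diag_apply]
  rw [integral_finsetSum, integral_finsetSum]
  · refine Finset.sum_congr rfl fun a _ => ?_
    simp only [Matrix.mul_apply]
    rw [integral_finsetSum, integral_finsetSum]
    · refine Finset.sum_congr rfl fun b _ => ?_
      rw [integral_last_mul_init ν (fun z => vecMulVec (c z) (c z) a b) (fun z => K z b a),
        integral_const_mul]
      rfl
    · exact fun b _ => (hK.integrable b a).const_mul _
    · intro b _
      obtain ⟨h, C, hC⟩ := hH a b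
      exact ((hK.comp hcast).integrable b a).bdd_mul
        (h.comp (measurable_pi_apply _)).aestronglyMeasurable (ae_of_all _ fun z => hC _)
  · exact fun a _ => ((IsBoundedMeasurable.const _).mul hK).integrable a a
  · exact fun a _ => ((hH.comp (measurable_pi_apply _)).mul (hK.comp hcast)).integrable a a


/-- One step of the moment recursion for centered sums of rank-one matrices, by exchanging one
summand with an independent copy. -/
theorem integral_trace_pow_succ_le {c : S → ι → ℝ} (hc : ∀ a, Measurable fun z => c z a) {R : ℝ}
    (hR0 : 0 < R) (hR : ∀ z, c z ⬝ᵥ c z ≤ R) {s : ℝ}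
    (hs : ∀ x : ι → ℝ, x ⬝ᵥ (secondMoment ν c *ᵥ x) ≤ s * (x ⬝ᵥ x)) (n m : ℕ) :
    ∫ z, (centeredSum ν c z ^ (2 * m + 2)).trace ∂(Measure.pi fun _ : Fin n => ν)
      ≤ (((2 * m + 1) * R) ^ 2 + 4 * n * s * ((2 * m + 1) * R)) *
        ∫ z, (centeredSum ν c z ^ (2 * m)).trace ∂(Measure.pi fun _ : Fin n => ν) := by
  set μ := Measure.pi fun _ : Fin n => ν with hμ
  set μ' := Measure.pi fun _ : Fin (n + 1) => ν with hμ'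
  set G := secondMoment ν c with hG
  set X : (Fin n → S) → Matrix ι ι ℝ := fun z => centeredSum ν c z with hXdef
  set H : S → Matrix ι ι ℝ := fun z => vecMulVec (c z) (c z) with hHdef
  set e : (Fin (n + 1) → S) → Fin n → S := fun z j => z j.castSucc with he
  have he_meas : Measurable e := measurable_pi_lambda _ fun j => measurable_pi_apply _
  have hXs : ∀ z, (X z).IsSymm := isSymm_centeredSum ν c
  have hX : IsBoundedMeasurable X := isBoundedMeasurable_centeredSum ν hc hR n
  have hH : IsBoundedMeasurable H := isBoundedMeasurable_vecMulVec hc hR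
  have hHi : ∀ k, IsBoundedMeasurable fun z : Fin (n + 1) → S => H (z k) :=
    fun k => hH.comp (measurable_pi_apply k)
  have hXe : IsBoundedMeasurable fun z => X (e z) := hX.comp he_meas
  set θ : ℝ := (2 * m + 1) * R with hθ
  have hθ0 : 0 < θ := by positivity
  -- the contribution of the summand `i`
  have hB : ∀ i : Fin n,
      ∫ z, ((H (z i) - G) * X z ^ (2 * m + 1)).trace ∂μ
        ≤ θ * (∫ z, (H (z i) * X z ^ (2 * m)).trace ∂μ + ∫ z, (G * X z ^ (2 * m)).trace ∂μ) := by
    intro i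
    set σ : Equiv.Perm (Fin (n + 1)) := Equiv.swap i.castSucc (Fin.last n) with hσ
    set D : (Fin (n + 1) → S) → Matrix ι ι ℝ :=
      fun z => H (z i.castSucc) - H (z (Fin.last n)) with hD
    have hDb : IsBoundedMeasurable D := (hHi _).sub (hHi _)
    have hperm : Measurable fun z : Fin (n + 1) → S => z ∘ σ :=
      (measurePreserving_comp_perm ν σ).measurable
    have hYe : IsBoundedMeasurable fun z : Fin (n + 1) → S => X (e (z ∘ σ)) := hXe.comp hperm
    have hDswap : ∀ z, D (z ∘ σ) = -D z := fun z => by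
      simp [hD, hσ]
    have hdiff : ∀ z, X (e z) - X (e (z ∘ σ)) = D z := fun z => by
      simp only [hXdef, centeredSum, ← Finset.sum_sub_distrib]
      rw [Finset.sum_eq_single i]
      · simp [he, hD, hσ, hHdef]
      · intro j _ hj
        have h1 : j.castSucc ≠ i.castSucc := fun h => hj (Fin.castSucc_injective n h)
        have h2 : j.castSucc ≠ Fin.last n := (Fin.castSucc_lt_last j).ne
        simp [he, hσ, Equiv.swap_apply_of_ne_of_ne h1 h2]
      · simp
    have hghost := fun (q : ℕ) => integral_trace_ghost_mul ν hc hR (hX.pow q)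
    -- replace the mean by the independent copy
    have h1 : ∫ z, ((H (z i) - G) * X z ^ (2 * m + 1)).trace ∂μ
        = ∫ z, (D z * X (e z) ^ (2 * m + 1)).trace ∂μ' := by
      have hl : ∫ z, ((H (z i) - G) * X z ^ (2 * m + 1)).trace ∂μ
          = ∫ z, (H (z i) * X z ^ (2 * m + 1)).trace ∂μ
            - ∫ z, (G * X z ^ (2 * m + 1)).trace ∂μ := by
        rw [← integral_sub (((hH.comp (measurable_pi_apply i)).mul (hX.pow _)).integrable_trace)
          (((IsBoundedMeasurable.const G).mul (hX.pow _)).integrable_trace)]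
        simp only [Matrix.sub_mul, trace_sub]
      rw [hl, ← hghost, ← integral_init ν fun z => (H (z i) * X z ^ (2 * m + 1)).trace,
        ← integral_sub]
      · simp only [hD, Matrix.sub_mul, trace_sub]
        rfl
      · exact ((hHi _).mul (hXe.pow _)).integrable_trace
      · exact ((hHi _).mul (hXe.pow _)).integrable_trace
    have hmeas : ∀ {F : (Fin (n + 1) → S) → Matrix ι ι ℝ}, IsBoundedMeasurable F →
        Measurable fun z => (F z).trace := fun hF =>
      Finset.measurable_sum _ fun a _ => (hF a a).1
    -- Swapping observation `i` with the copy preserves the law, flips the sign of `D` and replaces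
    -- `X` by a matrix differing from it by exactly `D`. Twice the integral is therefore that of `D`
    -- times a difference of odd powers.
    have h2 : ∫ z, (D z * X (e z) ^ (2 * m + 1)).trace ∂μ'
        = -∫ z, (D z * X (e (z ∘ σ)) ^ (2 * m + 1)).trace ∂μ' := by
      rw [← integral_comp_perm ν σ (hmeas (hDb.mul (hXe.pow _))), ← integral_neg]
      simp only [hDswap, Matrix.neg_mul, trace_neg]
      rfl
    have h3 : ∫ z, (D z * X (e (z ∘ σ)) ^ (2 * m) * D z).trace ∂μ'
        = ∫ z, (D z * X (e z) ^ (2 * m) * D z).trace ∂μ' := by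
      rw [← integral_comp_perm ν σ (hmeas ((hDb.mul (hXe.pow _)).mul hDb))]
      simp only [hDswap, Matrix.neg_mul, Matrix.mul_neg, neg_neg]
      rfl
    have hi1 := ((hDb.mul (hXe.pow (2 * m + 1))).integrable_trace (μ := μ'))
    have hi2 := ((hDb.mul (hYe.pow (2 * m + 1))).integrable_trace (μ := μ'))
    have hi3 := (((hDb.mul (hXe.pow (2 * m))).mul hDb).integrable_trace (μ := μ'))
    have hi4 := (((hDb.mul (hYe.pow (2 * m))).mul hDb).integrable_trace (μ := μ'))
    have hi5 := (((hHi i.castSucc).mul (hXe.pow (2 * m))).integrable_trace (μ := μ'))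
    have hi6 := (((hHi (Fin.last n)).mul (hXe.pow (2 * m))).integrable_trace (μ := μ'))
    have h4 : 2 * (∫ z, (D z * X (e z) ^ (2 * m + 1)).trace ∂μ'
          - ∫ z, (D z * X (e (z ∘ σ)) ^ (2 * m + 1)).trace ∂μ')
        ≤ (2 * m + 1) * (∫ z, (D z * X (e z) ^ (2 * m) * D z).trace ∂μ'
          + ∫ z, (D z * X (e (z ∘ σ)) ^ (2 * m) * D z).trace ∂μ') := by
      rw [← integral_sub hi1 hi2, ← integral_add hi3 hi4, ← integral_const_mul,
        ← integral_const_mul]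
      refine integral_mono ((hi1.sub hi2).const_mul _) ((hi3.add hi4).const_mul _) fun z => ?_
      have := two_mul_trace_mul_pow_sub_pow_le (hXs (e z)) (hXs (e (z ∘ σ))) m
      rw [hdiff] at this
      simpa only [Matrix.mul_sub, trace_sub] using this
    have h5 : ∫ z, (D z * X (e z) ^ (2 * m) * D z).trace ∂μ'
        ≤ 2 * R * (∫ z, (H (z i.castSucc) * X (e z) ^ (2 * m)).trace ∂μ'
          + ∫ z, (H (z (Fin.last n)) * X (e z) ^ (2 * m)).trace ∂μ') := by
      rw [← integral_add hi5 hi6, ← integral_const_mul]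
      refine integral_mono hi3 ((hi5.add hi6).const_mul _) fun z => ?_
      refine (trace_conj_sub_le (hXs (e z)) (isSymm_vecMulVec_self _)
        (isSymm_vecMulVec_self _) m).trans ?_
      have a1 := trace_vecMulVec_conj_le (hXs (e z)) (c (z i.castSucc)) m (hR _)
      have a2 := trace_vecMulVec_conj_le (hXs (e z)) (c (z (Fin.last n))) m (hR _)
      simp only [hHdef]
      linarith
    have h6 : ∫ z, (H (z i.castSucc) * X (e z) ^ (2 * m)).trace ∂μ'
        = ∫ z, (H (z i) * X z ^ (2 * m)).trace ∂μ :=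
      integral_init ν fun z => (H (z i) * X z ^ (2 * m)).trace
    have h7 : ∫ z, (H (z (Fin.last n)) * X (e z) ^ (2 * m)).trace ∂μ'
        = ∫ z, (G * X z ^ (2 * m)).trace ∂μ := hghost (2 * m)
    rw [h6, h7] at h5
    rw [h3] at h4
    rw [h1]
    have h8 : 2 * (2 * ∫ z, (D z * X (e z) ^ (2 * m + 1)).trace ∂μ')
        ≤ (2 * m + 1) * (2 * ∫ z, (D z * X (e z) ^ (2 * m) * D z).trace ∂μ') := by
      linarith
    have h9 := mul_le_mul_of_nonneg_left h5 (show (0 : ℝ) ≤ 2 * m + 1 by positivity)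
    rw [hθ]
    linarith
  -- sum over the summands
  have hsum : ∀ q : ℕ, ∑ i : Fin n, ∫ z, (H (z i) * X z ^ q).trace ∂μ
      = ∫ z, (X z ^ (q + 1)).trace ∂μ + n * ∫ z, (G * X z ^ q).trace ∂μ := by
    intro q
    rw [← integral_finsetSum _ fun i _ =>
        ((hH.comp (measurable_pi_apply i)).mul (hX.pow _)).integrable_trace,
      ← integral_const_mul, ← integral_add (hX.pow _).integrable_trace
        (((IsBoundedMeasurable.const G).mul (hX.pow _)).integrable_trace.const_mul _)]
    refine integral_congr_ae (ae_of_all _ fun z => ?_)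
    have : X z = ∑ i, H (z i) - (n : ℝ) • G := by
      simp only [hXdef, centeredSum, hHdef, hG, Finset.sum_sub_distrib, Finset.sum_const,
        Finset.card_univ, Fintype.card_fin, Nat.cast_smul_eq_nsmul]
    simp only [pow_succ']
    rw [← trace_sum, ← Finset.sum_mul]
    nth_rewrite 2 [this]
    rw [Matrix.sub_mul, trace_sub, Matrix.smul_mul, trace_smul, smul_eq_mul]
    ring
  have htop : ∫ z, (X z ^ (2 * m + 2)).trace ∂μ
      = ∑ i : Fin n, ∫ z, ((H (z i) - G) * X z ^ (2 * m + 1)).trace ∂μ := by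
    rw [← integral_finsetSum _ fun i _ =>
        (((hH.comp (measurable_pi_apply i)).sub (.const G)).mul (hX.pow _)).integrable_trace]
    refine integral_congr_ae (ae_of_all _ fun z => ?_)
    beta_reduce
    rw [← trace_sum, ← Finset.sum_mul, pow_succ']
    rfl
  have hGle : ∫ z, (G * X z ^ (2 * m)).trace ∂μ ≤ s * ∫ z, (X z ^ (2 * m)).trace ∂μ := by
    rw [← integral_const_mul]
    exact integral_mono ((IsBoundedMeasurable.const G).mul (hX.pow _)).integrable_trace
      ((hX.pow _).integrable_trace.const_mul _) fun z => trace_mul_pow_even_le (hXs z) hs m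
  -- With this choice of `θ`, half of the top moment appears on the right of the final inequality
  -- and is absorbed, which doubles the remaining coefficients to `θ²` and `4 n s θ`.
  have hodd : 2 * θ * ∫ z, (X z ^ (2 * m + 1)).trace ∂μ
      ≤ ∫ z, (X z ^ (2 * m + 2)).trace ∂μ + θ ^ 2 * ∫ z, (X z ^ (2 * m)).trace ∂μ := by
    rw [← integral_const_mul, ← integral_const_mul, ← integral_add (hX.pow _).integrable_trace
      ((hX.pow _).integrable_trace.const_mul _)]
    exact integral_mono ((hX.pow _).integrable_trace.const_mul _)
      ((hX.pow _).integrable_trace.add ((hX.pow _).integrable_trace.const_mul _))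
      fun z => trace_pow_odd_le (hXs z) m θ
  have hall : ∫ z, (X z ^ (2 * m + 2)).trace ∂μ
      ≤ θ * (∫ z, (X z ^ (2 * m + 1)).trace ∂μ + 2 * n * ∫ z, (G * X z ^ (2 * m)).trace ∂μ) := by
    rw [htop]
    refine (Finset.sum_le_sum fun i _ => hB i).trans (le_of_eq ?_)
    rw [← Finset.mul_sum, Finset.sum_add_distrib, hsum]
    simp only [Finset.sum_const, Finset.card_univ, Fintype.card_fin, nsmul_eq_mul]
    ring
  have hfin := mul_le_mul_of_nonneg_left hGle (show 0 ≤ 2 * (n : ℝ) * θ by positivity)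
  linarith

/-- The recursion is iterated `p` times from `tr 1 = card ι`, with every factor `2 m + 1` enlarged
to `2 p`. -/
theorem integral_trace_pow_le {c : S → ι → ℝ} (hc : ∀ a, Measurable fun z => c z a) {R : ℝ}
    (hR0 : 0 < R) (hR : ∀ z, c z ⬝ᵥ c z ≤ R) {s : ℝ} (hs0 : 0 ≤ s)
    (hs : ∀ x : ι → ℝ, x ⬝ᵥ (secondMoment ν c *ᵥ x) ≤ s * (x ⬝ᵥ x)) (n p : ℕ) :
    ∫ z, (centeredSum ν c z ^ (2 * p)).trace ∂(Measure.pi fun _ : Fin n => ν)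
      ≤ Fintype.card ι * ((2 * p * R) ^ 2 + 4 * n * s * (2 * p * R)) ^ p := by
  have key : ∀ m ≤ p, ∫ z, (centeredSum ν c z ^ (2 * m)).trace ∂(Measure.pi fun _ : Fin n => ν)
      ≤ Fintype.card ι * ((2 * p * R) ^ 2 + 4 * n * s * (2 * p * R)) ^ m := by
    intro m
    induction m with
    | zero => intro _; simp
    | succ m ih =>
      intro hm
      refine (integral_trace_pow_succ_le ν hc hR0 hR hs n m).trans ?_
      have hmp : (2 * m + 1 : ℝ) ≤ 2 * p := by
        have : ((m + 1 : ℕ) : ℝ) ≤ p := Nat.cast_le.2 hm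
        push_cast at this
        linarith
      have hθ : (2 * m + 1 : ℝ) * R ≤ 2 * p * R := mul_le_mul_of_nonneg_right hmp hR0.le
      have h0 : 0 ≤ ∫ z, (centeredSum ν c z ^ (2 * m)).trace ∂(Measure.pi fun _ : Fin n => ν) :=
        integral_nonneg fun z => trace_pow_even_nonneg (isSymm_centeredSum ν c z) m
      calc _ ≤ ((2 * p * R) ^ 2 + 4 * n * s * (2 * p * R)) *
            ∫ z, (centeredSum ν c z ^ (2 * m)).trace ∂(Measure.pi fun _ : Fin n => ν) := by
            gcongr
        _ ≤ ((2 * p * R) ^ 2 + 4 * n * s * (2 * p * R)) *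
            (Fintype.card ι * ((2 * p * R) ^ 2 + 4 * n * s * (2 * p * R)) ^ m) := by
            gcongr
            exact ih (by omega)
        _ = _ := by ring
  exact key p le_rfl

end MomentRecursion

/-! ### Tail bound for the operator norm of a centered sum. -/

section Concentration

variable {Ω S ι : Type*} [MeasurableSpace Ω] [MeasurableSpace S] [Fintype ι] [DecidableEq ι]

theorem map_sample_eq_pi {P : Measure Ω} [IsProbabilityMeasure P] {Z : ℕ → Ω → S}
    (hZ : ∀ i, Measurable (Z i)) (hind : iIndepFun Z P) (hid : ∀ i, IdentDistrib (Z i) (Z 0) P P)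
    (n : ℕ) :
    P.map (fun ω (i : Fin n) => Z i ω) = Measure.pi fun _ : Fin n => P.map (Z 0) := by
  have h := hind.precomp (g := fun i : Fin n => (i : ℕ)) Fin.val_injective
  rw [iIndepFun_iff_map_fun_eq_pi_map fun i : Fin n => (hZ i).aemeasurable] at h
  simpa only [(hid _).map_eq] using h

theorem measure_opNorm_centeredSum_gt_le_of_bounded {P : Measure Ω} [IsProbabilityMeasure P]
    {Z : ℕ → Ω → S} (hZ : ∀ i, Measurable (Z i)) (hind : iIndepFun Z P)
    (hid : ∀ i, IdentDistrib (Z i) (Z 0) P P) {c : S → ι → ℝ}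
    (hc : ∀ a, Measurable fun z => c z a) {R : ℝ} (hR0 : 0 < R) (hR : ∀ z, c z ⬝ᵥ c z ≤ R)
    {s : ℝ} (hs0 : 0 ≤ s)
    (hs : ∀ x : ι → ℝ, x ⬝ᵥ (secondMoment (P.map (Z 0)) c *ᵥ x) ≤ s * (x ⬝ᵥ x)) (n : ℕ) {p : ℕ}
    (hp : p ≠ 0) {t : ℝ} (ht : 0 < t) :
    P {ω | ∃ u : ι → ℝ, t ^ 2 * (u ⬝ᵥ u) <
        (centeredSum (P.map (Z 0)) c (fun i : Fin n => Z i ω) *ᵥ u) ⬝ᵥ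
          (centeredSum (P.map (Z 0)) c (fun i : Fin n => Z i ω) *ᵥ u)}
      ≤ ENNReal.ofReal
        (Fintype.card ι * (((2 * p * R) ^ 2 + 4 * n * s * (2 * p * R)) / t ^ 2) ^ p) := by
  set ν := P.map (Z 0) with hν
  have : IsProbabilityMeasure ν := Measure.isProbabilityMeasure_map (hZ 0).aemeasurable
  have hbm := (isBoundedMeasurable_centeredSum ν hc hR n).pow (2 * p)
  have hmeas : Measurable fun z : Fin n → S => (centeredSum ν c z ^ (2 * p)).trace :=
    Finset.measurable_sum _ fun a _ => (hbm a a).1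
  have hZn : Measurable fun ω (i : Fin n) => Z i ω := measurable_pi_lambda _ fun i => hZ i
  -- The event quantified over all `u` sits inside a measurable trace event, to which Markov's
  -- inequality applies.
  have hsub : {ω | ∃ u : ι → ℝ, t ^ 2 * (u ⬝ᵥ u) <
        (centeredSum ν c (fun i : Fin n => Z i ω) *ᵥ u) ⬝ᵥ
          (centeredSum ν c (fun i : Fin n => Z i ω) *ᵥ u)}
      ⊆ (fun ω (i : Fin n) => Z i ω) ⁻¹'
        {z | t ^ (2 * p) ≤ (centeredSum ν c z ^ (2 * p)).trace} := by
    rintro ω ⟨u, hu⟩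
    by_contra hcon
    simp only [Set.mem_preimage, Set.mem_ofPred_eq, not_le] at hcon
    exact absurd (mulVec_dotProduct_le_of_trace_pow_le (isSymm_centeredSum ν c _) hp hcon.le u)
      (not_le.2 hu)
  refine (measure_mono hsub).trans ?_
  rw [← Measure.map_apply hZn (measurableSet_le measurable_const hmeas),
    map_sample_eq_pi hZ hind hid n]
  have hmarkov := mul_meas_ge_le_integral_of_nonneg (μ := Measure.pi fun _ : Fin n => ν)
    (ae_of_all _ fun z => trace_pow_even_nonneg (isSymm_centeredSum ν c z) p)
    hbm.integrable_trace (t ^ (2 * p))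
  have hle := hmarkov.trans (integral_trace_pow_le ν hc hR0 hR hs0 hs n p)
  rw [← ENNReal.ofReal_toReal (measure_ne_top (Measure.pi fun _ : Fin n => ν) _)]
  refine ENNReal.ofReal_le_ofReal ?_
  rw [div_pow, ← pow_mul, ← mul_div_assoc, le_div_iff₀ (by positivity), mul_comm]
  exact hle

/-- A matrix concentration inequality for sums of independent identically distributed rank-one
matrices. -/
theorem measure_opNorm_centeredSum_gt_le {P : Measure Ω} [IsProbabilityMeasure P]
    {Z : ℕ → Ω → S} (hZ : ∀ i, Measurable (Z i)) (hind : iIndepFun Z P)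
    (hid : ∀ i, IdentDistrib (Z i) (Z 0) P P) {c : S → ι → ℝ}
    (hc : ∀ a, Measurable fun z => c z a) {R : ℝ} (hR0 : 0 < R)
    (hR : ∀ᵐ z ∂(P.map (Z 0)), c z ⬝ᵥ c z ≤ R) {s : ℝ} (hs0 : 0 ≤ s)
    (hs : ∀ x : ι → ℝ, x ⬝ᵥ (secondMoment (P.map (Z 0)) c *ᵥ x) ≤ s * (x ⬝ᵥ x)) (n : ℕ) {p : ℕ}
    (hp : p ≠ 0) {t : ℝ} (ht : 0 < t) :
    P {ω | ∃ u : ι → ℝ, t ^ 2 * (u ⬝ᵥ u) <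
        (centeredSum (P.map (Z 0)) c (fun i : Fin n => Z i ω) *ᵥ u) ⬝ᵥ
          (centeredSum (P.map (Z 0)) c (fun i : Fin n => Z i ω) *ᵥ u)}
      ≤ ENNReal.ofReal
        (Fintype.card ι * (((2 * p * R) ^ 2 + 4 * n * s * (2 * p * R)) / t ^ 2) ^ p) := by
  classical
  -- Truncation makes the almost sure bound a pointwise one, and changes the moments and the sample
  -- only on null sets.
  set c' : S → ι → ℝ := fun z => if c z ⬝ᵥ c z ≤ R then c z else 0 with hc'
  have hcc : ∀ᵐ z ∂(P.map (Z 0)), c' z = c z := by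
    filter_upwards [hR] with z hz
    simp [hc', hz]
  have hset : MeasurableSet {z | c z ⬝ᵥ c z ≤ R} :=
    measurableSet_le (Finset.measurable_sum _ fun a _ => (hc a).mul (hc a)) measurable_const
  have hcm : ∀ a, Measurable fun z => c' z a := fun a => by
    have : (fun z => c' z a) = fun z => if c z ⬝ᵥ c z ≤ R then c z a else 0 := by
      ext z
      simp only [hc']
      split_ifs <;> rfl
    rw [this]
    exact Measurable.ite hset (hc a) measurable_const
  have hR' : ∀ z, c' z ⬝ᵥ c' z ≤ R := fun z => by
    simp only [hc']
    split_ifs with h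
    · exact h
    · simpa using hR0.le
  have hmom : secondMoment (P.map (Z 0)) c' = secondMoment (P.map (Z 0)) c := by
    ext a b
    simp only [secondMoment, of_apply]
    refine integral_congr_ae ?_
    filter_upwards [hcc] with z hz
    rw [hz]
  have hall : ∀ᵐ ω ∂P, ∀ i, c' (Z i ω) = c (Z i ω) := by
    refine ae_all_iff.2 fun i => ?_
    rw [← (hid i).map_eq] at hcc
    exact ae_of_ae_map (hZ i).aemeasurable hcc
  refine le_trans (measure_mono_ae ?_) (measure_opNorm_centeredSum_gt_le_of_bounded hZ hind hid
    hcm hR0 hR' hs0 (by rw [hmom]; exact hs) n hp ht)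
  filter_upwards [hall] with ω hω
  have : centeredSum (P.map (Z 0)) c' (fun i : Fin n => Z i ω)
      = centeredSum (P.map (Z 0)) c (fun i : Fin n => Z i ω) := by
    simp only [centeredSum, hmom, hω]
  rintro ⟨u, hu⟩
  exact ⟨u, by rw [this]; exact hu⟩

end Concentration

/-! ### Deterministic stability of two-stage least squares. -/

section TwoStageLeastSquares

variable {m n : Type*} [Fintype m] [Fintype n]

/-- The difference `D` of the two sides satisfies `D A = 0`, and its transpose factors as `A` times
a matrix, so `D D' = 0`. Hence the normal equations are solved whichever generalized inverse is
taken. -/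
theorem gram_mul_ginv_mul_transpose {A : Matrix m n ℝ} {N : Matrix n n ℝ}
    (h : Aᵀ * A * N * (Aᵀ * A) = Aᵀ * A) : Aᵀ * A * N * Aᵀ = Aᵀ := by
  classical
  have h0 : (Aᵀ * A * N * Aᵀ - Aᵀ) * A = 0 := by
    rw [Matrix.sub_mul, Matrix.mul_assoc _ Aᵀ A, h, sub_self]
  have h1 : (Aᵀ * A * N * Aᵀ - Aᵀ) * (Aᵀ * A * N * Aᵀ - Aᵀ)ᵀ = 0 := by
    have : (Aᵀ * A * N * Aᵀ - Aᵀ)ᵀ = A * (Nᵀ * (Aᵀ * A) - 1) := by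
      simp only [transpose_sub, transpose_mul, transpose_transpose, Matrix.mul_sub,
        Matrix.mul_one, Matrix.mul_assoc]
    rw [this, ← Matrix.mul_assoc, h0, Matrix.zero_mul]
  rw [← Matrix.conjTranspose_eq_transpose_of_trivial (Aᵀ * A * N * Aᵀ - Aᵀ)] at h1
  exact sub_eq_zero.1 (Matrix.self_mul_conjTranspose_eq_zero.1 h1)

theorem mulVec_dotProduct_mulVec_transpose (A : Matrix m n ℝ) (x : n → ℝ) (y : m → ℝ) :
    (A *ᵥ x) ⬝ᵥ y = x ⬝ᵥ (Aᵀ *ᵥ y) := by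
  rw [dotProduct_comm, dotProduct_mulVec, ← mulVec_transpose, dotProduct_comm]

theorem dotProduct_self_sub_smul_nonneg (x y : m → ℝ) (t : ℝ) :
    0 ≤ x ⬝ᵥ x - 2 * t * (x ⬝ᵥ y) + t ^ 2 * (y ⬝ᵥ y) := by
  have h : 0 ≤ (x - t • y) ⬝ᵥ (x - t • y) := Finset.sum_nonneg fun i _ => mul_self_nonneg _
  simp only [sub_dotProduct, dotProduct_sub, smul_dotProduct, dotProduct_smul, smul_eq_mul,
    dotProduct_comm y x] at h
  linarith

/-- Stability of two-stage least squares: when the empirical Gram matrix of the instruments lies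
between `lo` and `hi`, the error of the coefficient vector is controlled, in the direction seen by
the instruments, by the instrumented residual. -/
theorem tslsCoef_stability
    {ginv : (k : ℕ) → Matrix (Fin k) (Fin k) ℝ → Matrix (Fin k) (Fin k) ℝ}
    (hg : IsGeneralizedInverse ginv) {n J K : ℕ} (Ψ : Matrix (Fin n) (Fin J) ℝ)
    (B : Matrix (Fin n) (Fin K) ℝ) (Q R : Matrix (Fin K) (Fin K) ℝ) (hQR : Q * R = 1)
    {lo hi : ℝ} (hhi : 0 < hi)
    (h_lo : ∀ g, lo * (g ⬝ᵥ g) ≤ ((B * Q) *ᵥ g) ⬝ᵥ ((B * Q) *ᵥ g))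
    (h_hi : ∀ g, ((B * Q) *ᵥ g) ⬝ᵥ ((B * Q) *ᵥ g) ≤ hi * (g ⬝ᵥ g))
    (hlo : 0 < lo) (y : Fin n → ℝ) (c : Fin J → ℝ) :
    lo * (((B * Q)ᵀ *ᵥ (Ψ *ᵥ (tslsCoef ginv Ψ B y - c))) ⬝ᵥ
        ((B * Q)ᵀ *ᵥ (Ψ *ᵥ (tslsCoef ginv Ψ B y - c))))
      ≤ hi * (((B * Q)ᵀ *ᵥ (y - Ψ *ᵥ c)) ⬝ᵥ ((B * Q)ᵀ *ᵥ (y - Ψ *ᵥ c))) := by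
  set N := ginv K (Bᵀ * B) with hN
  set Pm := B * N * Bᵀ with hPm
  set a := tslsCoef ginv Ψ B y - c with ha
  set e := y - Ψ *ᵥ c with he
  -- This identity alone makes `Pm` the orthogonal projection onto the column space of `B`: it
  -- yields `Pm' Pm = Pm'`, whose left side is symmetric.
  have hB : Bᵀ * Pm = Bᵀ := by
    have := gram_mul_ginv_mul_transpose (A := B) (N := N) (hg K (Bᵀ * B))
    rw [hPm]
    simpa only [Matrix.mul_assoc] using this
  have hPP : Pmᵀ * Pm = Pmᵀ := by
    have ht : Pmᵀ = B * Nᵀ * Bᵀ := by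
      simp only [hPm, transpose_mul, transpose_transpose, Matrix.mul_assoc]
    rw [ht, Matrix.mul_assoc, hB]
  have hsym : Pmᵀ = Pm := by
    have := congrArg transpose hPP
    rw [transpose_mul, transpose_transpose, hPP] at this
    exact this
  rw [hsym] at hPP
  set Φ := Pm * Ψ with hΦ
  have hΦt : Φᵀ = Ψᵀ * Pm := by rw [hΦ, transpose_mul, hsym]
  have hΦΦ : Φᵀ * Φ = Ψᵀ * B * N * Bᵀ * Ψ := by
    rw [hΦt, hΦ, Matrix.mul_assoc, ← Matrix.mul_assoc Pm, hPP, hPm]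
    simp only [Matrix.mul_assoc]
  have hΦΨ : Φᵀ * Ψ = Φᵀ * Φ := by
    rw [hΦΦ, hΦt, hPm]
    simp only [Matrix.mul_assoc]
  have hnormal : Φᵀ *ᵥ (Φ *ᵥ a) = Φᵀ *ᵥ e := by
    have h1 : tslsCoef ginv Ψ B y = (ginv J (Φᵀ * Φ) * Φᵀ) *ᵥ y := by
      rw [tslsCoef, hΦΦ, hΦt, hPm]
      simp only [Matrix.mul_assoc, hN]
    have h2 : Φᵀ * Φ * ginv J (Φᵀ * Φ) * Φᵀ = Φᵀ := gram_mul_ginv_mul_transpose (hg J _)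
    rw [ha, he, mulVec_sub, mulVec_sub, mulVec_sub, h1, mulVec_mulVec, mulVec_mulVec,
      mulVec_mulVec, mulVec_mulVec, hΦΨ, ← Matrix.mul_assoc (Φᵀ * Φ), h2]
  have hPΦ : Pm * Φ = Φ := by rw [hΦ, ← Matrix.mul_assoc, hPP]
  -- `|Φ a| ≤ |P e|`
  have h1 : (Φ *ᵥ a) ⬝ᵥ (Φ *ᵥ a) = (Φ *ᵥ a) ⬝ᵥ (Pm *ᵥ e) := by
    rw [mulVec_dotProduct_mulVec_transpose, hnormal, ← mulVec_dotProduct_mulVec_transpose]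
    nth_rewrite 1 [← hPΦ]
    rw [← mulVec_mulVec, mulVec_dotProduct_mulVec_transpose, hsym]
  have h1' := dotProduct_self_sub_smul_nonneg (Φ *ᵥ a) (Pm *ᵥ e) 1
  -- `lo |P e|² ≤ |(BQ)' e|²`
  obtain ⟨g, hgPe⟩ : ∃ g, Pm *ᵥ e = (B * Q) *ᵥ g := by
    refine ⟨(R * N * Bᵀ) *ᵥ e, ?_⟩
    rw [mulVec_mulVec, hPm]
    congr 1
    calc B * N * Bᵀ = B * (Q * R) * N * Bᵀ := by rw [hQR, Matrix.mul_one]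
      _ = _ := by simp only [Matrix.mul_assoc]
  have h2 : (Pm *ᵥ e) ⬝ᵥ (Pm *ᵥ e) = ((B * Q)ᵀ *ᵥ e) ⬝ᵥ g := by
    have : (Pm *ᵥ e) ⬝ᵥ (Pm *ᵥ e) = (Pm *ᵥ e) ⬝ᵥ e := by
      rw [mulVec_dotProduct_mulVec_transpose, mulVec_mulVec, hsym, hPP, dotProduct_comm]
    rw [this, hgPe, mulVec_dotProduct_mulVec_transpose, dotProduct_comm]
  have h2' := dotProduct_self_sub_smul_nonneg ((B * Q)ᵀ *ᵥ e) g lo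
  have h2lo := h_lo g
  rw [← hgPe, h2] at h2lo
  -- `|w|² ≤ hi |Φ a|²` for `w = (BQ)' Ψ a`
  set w := (B * Q)ᵀ *ᵥ (Ψ *ᵥ a) with hw
  have hPB : Pm * (B * Q) = B * Q := by
    have := congrArg transpose hB
    rw [transpose_mul, transpose_transpose, hsym] at this
    rw [← Matrix.mul_assoc, this]
  have h3 : w ⬝ᵥ w = ((B * Q) *ᵥ w) ⬝ᵥ (Φ *ᵥ a) := by
    nth_rewrite 2 [hw]
    rw [← mulVec_dotProduct_mulVec_transpose, hΦ, ← mulVec_mulVec a Pm]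
    nth_rewrite 1 [← hPB]
    rw [← mulVec_mulVec w Pm, mulVec_dotProduct_mulVec_transpose, hsym]
  have h3' := dotProduct_self_sub_smul_nonneg ((B * Q) *ᵥ w) (Φ *ᵥ a) hi
  have h3hi := h_hi w
  rw [← h3] at h3'
  have h4 : w ⬝ᵥ w ≤ hi * ((Φ *ᵥ a) ⬝ᵥ (Φ *ᵥ a)) := by
    refine le_of_mul_le_mul_left ?_ hhi
    linarith
  have h5 : (Φ *ᵥ a) ⬝ᵥ (Φ *ᵥ a) ≤ ((B * Q)ᵀ *ᵥ e) ⬝ᵥ g := by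
    rw [← h1, h2] at h1'
    linarith
  have h6 : lo * (((B * Q)ᵀ *ᵥ e) ⬝ᵥ g) ≤ ((B * Q)ᵀ *ᵥ e) ⬝ᵥ ((B * Q)ᵀ *ᵥ e) := by
    nlinarith [mul_le_mul_of_nonneg_left h2lo hlo.le]
  calc lo * (w ⬝ᵥ w) ≤ lo * (hi * (((B * Q)ᵀ *ᵥ e) ⬝ᵥ g)) := by gcongr; exact h4.trans (by gcongr)
    _ = hi * (lo * (((B * Q)ᵀ *ᵥ e) ⬝ᵥ g)) := by ring
    _ ≤ _ := by gcongr

end TwoStageLeastSquares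

/-! ### The inverse square root of a Gram matrix. -/

section InverseSquareRoot

variable {J : ℕ} {G : Matrix (Fin J) (Fin J) ℝ}

theorem isSymm_invSqrt (G : Matrix (Fin J) (Fin J) ℝ) : (invSqrt G).IsSymm := by
  have h : IsSelfAdjoint (invSqrt G) := cfc_predicate _ G
  have h' : (invSqrt G)ᴴ = invSqrt G := h
  rwa [Matrix.conjTranspose_eq_transpose_of_trivial] at h'

theorem invSqrt_mul_mul_invSqrt (hG : G.PosDef) : invSqrt G * G * invSqrt G = 1 := by
  have hpos : ∀ t ∈ spectrum ℝ G, 0 < t := by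
    intro t ht
    rw [hG.isHermitian.spectrum_real_eq_range_eigenvalues] at ht
    obtain ⟨i, rfl⟩ := ht
    exact hG.eigenvalues_pos i
  have hsa : IsSelfAdjoint G := hG.isHermitian
  have hcont : ContinuousOn (fun t : ℝ => (√t)⁻¹) (spectrum ℝ G) :=
    Real.continuous_sqrt.continuousOn.inv₀ fun t ht => (Real.sqrt_pos.2 (hpos t ht)).ne'
  have h1 : invSqrt G * G * invSqrt G
      = cfc (fun t : ℝ => (√t)⁻¹ * t * (√t)⁻¹) G := by
    rw [cfc_mul (fun t : ℝ => (√t)⁻¹ * t) (fun t : ℝ => (√t)⁻¹) G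
        (hcont.mul continuousOn_id) hcont,
      cfc_mul (fun t : ℝ => (√t)⁻¹) (fun t : ℝ => t) G hcont continuousOn_id, cfc_id' ℝ G hsa]
    rfl
  rw [h1, cfc_congr (g := fun _ => (1 : ℝ)), cfc_const_one ℝ G]
  intro t ht
  have hs := Real.sqrt_pos.2 (hpos t ht)
  have hsq := Real.mul_self_sqrt (hpos t ht).le
  show (√t)⁻¹ * t * (√t)⁻¹ = 1
  field_simp
  nlinarith

/-- The product `G * invSqrt G` serves as `G^{1/2}`, which changes coefficients in the original
basis into whitened coordinates. -/
theorem invSqrt_mul_inverse (hG : G.PosDef) : invSqrt G * (G * invSqrt G) = 1 := by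
  rw [← Matrix.mul_assoc, invSqrt_mul_mul_invSqrt hG]

end InverseSquareRoot

/-! ### Orthonormalized bases and Fourier coefficients in the sieve space. -/

section Whitening

variable {α : Type*} [MeasurableSpace α] {J : ℕ} {μ : Measure α} {ψ : Fin J → α → ℝ}

/-- The orthonormalized basis functions `G^{-1/2} ψ(x)`. -/
def whiten (μ : Measure α) (ψ : Fin J → α → ℝ) (x : α) : Fin J → ℝ :=
  invSqrt (gram μ ψ) *ᵥ fun j => ψ j x

theorem measurable_whiten (hψ : ∀ j, Measurable (ψ j)) (j : Fin J) :
    Measurable fun x => whiten μ ψ x j := by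
  simp only [whiten, mulVec, dotProduct]
  exact Finset.measurable_sum _ fun k _ => (hψ k).const_mul _

theorem memLp_whiten (hψ : ∀ j, MemLp (ψ j) 2 μ) (j : Fin J) :
    MemLp (fun x => whiten μ ψ x j) 2 μ := by
  simp only [whiten, mulVec, dotProduct]
  exact memLp_finsetSum _ fun k _ => (hψ k).const_mul _

theorem memLp_dotProduct {f : α → Fin J → ℝ} (hf : ∀ j, MemLp (fun x => f x j) 2 μ)
    (a : Fin J → ℝ) : MemLp (fun x => f x ⬝ᵥ a) 2 μ := by
  simp only [dotProduct]
  exact memLp_finsetSum _ fun k _ => (hf k).mul_const _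

theorem integral_dotProduct_mul {f : α → Fin J → ℝ} (hf : ∀ j, MemLp (fun x => f x j) 2 μ)
    {g : α → ℝ} (hg : MemLp g 2 μ) (a : Fin J → ℝ) :
    ∫ x, (f x ⬝ᵥ a) * g x ∂μ = a ⬝ᵥ fun j => ∫ x, f x j * g x ∂μ := by
  simp only [dotProduct, Finset.sum_mul]
  rw [integral_finsetSum]
  · refine Finset.sum_congr rfl fun j _ => ?_
    rw [← integral_const_mul]
    exact integral_congr_ae (ae_of_all _ fun x => by ring)
  · exact fun j _ => ((hf j).mul_const (a j)).integrable_mul hg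

theorem integral_whiten_mul_whiten (hψ : ∀ j, MemLp (ψ j) 2 μ) (hG : (gram μ ψ).PosDef)
    (j k : Fin J) :
    ∫ x, whiten μ ψ x j * whiten μ ψ x k ∂μ = (1 : Matrix (Fin J) (Fin J) ℝ) j k := by
  set Q := invSqrt (gram μ ψ) with hQ
  have hsymm : ∀ i l, Q i l = Q l i := fun i l => congrFun (congrFun (isSymm_invSqrt (gram μ ψ)) l) i
  have h1 : ∫ x, whiten μ ψ x j * whiten μ ψ x k ∂μ
      = (Q j) ⬝ᵥ (gram μ ψ *ᵥ (Q k)) := by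
    have e1 := integral_dotProduct_mul hψ (memLp_whiten hψ k) (Q j)
    have e2 : ∀ i, ∫ x, ψ i x * whiten μ ψ x k ∂μ = (gram μ ψ *ᵥ (Q k)) i := fun i => by
      have := integral_dotProduct_mul hψ (hψ i) (Q k)
      simp only [mulVec, gram]
      rw [dotProduct_comm]
      simp only [of_apply]
      calc ∫ x, ψ i x * whiten μ ψ x k ∂μ
          = ∫ x, ((fun j => ψ j x) ⬝ᵥ Q k) * ψ i x ∂μ := by
            refine integral_congr_ae (ae_of_all _ fun x => ?_)
            simp only [whiten, mulVec, ← hQ, dotProduct_comm, mul_comm]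
        _ = _ := this
        _ = _ := by simp only [mul_comm]
    calc ∫ x, whiten μ ψ x j * whiten μ ψ x k ∂μ
        = ∫ x, ((fun j => ψ j x) ⬝ᵥ Q j) * whiten μ ψ x k ∂μ := by
          refine integral_congr_ae (ae_of_all _ fun x => ?_)
          simp only [whiten, mulVec, ← hQ, dotProduct_comm]
      _ = _ := by rw [e1]; simp only [e2]
  rw [h1, ← invSqrt_mul_mul_invSqrt hG, ← hQ, Matrix.mul_assoc, Matrix.mul_apply]
  refine Finset.sum_congr rfl fun i _ => ?_
  rw [Matrix.mul_apply]
  congr 1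
  show ∑ l, gram μ ψ i l * Q k l = _
  exact Finset.sum_congr rfl fun l _ => by rw [hsymm k l]

theorem integral_whiten_dotProduct_sq (hψ : ∀ j, MemLp (ψ j) 2 μ) (hG : (gram μ ψ).PosDef)
    (a : Fin J → ℝ) : ∫ x, (whiten μ ψ x ⬝ᵥ a) ^ 2 ∂μ = a ⬝ᵥ a := by
  have hw := memLp_whiten hψ
  simp only [sq]
  rw [integral_dotProduct_mul hw (memLp_dotProduct hw a)]
  congr 1
  ext j
  have : ∀ x, whiten μ ψ x j * (whiten μ ψ x ⬝ᵥ a) = (whiten μ ψ x ⬝ᵥ a) * whiten μ ψ x j :=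
    fun x => mul_comm _ _
  simp only [this]
  rw [integral_dotProduct_mul hw (hw j)]
  simp only [integral_whiten_mul_whiten hψ hG]
  simp [dotProduct, Matrix.one_apply]

theorem whiten_dotProduct (ψ : Fin J → α → ℝ) (x : α) (a : Fin J → ℝ) :
    whiten μ ψ x ⬝ᵥ a = ∑ j, ψ j x * (invSqrt (gram μ ψ) *ᵥ a) j := by
  rw [whiten, mulVec_dotProduct_mulVec_transpose, (isSymm_invSqrt (gram μ ψ)).eq]
  rfl

theorem enorm_toLp_sq {n : ℕ} (v : Fin n → ℝ) :
    ‖WithLp.toLp 2 v‖ₑ ^ 2 = ENNReal.ofReal (v ⬝ᵥ v) := by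
  rw [← ofReal_norm, ← ENNReal.ofReal_pow (norm_nonneg _), EuclideanSpace.norm_sq_eq]
  simp [dotProduct, sq]

theorem whiten_dotProduct_self_le {s : Set α} (h : zeta μ s ψ ≠ ⊤) {x : α} (hx : x ∈ s) :
    whiten μ ψ x ⬝ᵥ whiten μ ψ x ≤ (zeta μ s ψ).toReal ^ 2 := by
  have h1 : ‖WithLp.toLp 2 (whiten μ ψ x)‖ₑ ≤ zeta μ s ψ := le_iSup₂ (f := fun x _ =>
    ‖WithLp.toLp 2 (invSqrt (gram μ ψ) *ᵥ fun j => ψ j x)‖ₑ) x hx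
  have h2 := pow_le_pow_left' h1 2
  rw [enorm_toLp_sq] at h2
  rw [← ENNReal.toReal_pow]
  exact (ENNReal.ofReal_le_iff_le_toReal (by simp [h])).1 h2

theorem toLp_sum {κ : Type*} (s : Finset κ) {f : κ → α → ℝ} (hf : ∀ k, MemLp (f k) 2 μ)
    (a : κ → ℝ) {g : α → ℝ} (hg : MemLp g 2 μ) (hfg : ∀ x, g x = ∑ k ∈ s, f k x * a k) :
    hg.toLp g = ∑ k ∈ s, a k • (hf k).toLp (f k) := by
  refine Lp.ext ?_
  have h1 : ∀ᵐ x ∂μ, ∀ k ∈ s, (a k • (hf k).toLp (f k) : Lp ℝ 2 μ) x = a k * f k x := by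
    refine (s.eventually_all).2 fun k _ => ?_
    filter_upwards [Lp.coeFn_smul (a k) ((hf k).toLp (f k)), (hf k).coeFn_toLp] with x hx1 hx2
    rw [hx1, Pi.smul_apply, hx2, smul_eq_mul]
  filter_upwards [hg.coeFn_toLp, Lp.coeFn_finsetSum s fun k => a k • (hf k).toLp (f k), h1]
    with x hx1 hx2 hx3
  rw [hx1, hx2, hfg, Finset.sum_apply]
  exact Finset.sum_congr rfl fun k hk => by rw [hx3 k hk, mul_comm]

theorem mem_sieveSpace_of_whiten (hψ : ∀ j, MemLp (ψ j) 2 μ) (a : Fin J → ℝ)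
    (h : MemLp (fun x => whiten μ ψ x ⬝ᵥ a) 2 μ) : h.toLp _ ∈ sieveSpace ψ hψ := by
  rw [toLp_sum Finset.univ hψ (invSqrt (gram μ ψ) *ᵥ a) h fun x => whiten_dotProduct ψ x a]
  exact (Submodule.mem_span_range_iff_exists_fun ℝ).2 ⟨_, rfl⟩

theorem exists_whiten_of_mem_sieveSpace (hψ : ∀ j, MemLp (ψ j) 2 μ) (hG : (gram μ ψ).PosDef)
    {h : Lp ℝ 2 μ} (hh : h ∈ sieveSpace ψ hψ) :
    ∃ a, h = (memLp_dotProduct (memLp_whiten hψ) a).toLp _ := by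
  obtain ⟨c, rfl⟩ := (Submodule.mem_span_range_iff_exists_fun ℝ).1 hh
  refine ⟨(gram μ ψ * invSqrt (gram μ ψ)) *ᵥ c, ?_⟩
  rw [toLp_sum Finset.univ hψ _ _ fun x => whiten_dotProduct ψ x _, mulVec_mulVec,
    invSqrt_mul_inverse hG, one_mulVec]

theorem norm_toLp_sq {f : α → ℝ} (hf : MemLp f 2 μ) : ‖hf.toLp f‖ ^ 2 = ∫ x, f x ^ 2 ∂μ := by
  rw [← real_inner_self_eq_norm_sq, L2.inner_def]
  refine integral_congr_ae ?_
  filter_upwards [hf.coeFn_toLp] with x hx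
  rw [hx]
  simp [sq]

theorem inner_toLp_left {f : α → ℝ} (hf : MemLp f 2 μ) (y : Lp ℝ 2 μ) :
    inner ℝ (hf.toLp f) y = ∫ x, f x * y x ∂μ := by
  rw [L2.inner_def]
  refine integral_congr_ae ?_
  filter_upwards [hf.coeFn_toLp] with x hx
  rw [hx]
  simp [mul_comm]

theorem norm_toLp_whiten_sq (hψ : ∀ j, MemLp (ψ j) 2 μ) (hG : (gram μ ψ).PosDef)
    (a : Fin J → ℝ) :
    ‖(memLp_dotProduct (memLp_whiten hψ) a).toLp _‖ ^ 2 = a ⬝ᵥ a := by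
  rw [norm_toLp_sq, integral_whiten_dotProduct_sq hψ hG]

/-- The norm of a projection onto the sieve space in terms of generalized Fourier coefficients. -/
theorem norm_starProjection_sq_le (hψ : ∀ j, MemLp (ψ j) 2 μ) (hG : (gram μ ψ).PosDef)
    (y : Lp ℝ 2 μ) :
    ‖(sieveSpace ψ hψ).starProjection y‖ ^ 2
      ≤ (fun j => ∫ x, whiten μ ψ x j * y x ∂μ) ⬝ᵥ (fun j => ∫ x, whiten μ ψ x j * y x ∂μ) := by
  set v : Fin J → ℝ := fun j => ∫ x, whiten μ ψ x j * y x ∂μ with hv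
  set p := (sieveSpace ψ hψ).starProjection y with hp
  have hmem : p ∈ sieveSpace ψ hψ := Submodule.starProjection_apply_mem _ y
  obtain ⟨a, ha⟩ := exists_whiten_of_mem_sieveSpace hψ hG hmem
  have h1 : ‖p‖ ^ 2 = inner ℝ p y := by
    have := Submodule.starProjection_inner_eq_zero y p hmem
    rw [inner_sub_left, sub_eq_zero, real_inner_comm] at this
    rw [this, real_inner_self_eq_norm_sq]
  have h2 : inner ℝ p y = a ⬝ᵥ v := by
    rw [ha, inner_toLp_left, integral_dotProduct_mul (memLp_whiten hψ) (Lp.memLp y)]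
  have h3 : ‖p‖ ^ 2 = a ⬝ᵥ a := by rw [ha, norm_toLp_whiten_sq hψ hG]
  have h4 := dotProduct_self_sub_smul_nonneg v a 1
  rw [dotProduct_comm v a] at h4
  linarith

/-- Bessel's inequality. -/
theorem whiten_coef_dotProduct_self_le (hψ : ∀ j, MemLp (ψ j) 2 μ) (hG : (gram μ ψ).PosDef)
    (y : Lp ℝ 2 μ) :
    (fun j => ∫ x, whiten μ ψ x j * y x ∂μ) ⬝ᵥ (fun j => ∫ x, whiten μ ψ x j * y x ∂μ)
      ≤ ‖y‖ ^ 2 := by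
  set v : Fin J → ℝ := fun j => ∫ x, whiten μ ψ x j * y x ∂μ with hv
  set h := (memLp_dotProduct (memLp_whiten hψ) v).toLp _ with hh
  have h1 : inner ℝ h y = v ⬝ᵥ v := by
    rw [inner_toLp_left, integral_dotProduct_mul (memLp_whiten hψ) (Lp.memLp y)]
  have h2 : ‖h‖ ^ 2 = v ⬝ᵥ v := norm_toLp_whiten_sq hψ hG v
  have h3 : 0 ≤ ‖h - y‖ ^ 2 := sq_nonneg _
  rw [norm_sub_sq_real] at h3
  linarith

end Whitening

/-! ### Contraction and duality for conditional expectation. -/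

section Operator

variable {Ω α β : Type*} [MeasurableSpace Ω] [MeasurableSpace α] [MeasurableSpace β]
  [StandardBorelSpace α] [Nonempty α] (P : Measure Ω) [IsFiniteMeasure P] {X : Ω → α} {W : Ω → β}

theorem condExpFun_comp_ae_eq (hX : Measurable X) (hW : Measurable W) {f : α → ℝ}
    (hf : MemLp f 2 (P.map X)) :
    P[fun ω => f (X ω) | MeasurableSpace.comap W inferInstance]
      =ᵐ[P] fun ω => condExpFun P X W f (W ω) := by
  have hj : Measurable fun ω => (W ω, X ω) := hW.prodMk hX
  have hsnd : MeasurePreserving (Prod.snd : β × α → α) (P.map fun ω => (W ω, X ω)) (P.map X) :=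
    ⟨measurable_snd, by rw [Measure.map_map measurable_snd hj]; rfl⟩
  have hint : Integrable (fun p : β × α => f p.2) (P.map fun ω => (W ω, X ω)) :=
    (hf.comp_measurePreserving hsnd).integrable one_le_two
  exact condExp_prod_ae_eq_integral_condDistrib' hW hX.aemeasurable hint

theorem norm_condExpOp_le (hX : Measurable X) (hW : Measurable W) (h : Lp ℝ 2 (P.map X)) :
    ‖condExpOp P hX hW h‖ ≤ ‖h‖ := by
  have hm := memLp_condExpFun P hX hW (Lp.memLp h)
  rw [condExpOp, Lp.norm_toLp, Lp.norm_def]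
  refine ENNReal.toReal_mono (Lp.eLpNorm_ne_top h) ?_
  rw [eLpNorm_map_measure hm.1 hW.aemeasurable, eLpNorm_map_measure (Lp.memLp h).1 hX.aemeasurable]
  calc eLpNorm (condExpFun P X W h ∘ W) 2 P
      = eLpNorm (P[fun ω => h (X ω) | MeasurableSpace.comap W inferInstance]) 2 P :=
        eLpNorm_congr_ae (condExpFun_comp_ae_eq P hX hW (Lp.memLp h)).symm
    _ ≤ _ := eLpNorm_condExp_le_eLpNorm _ one_le_two

/-- Integrals of `T h` against a function of `W`. -/
theorem integral_mul_condExpOp (hX : Measurable X) (hW : Measurable W) {g : β → ℝ}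
    (hg : Measurable g) (hg2 : MemLp g 2 (P.map W)) {f : α → ℝ} (hf : MemLp f 2 (P.map X)) :
    ∫ w, g w * condExpOp P hX hW (hf.toLp f) w ∂(P.map W) = ∫ ω, g (W ω) * f (X ω) ∂P := by
  set h := hf.toLp f with hh
  have hm := memLp_condExpFun P hX hW (Lp.memLp h)
  have hXmp : MeasurePreserving X P (P.map X) := ⟨hX, rfl⟩
  have hWmp : MeasurePreserving W P (P.map W) := ⟨hW, rfl⟩
  have hfX : MemLp (fun ω => f (X ω)) 2 P := hf.comp_measurePreserving hXmp
  have hgW : MemLp (fun ω => g (W ω)) 2 P := hg2.comp_measurePreserving hWmp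
  have h1 : ∫ w, g w * condExpOp P hX hW h w ∂(P.map W)
      = ∫ w, g w * condExpFun P X W h w ∂(P.map W) := by
    refine integral_congr_ae ?_
    filter_upwards [hm.coeFn_toLp] with w hw
    rw [condExpOp, hw]
  have h2 : ∫ w, g w * condExpFun P X W h w ∂(P.map W)
      = ∫ ω, g (W ω) * condExpFun P X W h (W ω) ∂P :=
    integral_map hW.aemeasurable (hg.aestronglyMeasurable.mul hm.1)
  have h3 : ∀ᵐ ω ∂P, h (X ω) = f (X ω) := ae_of_ae_map hX.aemeasurable hf.coeFn_toLp
  have h4 : (fun ω => condExpFun P X W h (W ω))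
      =ᵐ[P] P[fun ω => f (X ω) | MeasurableSpace.comap W inferInstance] :=
    (condExpFun_comp_ae_eq P hX hW (Lp.memLp h)).symm.trans (condExp_congr_ae h3)
  have hgm : StronglyMeasurable[MeasurableSpace.comap W inferInstance] fun ω => g (W ω) :=
    (hg.comp (comap_measurable W)).stronglyMeasurable
  have h5 := condExp_mul_of_stronglyMeasurable_left hgm (hgW.integrable_mul hfX)
    (hfX.integrable one_le_two)
  rw [h1, h2]
  calc ∫ ω, g (W ω) * condExpFun P X W h (W ω) ∂P
      = ∫ ω, (P[(fun ω => g (W ω)) * (fun ω => f (X ω)) |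
          MeasurableSpace.comap W inferInstance]) ω ∂P := by
        refine integral_congr_ae ?_
        filter_upwards [h4, h5] with ω hω4 hω5
        rw [hω4, hω5]
        rfl
    _ = ∫ ω, g (W ω) * f (X ω) ∂P := integral_condExp hW.comap_le

end Operator

/-! ### Markov and variance bounds for i.i.d. sums. -/

section SampleMeans

variable {Ω S : Type*} [MeasurableSpace Ω] [MeasurableSpace S]

/-- Markov's inequality, in a form that covers a vanishing bound. -/
theorem measure_gt_mul_le {P : Measure Ω} [IsFiniteMeasure P] {f : Ω → ℝ} (hf : Integrable f P)
    (hf0 : ∀ ω, 0 ≤ f ω) {A M : ℝ} (hA : ∫ ω, f ω ∂P ≤ A) (hM : 0 < M) :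
    P {ω | M * A < f ω} ≤ ENNReal.ofReal (1 / M) := by
  have hA0 : 0 ≤ A := (integral_nonneg hf0).trans hA
  -- The case `A = 0` occurs when `h₀` lies in the sieve space; `f` then vanishes almost surely.
  rcases hA0.eq_or_lt with h | h
  · have h0 : ∫ ω, f ω ∂P = 0 := le_antisymm (h ▸ hA) (integral_nonneg hf0)
    have hae := (integral_eq_zero_iff_of_nonneg hf0 hf).1 h0
    have : P {ω | M * A < f ω} = 0 := by
      rw [← h, mul_zero]
      refine measure_mono_null ?_ hae
      intro ω hω hcon
      exact absurd hcon (ne_of_gt hω)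
    rw [this]
    exact bot_le
  · have hmk := mul_meas_ge_le_integral_of_nonneg (ae_of_all _ hf0) hf (M * A)
    have h1 : P.real {ω | M * A ≤ f ω} ≤ 1 / M := by
      rw [le_div_iff₀ hM]
      refine le_of_mul_le_mul_left ?_ h
      calc A * (P.real {ω | M * A ≤ f ω} * M) = M * A * P.real {ω | M * A ≤ f ω} := by ring
        _ ≤ A * 1 := by rw [mul_one]; exact hmk.trans hA
    calc P {ω | M * A < f ω} ≤ P {ω | M * A ≤ f ω} :=
          measure_mono fun ω (hω : M * A < f ω) => le_of_lt hω
      _ = ENNReal.ofReal (P.real {ω | M * A ≤ f ω}) := (ofReal_measureReal).symm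
      _ ≤ _ := ENNReal.ofReal_le_ofReal h1

/-- The mean squared deviation of a sum of i.i.d. random vectors from its mean. -/
theorem integral_sum_sub_dotProduct_self_le {P : Measure Ω} [IsProbabilityMeasure P]
    {Z : ℕ → Ω → S} (hind : iIndepFun Z P) (hid : ∀ i, IdentDistrib (Z i) (Z 0) P P) {K : ℕ}
    {F : S → Fin K → ℝ} (hF : ∀ k, Measurable fun z => F z k)
    (hF2 : ∀ k, MemLp (fun ω => F (Z 0 ω) k) 2 P) (n : ℕ) :
    Integrable (fun ω => (fun k => ∑ i : Fin n, F (Z i ω) k - n * ∫ ω, F (Z 0 ω) k ∂P) ⬝ᵥ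
        (fun k => ∑ i : Fin n, F (Z i ω) k - n * ∫ ω, F (Z 0 ω) k ∂P)) P ∧
    ∫ ω, (fun k => ∑ i : Fin n, F (Z i ω) k - n * ∫ ω, F (Z 0 ω) k ∂P) ⬝ᵥ
        (fun k => ∑ i : Fin n, F (Z i ω) k - n * ∫ ω, F (Z 0 ω) k ∂P) ∂P
      ≤ n * ∑ k, ∫ ω, F (Z 0 ω) k ^ 2 ∂P := by
  have hmem : ∀ k i, MemLp (fun ω => F (Z i ω) k) 2 P := fun k i =>
    ((hid i).comp (hF k)).memLp_iff.2 (hF2 k)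
  have hmean : ∀ k i, ∫ ω, F (Z i ω) k ∂P = ∫ ω, F (Z 0 ω) k ∂P := fun k i =>
    ((hid i).comp (hF k)).integral_eq
  have hsum : ∀ k, MemLp (∑ i : Fin n, fun ω => F (Z i ω) k) 2 P := fun k =>
    memLp_finsetSum' _ fun i _ => hmem k i
  have hsum' : ∀ k, MemLp (fun ω => ∑ i : Fin n, F (Z i ω) k - n * ∫ ω, F (Z 0 ω) k ∂P) 2 P :=
    fun k => MemLp.sub (f := fun ω => ∑ i : Fin n, F (Z i ω) k)
      (g := fun _ => n * ∫ ω, F (Z 0 ω) k ∂P) (memLp_finsetSum _ fun i _ => hmem k i)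
      (memLp_const _)
  have hint : ∀ k, Integrable (fun ω => (∑ i : Fin n, F (Z i ω) k - n * ∫ ω, F (Z 0 ω) k ∂P) *
      (∑ i : Fin n, F (Z i ω) k - n * ∫ ω, F (Z 0 ω) k ∂P)) P := fun k =>
    (hsum' k).integrable_mul (hsum' k)
  simp only [dotProduct]
  refine ⟨integrable_finsetSum _ fun k _ => hint k, ?_⟩
  rw [integral_finsetSum _ fun k _ => hint k, Finset.mul_sum]
  refine Finset.sum_le_sum fun k _ => ?_
  have hvar : ∫ ω, (∑ i : Fin n, F (Z i ω) k - n * ∫ ω, F (Z 0 ω) k ∂P) *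
      (∑ i : Fin n, F (Z i ω) k - n * ∫ ω, F (Z 0 ω) k ∂P) ∂P
      = Var[∑ i : Fin n, fun ω => F (Z i ω) k; P] := by
    rw [variance_eq_integral (hsum k).1.aemeasurable]
    have hm : ∫ ω, (∑ i : Fin n, fun ω => F (Z i ω) k) ω ∂P = n * ∫ ω, F (Z 0 ω) k ∂P := by
      simp only [Finset.sum_apply]
      rw [integral_finsetSum _ fun (i : Fin n) _ => (hmem k i).integrable one_le_two]
      simp [hmean]
    rw [hm]
    refine integral_congr_ae (ae_of_all _ fun ω => ?_)
    simp only [Finset.sum_apply, sq]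
  rw [hvar, IndepFun.variance_sum fun (i : Fin n) _ => hmem k i]
  · have : ∀ i : Fin n, Var[fun ω => F (Z i ω) k; P] = Var[fun ω => F (Z 0 ω) k; P] := fun i =>
      ((hid i).comp (hF k)).variance_eq
    simp only [this, Finset.sum_const, Finset.card_univ, Fintype.card_fin, nsmul_eq_mul]
    exact mul_le_mul_of_nonneg_left (variance_le_expectation_sq (hF2 k).1) (Nat.cast_nonneg n)
  · intro i _ j _ hij
    exact (hind.indepFun (fun h => hij (Fin.ext h))).comp (hF k) (hF k)

end SampleMeans

/-! ### Instruments and regressors stacked into one random vector. -/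

section PairedVectors

variable {S : Type*} [MeasurableSpace S] {ν : Measure S} {K J : ℕ} {f : S → Fin K → ℝ}
  {g : S → Fin J → ℝ}

/-- The cross moment matrix `E[f g']`. -/
def crossMoment (ν : Measure S) (f : S → Fin K → ℝ) (g : S → Fin J → ℝ) :
    Matrix (Fin K) (Fin J) ℝ :=
  Matrix.of fun k j => ∫ z, f z k * g z j ∂ν

/-- The `n × K` matrix with rows `f(z₁)', …, f(zₙ)'`. -/
def rowMatrix {n : ℕ} (f : S → Fin K → ℝ) (z : Fin n → S) : Matrix (Fin n) (Fin K) ℝ :=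
  Matrix.of fun i k => f (z i) k

theorem crossMoment_mulVec (hf : ∀ k, MemLp (fun z => f z k) 2 ν)
    (hg : ∀ j, MemLp (fun z => g z j) 2 ν) (q : Fin J → ℝ) :
    crossMoment ν f g *ᵥ q = fun k => ∫ z, f z k * (g z ⬝ᵥ q) ∂ν := by
  ext k
  have h := integral_dotProduct_mul hg (hf k) q
  simp only [mul_comm (f _ k)]
  rw [h, dotProduct_comm]
  simp only [mulVec, crossMoment, of_apply, mul_comm (f _ k)]

theorem secondMoment_sumElim_mulVec_left (hff : ∀ k l, ∫ z, f z k * f z l ∂ν = (1 : Matrix _ _ ℝ) k l)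
    (p : Fin K → ℝ) (q : Fin J → ℝ) (k : Fin K) :
    (secondMoment ν (fun z => Sum.elim (f z) (g z)) *ᵥ Sum.elim p q) (Sum.inl k)
      = p k + (crossMoment ν f g *ᵥ q) k := by
  simp only [mulVec, dotProduct, Fintype.sum_sum_type, secondMoment, of_apply, Sum.elim_inl,
    Sum.elim_inr, hff, crossMoment]
  simp [Matrix.one_apply]

theorem secondMoment_sumElim_mulVec_right
    (hgg : ∀ k l, ∫ z, g z k * g z l ∂ν = (1 : Matrix _ _ ℝ) k l)
    (p : Fin K → ℝ) (q : Fin J → ℝ) (j : Fin J) :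
    (secondMoment ν (fun z => Sum.elim (f z) (g z)) *ᵥ Sum.elim p q) (Sum.inr j)
      = ((crossMoment ν f g)ᵀ *ᵥ p) j + q j := by
  simp only [mulVec, dotProduct, Fintype.sum_sum_type, secondMoment, of_apply, Sum.elim_inl,
    Sum.elim_inr, hgg, crossMoment, transpose_apply, mul_comm (g _ j) (f _ _)]
  simp [Matrix.one_apply]

theorem integral_dotProduct_sq_of_orthonormal (hf : ∀ k, MemLp (fun z => f z k) 2 ν)
    (hff : ∀ k l, ∫ z, f z k * f z l ∂ν = (1 : Matrix _ _ ℝ) k l) (p : Fin K → ℝ) :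
    ∫ z, (f z ⬝ᵥ p) * (f z ⬝ᵥ p) ∂ν = p ⬝ᵥ p := by
  rw [integral_dotProduct_mul hf (memLp_dotProduct hf p), ← crossMoment_mulVec hf hf]
  have : crossMoment ν f f = 1 := by
    ext k l
    exact hff k l
  rw [this, one_mulVec]

/-- The stacked second moment matrix has identity diagonal blocks, and its cross term is `2
E[(f·p)(g·q)] ≤ |p|² + |q|²`. Stacking lets a single concentration bound control the instrument Gram
matrix and the cross moments together. -/
theorem dotProduct_secondMoment_sumElim_le (hf : ∀ k, MemLp (fun z => f z k) 2 ν)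
    (hg : ∀ j, MemLp (fun z => g z j) 2 ν)
    (hff : ∀ k l, ∫ z, f z k * f z l ∂ν = (1 : Matrix _ _ ℝ) k l)
    (hgg : ∀ k l, ∫ z, g z k * g z l ∂ν = (1 : Matrix _ _ ℝ) k l) (x : Fin K ⊕ Fin J → ℝ) :
    x ⬝ᵥ (secondMoment ν (fun z => Sum.elim (f z) (g z)) *ᵥ x) ≤ 2 * (x ⬝ᵥ x) := by
  obtain ⟨p, q, rfl⟩ : ∃ p q, x = Sum.elim p q := ⟨_, _, (Sum.elim_comp_inl_inr x).symm⟩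
  have e1 : Sum.elim p q ⬝ᵥ Sum.elim p q = p ⬝ᵥ p + q ⬝ᵥ q := by
    simp [dotProduct, Fintype.sum_sum_type]
  have e2 : Sum.elim p q ⬝ᵥ (secondMoment ν (fun z => Sum.elim (f z) (g z)) *ᵥ Sum.elim p q)
      = p ⬝ᵥ p + p ⬝ᵥ (crossMoment ν f g *ᵥ q) + (q ⬝ᵥ ((crossMoment ν f g)ᵀ *ᵥ p) + q ⬝ᵥ q) := by
    rw [← dotProduct_add, ← dotProduct_add]
    simp only [dotProduct, Fintype.sum_sum_type (α₁ := Fin K),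
      secondMoment_sumElim_mulVec_left hff, secondMoment_sumElim_mulVec_right hgg, Sum.elim_inl,
      Sum.elim_inr, Pi.add_apply]
  have e3 : q ⬝ᵥ ((crossMoment ν f g)ᵀ *ᵥ p) = p ⬝ᵥ (crossMoment ν f g *ᵥ q) := by
    rw [← mulVec_dotProduct_mulVec_transpose, dotProduct_comm]
  have hfp := memLp_dotProduct hf p
  have hgq := memLp_dotProduct hg q
  have hi1 : Integrable (fun z => (f z ⬝ᵥ p) * (f z ⬝ᵥ p)) ν := hfp.integrable_mul hfp
  have hi2 : Integrable (fun z => (g z ⬝ᵥ q) * (g z ⬝ᵥ q)) ν := hgq.integrable_mul hgq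
  have hi3 : Integrable (fun z => (f z ⬝ᵥ p) * (g z ⬝ᵥ q)) ν := hfp.integrable_mul hgq
  have e4 : 2 * (p ⬝ᵥ (crossMoment ν f g *ᵥ q)) ≤ p ⬝ᵥ p + q ⬝ᵥ q := by
    rw [crossMoment_mulVec hf hg, ← integral_dotProduct_mul hf hgq,
      ← integral_dotProduct_sq_of_orthonormal hf hff p,
      ← integral_dotProduct_sq_of_orthonormal hg hgg q, ← integral_const_mul,
      ← integral_add hi1 hi2]
    refine integral_mono (hi3.const_mul 2) (hi1.add hi2) fun z => ?_
    beta_reduce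
    nlinarith [sq_nonneg (f z ⬝ᵥ p - g z ⬝ᵥ q)]
  rw [e1, e2, e3]
  linarith

theorem centeredSum_mulVec {ι : Type*} [Fintype ι] (c : S → ι → ℝ) {n : ℕ} (z : Fin n → S)
    (u : ι → ℝ) (a : ι) :
    (centeredSum ν c z *ᵥ u) a
      = ∑ i, (c (z i) ⬝ᵥ u) * c (z i) a - n * (secondMoment ν c *ᵥ u) a := by
  have h : centeredSum ν c z = ∑ i, vecMulVec (c (z i)) (c (z i)) - (n : ℝ) • secondMoment ν c := by
    simp only [centeredSum, Finset.sum_sub_distrib, Finset.sum_const, Finset.card_univ,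
      Fintype.card_fin, Nat.cast_smul_eq_nsmul]
  rw [h, sub_mulVec, smul_mulVec, Pi.sub_apply, Pi.smul_apply, smul_eq_mul, sum_mulVec,
    Finset.sum_apply]
  congr 1
  refine Finset.sum_congr rfl fun i _ => ?_
  rw [vecMulVec_mulVec]
  simp [mul_comm]

omit [MeasurableSpace S] in
theorem rowMatrix_mulVec {n : ℕ} (z : Fin n → S) (q : Fin J → ℝ) :
    rowMatrix g z *ᵥ q = fun i => g (z i) ⬝ᵥ q := rfl

omit [MeasurableSpace S] in
theorem transpose_rowMatrix_mulVec {n : ℕ} (z : Fin n → S) (y : Fin n → ℝ) (k : Fin K) :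
    ((rowMatrix f z)ᵀ *ᵥ y) k = ∑ i, f (z i) k * y i := rfl

theorem dotProduct_inl_le (u : Fin K ⊕ Fin J → ℝ) :
    (fun k => u (Sum.inl k)) ⬝ᵥ (fun k => u (Sum.inl k)) ≤ u ⬝ᵥ u := by
  simp only [dotProduct, Fintype.sum_sum_type]
  exact le_add_of_nonneg_right (Finset.sum_nonneg fun j _ => mul_self_nonneg _)

/-- A bound on the centered sum controls the empirical Gram matrix. -/
theorem gram_deviation_le (hff : ∀ k l, ∫ z, f z k * f z l ∂ν = (1 : Matrix _ _ ℝ) k l) {n : ℕ}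
    {z : Fin n → S} {t : ℝ}
    (h : ∀ u, (centeredSum ν (fun z => Sum.elim (f z) (g z)) z *ᵥ u) ⬝ᵥ
      (centeredSum ν (fun z => Sum.elim (f z) (g z)) z *ᵥ u) ≤ t ^ 2 * (u ⬝ᵥ u))
    (p : Fin K → ℝ) :
    ((rowMatrix f z)ᵀ *ᵥ (rowMatrix f z *ᵥ p) - (n : ℝ) • p) ⬝ᵥ
      ((rowMatrix f z)ᵀ *ᵥ (rowMatrix f z *ᵥ p) - (n : ℝ) • p) ≤ t ^ 2 * (p ⬝ᵥ p) := by
  have h1 := (dotProduct_inl_le _).trans (h (Sum.elim p 0))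
  have h2 : Sum.elim p (0 : Fin J → ℝ) ⬝ᵥ Sum.elim p 0 = p ⬝ᵥ p := by
    simp [dotProduct, Fintype.sum_sum_type]
  have h3 : (rowMatrix f z)ᵀ *ᵥ (rowMatrix f z *ᵥ p) - (n : ℝ) • p
      = fun k => (centeredSum ν (fun z => Sum.elim (f z) (g z)) z *ᵥ Sum.elim p 0) (Sum.inl k) := by
    ext k
    rw [centeredSum_mulVec, secondMoment_sumElim_mulVec_left hff, Pi.sub_apply,
      transpose_rowMatrix_mulVec]
    simp [rowMatrix_mulVec, dotProduct, Fintype.sum_sum_type, mul_comm]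
  rwa [h2, ← h3] at h1

/-- A bound on the centered sum controls the empirical cross moment matrix. -/
theorem crossMoment_deviation_le (hff : ∀ k l, ∫ z, f z k * f z l ∂ν = (1 : Matrix _ _ ℝ) k l)
    {n : ℕ} {z : Fin n → S} {t : ℝ}
    (h : ∀ u, (centeredSum ν (fun z => Sum.elim (f z) (g z)) z *ᵥ u) ⬝ᵥ
      (centeredSum ν (fun z => Sum.elim (f z) (g z)) z *ᵥ u) ≤ t ^ 2 * (u ⬝ᵥ u))
    (q : Fin J → ℝ) :
    ((rowMatrix f z)ᵀ *ᵥ (rowMatrix g z *ᵥ q) - (n : ℝ) • (crossMoment ν f g *ᵥ q)) ⬝ᵥ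
      ((rowMatrix f z)ᵀ *ᵥ (rowMatrix g z *ᵥ q) - (n : ℝ) • (crossMoment ν f g *ᵥ q))
      ≤ t ^ 2 * (q ⬝ᵥ q) := by
  have h1 := (dotProduct_inl_le _).trans (h (Sum.elim 0 q))
  have h2 : Sum.elim (0 : Fin K → ℝ) q ⬝ᵥ Sum.elim 0 q = q ⬝ᵥ q := by
    simp [dotProduct, Fintype.sum_sum_type]
  have h3 : (rowMatrix f z)ᵀ *ᵥ (rowMatrix g z *ᵥ q) - (n : ℝ) • (crossMoment ν f g *ᵥ q)
      = fun k => (centeredSum ν (fun z => Sum.elim (f z) (g z)) z *ᵥ Sum.elim 0 q) (Sum.inl k) := by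
    ext k
    rw [centeredSum_mulVec, secondMoment_sumElim_mulVec_left hff, Pi.sub_apply,
      transpose_rowMatrix_mulVec]
    simp [rowMatrix_mulVec, dotProduct, Fintype.sum_sum_type, mul_comm]
  rwa [h2, ← h3] at h1

/-- The Euclidean norm on coordinate vectors. -/
def euclNorm {k : ℕ} (v : Fin k → ℝ) : ℝ := ‖WithLp.toLp 2 v‖

theorem euclNorm_nonneg {k : ℕ} (v : Fin k → ℝ) : 0 ≤ euclNorm v := norm_nonneg _

theorem euclNorm_sq {k : ℕ} (v : Fin k → ℝ) : euclNorm v ^ 2 = v ⬝ᵥ v := by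
  rw [euclNorm, EuclideanSpace.norm_sq_eq]
  simp [dotProduct, sq]

theorem euclNorm_add_le {k : ℕ} (v w : Fin k → ℝ) : euclNorm (v + w) ≤ euclNorm v + euclNorm w := by
  rw [euclNorm, WithLp.toLp_add]
  exact norm_add_le _ _

theorem euclNorm_smul {k : ℕ} {r : ℝ} (hr : 0 ≤ r) (v : Fin k → ℝ) :
    euclNorm (r • v) = r * euclNorm v := by
  rw [euclNorm, WithLp.toLp_smul, norm_smul, Real.norm_of_nonneg hr]
  rfl

theorem euclNorm_le_of_dotProduct_le {k l : ℕ} {v : Fin k → ℝ} {w : Fin l → ℝ} {t : ℝ} (ht : 0 ≤ t)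
    (h : v ⬝ᵥ v ≤ t ^ 2 * (w ⬝ᵥ w)) : euclNorm v ≤ t * euclNorm w := by
  rw [← euclNorm_sq, ← euclNorm_sq, ← mul_pow] at h
  exact (pow_le_pow_iff_left₀ (euclNorm_nonneg v) (mul_nonneg ht (euclNorm_nonneg w))
    two_ne_zero).1 h

/-- On the event where the centered sum is small relative to the ill-posedness `τ`, the
two-stage least squares coefficients, expressed in the orthonormalized basis, inherit the error of
the instrumented residual up to a factor `4 τ / n`. -/
theorem tslsCoef_error_le {ginv : (k : ℕ) → Matrix (Fin k) (Fin k) ℝ → Matrix (Fin k) (Fin k) ℝ}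
    (hginv : IsGeneralizedInverse ginv)
    (hff : ∀ k l, ∫ z, f z k * f z l ∂ν = (1 : Matrix _ _ ℝ) k l) {τ : ℝ} (hτ : 1 ≤ τ)
    (hS : ∀ q, 3 / 4 * euclNorm q ≤ τ * euclNorm (crossMoment ν f g *ᵥ q)) {n : ℕ} (hn : 0 < n)
    {z : Fin n → S}
    (h : ∀ u, (centeredSum ν (fun z => Sum.elim (f z) (g z)) z *ᵥ u) ⬝ᵥ
      (centeredSum ν (fun z => Sum.elim (f z) (g z)) z *ᵥ u) ≤ (n / (8 * τ)) ^ 2 * (u ⬝ᵥ u))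
    {Ψ : Matrix (Fin n) (Fin J) ℝ} {B : Matrix (Fin n) (Fin K) ℝ}
    {Q R : Matrix (Fin K) (Fin K) ℝ} (hQR : Q * R = 1) (hB : B * Q = rowMatrix f z)
    {Q' R' : Matrix (Fin J) (Fin J) ℝ} (hQR' : Q' * R' = 1) (hΨ : Ψ * Q' = rowMatrix g z)
    (y : Fin n → ℝ) (c : Fin J → ℝ) :
    euclNorm (R' *ᵥ (tslsCoef ginv Ψ B y - c))
      ≤ 4 * τ / n * euclNorm ((rowMatrix f z)ᵀ *ᵥ (y - Ψ *ᵥ c)) := by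
  have hn' : (0 : ℝ) < n := Nat.cast_pos.2 hn
  have hτ0 : 0 < τ := by linarith
  set t : ℝ := n / (8 * τ) with ht
  have ht0 : 0 ≤ t := by positivity
  -- Because `τ ≥ 1`, the tolerance `n / (8 τ)` also keeps the Gram matrix between `7 n / 8` and `9
  -- n / 8`.
  have htn : t ≤ n / 8 := by
    rw [ht, div_le_div_iff₀ (by positivity) (by norm_num)]
    nlinarith
  have hgram : ∀ p, |((B * Q) *ᵥ p) ⬝ᵥ ((B * Q) *ᵥ p) - n * (p ⬝ᵥ p)| ≤ n / 8 * (p ⬝ᵥ p) := by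
    intro p
    rw [hB]
    have h1 := euclNorm_le_of_dotProduct_le ht0 (gram_deviation_le hff h p)
    set r := (rowMatrix f z)ᵀ *ᵥ (rowMatrix f z *ᵥ p) - (n : ℝ) • p with hr
    have h2 : (rowMatrix f z *ᵥ p) ⬝ᵥ (rowMatrix f z *ᵥ p) - n * (p ⬝ᵥ p) = p ⬝ᵥ r := by
      rw [mulVec_dotProduct_mulVec_transpose, hr, dotProduct_sub, dotProduct_smul, smul_eq_mul]
    have h3 : |p ⬝ᵥ r| ≤ euclNorm p * euclNorm r := by
      have := abs_real_inner_le_norm (WithLp.toLp 2 p : EuclideanSpace ℝ (Fin K)) (WithLp.toLp 2 r)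
      rw [EuclideanSpace.inner_toLp_toLp] at this
      simpa [dotProduct_comm, euclNorm] using this
    rw [h2]
    refine h3.trans ?_
    rw [← euclNorm_sq]
    nlinarith [mul_le_mul_of_nonneg_left h1 (euclNorm_nonneg p),
      mul_le_mul_of_nonneg_right htn (sq_nonneg (euclNorm p))]
  have key := tslsCoef_stability hginv Ψ B Q R hQR (lo := 7 / 8 * n) (hi := 9 / 8 * n)
    (by positivity) (fun p => by have := (abs_le.1 (hgram p)).1; linarith)
    (fun p => by have := (abs_le.1 (hgram p)).2; linarith) (by positivity) y c
  rw [hB] at key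
  set a := tslsCoef ginv Ψ B y - c with ha
  set e := (rowMatrix f z)ᵀ *ᵥ (y - Ψ *ᵥ c) with he
  set b := R' *ᵥ a with hb
  have hΨa : Ψ *ᵥ a = rowMatrix g z *ᵥ b := by
    rw [← hΨ, hb, mulVec_mulVec, Matrix.mul_assoc, hQR', Matrix.mul_one]
  rw [hΨa] at key
  set w := (rowMatrix f z)ᵀ *ᵥ (rowMatrix g z *ᵥ b) with hw
  -- The ratio `9/7` of the Gram bounds is generously replaced by `4`.
  have h4 : w ⬝ᵥ w ≤ 2 ^ 2 * (e ⬝ᵥ e) := by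
    refine le_of_mul_le_mul_left ?_ hn'
    have : 0 ≤ e ⬝ᵥ e := by rw [← euclNorm_sq]; positivity
    nlinarith [mul_nonneg hn'.le this]
  have h5 := euclNorm_le_of_dotProduct_le (by norm_num) h4
  have h6 := euclNorm_le_of_dotProduct_le ht0 (crossMoment_deviation_le hff h b)
  rw [← hw] at h6
  have h7 : n * euclNorm (crossMoment ν f g *ᵥ b)
      ≤ euclNorm w + t * euclNorm b := by
    rw [← euclNorm_smul hn'.le]
    have e1 : (n : ℝ) • (crossMoment ν f g *ᵥ b)
        = w + (-1 : ℝ) • (w - (n : ℝ) • (crossMoment ν f g *ᵥ b)) := by module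
    have e2 : euclNorm ((-1 : ℝ) • (w - (n : ℝ) • (crossMoment ν f g *ᵥ b)))
        = euclNorm (w - (n : ℝ) • (crossMoment ν f g *ᵥ b)) := by
      rw [euclNorm, WithLp.toLp_smul, norm_smul]
      simp [euclNorm]
    rw [e1]
    refine (euclNorm_add_le _ _).trans ?_
    rw [e2]
    linarith
  have h8 := hS b
  -- The deviation term costs `n |b| / 8` out of `3 n |b| / 4`. What remains is `5 n |b| / 8 ≤ 2 τ
  -- |e|`, and `16/5 ≤ 4`.
  have h9 : 8 * τ * t = n := by rw [ht]; field_simp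
  rw [div_mul_eq_mul_div, le_div_iff₀ hn']
  have h10 := mul_le_mul_of_nonneg_left h8 hn'.le
  have h11 := mul_le_mul_of_nonneg_left h7 hτ0.le
  have h12 := mul_le_mul_of_nonneg_left h5 hτ0.le
  have h13 : τ * (t * euclNorm b) = n * euclNorm b / 8 := by
    rw [← h9]; ring
  have h14 : 0 ≤ n * euclNorm b := mul_nonneg hn'.le (euclNorm_nonneg b)
  nlinarith

end PairedVectors

/-! ### Working inequalities for the ill-posedness and the projection gap. -/

section IllPosedness

variable {E F : Type*} [NormedAddCommGroup E] [NormedSpace ℝ E] [NormedAddCommGroup F]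

theorem norm_le_illPosedness_mul {T : E → F} {V : Submodule ℝ E} (h : illPosedness T V ≠ ⊤)
    {x : E} (hx : x ∈ V) : ‖x‖ ≤ (illPosedness T V).toReal * ‖T x‖ := by
  rcases eq_or_ne x 0 with rfl | hx0
  · rw [norm_zero]
    positivity
  have h1 : ‖x‖ₑ / ‖T x‖ₑ ≤ illPosedness T V :=
    le_iSup₂_of_le (f := fun h _ => ⨆ _ : h ≠ 0, ‖h‖ₑ / ‖T h‖ₑ) x hx
      (le_iSup (fun _ : x ≠ 0 => ‖x‖ₑ / ‖T x‖ₑ) hx0)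
  -- A nonzero extended nonnegative real divided by zero is `⊤`, so finiteness of the supremum
  -- excludes `T x = 0`.
  have h2 : ‖T x‖ₑ ≠ 0 := by
    intro h0
    rw [h0, ENNReal.div_zero (by simpa using hx0)] at h1
    exact h (top_le_iff.1 h1)
  rw [ENNReal.div_le_iff h2 enorm_ne_top] at h1
  have h3 := ENNReal.toReal_mono (ENNReal.mul_ne_top h enorm_ne_top) h1
  simpa using h3

theorem one_le_illPosedness {T : E → F} {V : Submodule ℝ E} {x : E} (hx : x ∈ V) (hx0 : x ≠ 0)
    (hT : ‖T x‖ ≤ ‖x‖) : 1 ≤ illPosedness T V := by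
  have h1 : ‖x‖ₑ / ‖T x‖ₑ ≤ illPosedness T V :=
    le_iSup₂_of_le (f := fun h _ => ⨆ _ : h ≠ 0, ‖h‖ₑ / ‖T h‖ₑ) x hx
      (le_iSup (fun _ : x ≠ 0 => ‖x‖ₑ / ‖T x‖ₑ) hx0)
  refine le_trans ?_ h1
  rw [ENNReal.le_div_iff_mul_le (Or.inr (by simpa using hx0)) (Or.inl enorm_ne_top), one_mul]
  exact enorm_le_iff_norm_le.2 hT

theorem enorm_starProjection_sub_le_projectionGap {F : Type*} [NormedAddCommGroup F]
    [InnerProductSpace ℝ F] {T : E → F} {V : Submodule ℝ E} {U : Submodule ℝ F}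
    [U.HasOrthogonalProjection] {x : E} (hx : x ∈ V) (hx1 : ‖x‖ = 1) :
    ‖U.starProjection (T x) - T x‖ₑ ≤ projectionGap T V U :=
  le_iSup₂_of_le (f := fun h _ => ⨆ _ : ‖h‖ = 1, ‖U.starProjection (T h) - T h‖ₑ) x hx
    (le_iSup (fun _ : ‖x‖ = 1 => ‖U.starProjection (T x) - T x‖ₑ) hx1)

end IllPosedness

theorem integral_comp_measurePreserving {Ω S : Type*} [MeasurableSpace Ω] [MeasurableSpace S]
    {μ : Measure Ω} {ν : Measure S} {f : Ω → S} (h : MeasurePreserving f μ ν) {g : S → ℝ}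
    (hg : AEStronglyMeasurable g ν) : ∫ x, g (f x) ∂μ = ∫ y, g y ∂ν := by
  rw [← integral_map h.measurable.aemeasurable (by rwa [h.map_eq]), h.map_eq]

/-! ### Whitened bases of the model and the good event. -/

namespace Setting

variable {Ω : Type*} [MeasurableSpace Ω] {P : Measure Ω} {d dw : ℕ} (M : Setting P d dw)

/-- The observation `(Y i, X i, W i)`. -/
def obs (i : ℕ) (ω : Ω) : ℝ × EuclideanSpace ℝ (Fin d) × EuclideanSpace ℝ (Fin dw) :=
  (M.Y i ω, M.X i ω, M.W i ω)

/-- The law of an observation. -/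
abbrev lawObs : Measure (ℝ × EuclideanSpace ℝ (Fin d) × EuclideanSpace ℝ (Fin dw)) :=
  P.map (M.obs 0)

/-- The orthonormalized instrument basis, as a function of the observation. -/
def instr (n : ℕ) (z : ℝ × EuclideanSpace ℝ (Fin d) × EuclideanSpace ℝ (Fin dw)) :
    Fin (M.K n) → ℝ :=
  whiten M.lawW (M.b (M.K n)) z.2.2

/-- The orthonormalized regressor basis, as a function of the observation. -/
def regr (n : ℕ) (z : ℝ × EuclideanSpace ℝ (Fin d) × EuclideanSpace ℝ (Fin dw)) :
    Fin (M.J n) → ℝ :=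
  whiten M.lawX (M.ψ (M.J n)) z.2.1

theorem measurable_obs (i : ℕ) : Measurable (M.obs i) :=
  (M.sample.measurable_Y i).prodMk ((M.sample.measurable_X i).prodMk (M.sample.measurable_W i))

theorem measurePreserving_obs : MeasurePreserving (M.obs 0) P M.lawObs :=
  ⟨M.measurable_obs 0, rfl⟩

theorem measurePreserving_X : MeasurePreserving (fun z => z.2.1) M.lawObs M.lawX :=
  ⟨by fun_prop, by rw [Measure.map_map (by fun_prop) (M.measurable_obs 0)]; rfl⟩

theorem measurePreserving_W : MeasurePreserving (fun z => z.2.2) M.lawObs M.lawW :=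
  ⟨by fun_prop, by rw [Measure.map_map (by fun_prop) (M.measurable_obs 0)]; rfl⟩

theorem measurable_instr (n : ℕ) (k : Fin (M.K n)) : Measurable fun z => M.instr n z k :=
  (measurable_whiten (M.measurable_b _) k).comp (by fun_prop : Measurable fun
    z : ℝ × EuclideanSpace ℝ (Fin d) × EuclideanSpace ℝ (Fin dw) => z.2.2)

theorem measurable_regr (n : ℕ) (j : Fin (M.J n)) : Measurable fun z => M.regr n z j :=
  (measurable_whiten (M.measurable_ψ _) j).comp (by fun_prop : Measurable fun
    z : ℝ × EuclideanSpace ℝ (Fin d) × EuclideanSpace ℝ (Fin dw) => z.2.1)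

theorem memLp_instr (n : ℕ) (k : Fin (M.K n)) : MemLp (fun z => M.instr n z k) 2 M.lawObs :=
  (memLp_whiten (M.memLp_b _) k).comp_measurePreserving M.measurePreserving_W

theorem memLp_regr (n : ℕ) (j : Fin (M.J n)) : MemLp (fun z => M.regr n z j) 2 M.lawObs :=
  (memLp_whiten (M.memLp_ψ _) j).comp_measurePreserving M.measurePreserving_X

theorem integral_instr_mul_instr (n : ℕ) (k l : Fin (M.K n)) :
    ∫ z, M.instr n z k * M.instr n z l ∂M.lawObs = (1 : Matrix _ _ ℝ) k l := by
  rw [← integral_whiten_mul_whiten (M.memLp_b _) (M.gram_b_posDef n)]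
  exact integral_comp_measurePreserving M.measurePreserving_W
    ((measurable_whiten (M.measurable_b _) k).mul
      (measurable_whiten (M.measurable_b _) l)).aestronglyMeasurable

theorem integral_regr_mul_regr (n : ℕ) (k l : Fin (M.J n)) :
    ∫ z, M.regr n z k * M.regr n z l ∂M.lawObs = (1 : Matrix _ _ ℝ) k l := by
  rw [← integral_whiten_mul_whiten (M.memLp_ψ _) (M.gram_ψ_posDef n)]
  exact integral_comp_measurePreserving M.measurePreserving_X
    ((measurable_whiten (M.measurable_ψ _) k).mul
      (measurable_whiten (M.measurable_ψ _) l)).aestronglyMeasurable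

theorem ae_instr_le {n : ℕ} (h : M.zetaMax n ≠ ⊤) :
    ∀ᵐ ω ∂P, M.instr n (M.obs 0 ω) ⬝ᵥ M.instr n (M.obs 0 ω) ≤ (M.zetaMax n).toReal ^ 2 := by
  have hle : zeta M.lawW M.suppW (M.b (M.K n)) ≤ M.zetaMax n := le_max_left _ _
  filter_upwards [M.mem_suppW 0] with ω hω
  refine (whiten_dotProduct_self_le (ne_top_of_le_ne_top h hle) hω).trans ?_
  exact pow_le_pow_left₀ ENNReal.toReal_nonneg (ENNReal.toReal_mono h hle) 2

theorem ae_regr_le {n : ℕ} (h : M.zetaMax n ≠ ⊤) :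
    ∀ᵐ ω ∂P, M.regr n (M.obs 0 ω) ⬝ᵥ M.regr n (M.obs 0 ω) ≤ (M.zetaMax n).toReal ^ 2 := by
  have hle : zeta M.lawX M.suppX (M.ψ (M.J n)) ≤ M.zetaMax n := le_max_right _ _
  filter_upwards [M.mem_suppX 0] with ω hω
  refine (whiten_dotProduct_self_le (ne_top_of_le_ne_top h hle) hω).trans ?_
  exact pow_le_pow_left₀ ENNReal.toReal_nonneg (ENNReal.toReal_mono h hle) 2

theorem measurable_sumElim (n : ℕ) (a : Fin (M.K n) ⊕ Fin (M.J n)) :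
    Measurable fun z => Sum.elim (M.instr n z) (M.regr n z) a := by
  cases a with
  | inl k => exact M.measurable_instr n k
  | inr j => exact M.measurable_regr n j

theorem ae_sumElim_le {n : ℕ} (h : M.zetaMax n ≠ ⊤) :
    ∀ᵐ z ∂M.lawObs, Sum.elim (M.instr n z) (M.regr n z) ⬝ᵥ Sum.elim (M.instr n z) (M.regr n z)
      ≤ 2 * (M.zetaMax n).toReal ^ 2 := by
  rw [ae_map_iff (M.measurable_obs 0).aemeasurable]
  · filter_upwards [M.ae_instr_le h, M.ae_regr_le h] with ω h1 h2
    have e : ∀ (p : Fin (M.K n) → ℝ) (q : Fin (M.J n) → ℝ),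
        Sum.elim p q ⬝ᵥ Sum.elim p q = p ⬝ᵥ p + q ⬝ᵥ q := fun p q => by
      simp [dotProduct, Fintype.sum_sum_type]
    rw [e]
    linarith
  · exact measurableSet_le (Finset.measurable_sum _ fun a _ =>
      (M.measurable_sumElim n a).mul (M.measurable_sumElim n a)) measurable_const

/-- If the supremum vanished, the whitened regressors would be zero almost surely, against their
unit second moment. Positivity matters because `⊤ * 0 = 0` would hide an infinite `τ` in the rate
condition. -/
theorem zetaMax_pos [IsProbabilityMeasure P] {n : ℕ} (hJ : 2 ≤ M.J n) : 0 < M.zetaMax n := by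
  rw [pos_iff_ne_zero]
  intro h0
  have hfin : M.zetaMax n ≠ ⊤ := by simp [h0]
  have hae := M.ae_regr_le hfin
  simp only [h0, ENNReal.toReal_zero, ne_eq, OfNat.ofNat_ne_zero, not_false_eq_true,
    zero_pow] at hae
  let j : Fin (M.J n) := ⟨0, by omega⟩
  have h1 := M.integral_regr_mul_regr n j j
  have hint := integral_comp_measurePreserving M.measurePreserving_obs
    ((M.measurable_regr n j).mul (M.measurable_regr n j)).aestronglyMeasurable
  rw [Matrix.one_apply_eq] at h1
  have h2 : ∫ ω, M.regr n (M.obs 0 ω) j * M.regr n (M.obs 0 ω) j ∂P = ∫ _, (0 : ℝ) ∂P := by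
    refine integral_congr_ae ?_
    filter_upwards [hae] with ω hω
    refine le_antisymm (le_trans ?_ hω) (mul_self_nonneg _)
    exact Finset.single_le_sum (f := fun a => M.regr n (M.obs 0 ω) a * M.regr n (M.obs 0 ω) a)
      (fun a _ => mul_self_nonneg _) (Finset.mem_univ j)
  have h3 := h2.symm.trans (hint.trans h1)
  simp at h3

theorem iIndepFun_obs : iIndepFun M.obs P := M.sample.indep

theorem identDistrib_obs (i : ℕ) : IdentDistrib (M.obs i) (M.obs 0) P P := M.sample.ident i

/-- The event on which the empirical second moments of the orthonormalized bases are within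
`1 / (8 τ)` of their means. -/
def goodEvent [IsFiniteMeasure P] (n : ℕ) : Set Ω :=
  {ω | ∀ u, (centeredSum M.lawObs (fun z => Sum.elim (M.instr n z) (M.regr n z))
        (fun i : Fin n => M.obs i ω) *ᵥ u) ⬝ᵥ
      (centeredSum M.lawObs (fun z => Sum.elim (M.instr n z) (M.regr n z))
        (fun i : Fin n => M.obs i ω) *ᵥ u) ≤ (n / (8 * (M.tau n).toReal)) ^ 2 * (u ⬝ᵥ u)}

theorem measure_compl_goodEvent_le [IsProbabilityMeasure P] {n : ℕ} (hn : 0 < n)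
    (hτ : 1 ≤ (M.tau n).toReal) (hζ : M.zetaMax n ≠ ⊤) (hζ0 : 0 < (M.zetaMax n).toReal) {p : ℕ}
    (hp : p ≠ 0) :
    P (M.goodEvent n)ᶜ ≤ ENNReal.ofReal ((M.K n + M.J n) *
      (64 * (M.tau n).toReal ^ 2 * ((4 * p * (M.zetaMax n).toReal ^ 2 / n) ^ 2
        + 8 * (4 * p * (M.zetaMax n).toReal ^ 2 / n))) ^ p) := by
  set τ := (M.tau n).toReal
  set ζ := (M.zetaMax n).toReal
  have hn' : (0 : ℝ) < n := Nat.cast_pos.2 hn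
  have hτ0 : 0 < τ := by linarith
  -- Each block has squared length at most `ζ²`, hence `R = 2 ζ²`; the stacked second moment bound
  -- is `s = 2`.
  have h := measure_opNorm_centeredSum_gt_le M.measurable_obs M.iIndepFun_obs M.identDistrib_obs
    (M.measurable_sumElim n) (R := 2 * ζ ^ 2) (by positivity) (M.ae_sumElim_le hζ) zero_le_two
    (dotProduct_secondMoment_sumElim_le (M.memLp_instr n) (M.memLp_regr n)
      (M.integral_instr_mul_instr n) (M.integral_regr_mul_regr n)) n hp
    (t := n / (8 * τ)) (by positivity)
  refine (measure_mono ?_).trans (h.trans (le_of_eq ?_))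
  · intro ω hω
    simpa [goodEvent] using hω
  · congr 2
    · simp
    · congr 1
      field_simp
      ring

/-! ### The population cross moment matrix as `Π_K T` in coordinates. -/

section Operator

variable [IsProbabilityMeasure P]

theorem norm_T_le (h : Lp ℝ 2 M.lawX) : ‖M.T h‖ ≤ ‖h‖ := norm_condExpOp_le P _ _ h

/-- The generalized Fourier coefficients of `T f` in the instrument space. -/
theorem integral_whiten_mul_T (n : ℕ) {f : EuclideanSpace ℝ (Fin d) → ℝ}
    (hf : MemLp f 2 M.lawX) (k : Fin (M.K n)) :
    ∫ w, whiten M.lawW (M.b (M.K n)) w k * M.T (hf.toLp f) w ∂M.lawW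
      = ∫ ω, M.instr n (M.obs 0 ω) k * f (M.X 0 ω) ∂P :=
  integral_mul_condExpOp P _ _ (measurable_whiten (M.measurable_b _) k)
    (memLp_whiten (M.memLp_b _) k) hf

theorem one_le_tau {n : ℕ} (hJ : 2 ≤ M.J n) : 1 ≤ M.tau n := by
  let a : Fin (M.J n) → ℝ := fun _ => 1
  have ha : 0 < a ⬝ᵥ a := by
    simp only [a, dotProduct, mul_one, Finset.sum_const, Finset.card_univ, Fintype.card_fin,
      nsmul_eq_mul]
    exact_mod_cast (by omega : 0 < M.J n)
  have hn := norm_toLp_whiten_sq (M.memLp_ψ _) (M.gram_ψ_posDef n) a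
  refine one_le_illPosedness (mem_sieveSpace_of_whiten (M.memLp_ψ _) a
    (memLp_dotProduct (memLp_whiten (M.memLp_ψ _)) a)) ?_ (M.norm_T_le _)
  intro h0
  rw [h0, norm_zero] at hn
  norm_num at hn
  linarith

/-- For a unit vector `h` of the sieve space, `1 ≤ τ ‖T h‖`, and passing to `Π_K T h` loses at most
`1/4`. The coefficients of `T h` against the whitened instruments are the cross moment matrix
applied to the coordinates of `h`. -/
theorem euclNorm_le_tau_mul_crossMoment {n : ℕ} (hτ : M.tau n ≠ ⊤)
    (hgap : M.tau n * projectionGap M.T (M.sieveX n) (M.sieveW n) ≤ ENNReal.ofReal (1 / 4))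
    (q : Fin (M.J n) → ℝ) :
    3 / 4 * euclNorm q
      ≤ (M.tau n).toReal * euclNorm (crossMoment M.lawObs (M.instr n) (M.regr n) *ᵥ q) := by
  rcases (euclNorm_nonneg q).eq_or_lt with h0 | h0
  · rw [← h0, mul_zero]
    exact mul_nonneg ENNReal.toReal_nonneg (euclNorm_nonneg _)
  set N := euclNorm q with hN
  set τ := (M.tau n).toReal with hτdef
  set S := crossMoment M.lawObs (M.instr n) (M.regr n) with hS
  have hτ0 : 0 ≤ τ := ENNReal.toReal_nonneg
  -- Normalization is needed because the projection gap is a supremum over the unit sphere.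
  have hfM := memLp_dotProduct (memLp_whiten (M.memLp_ψ (M.J n))) (N⁻¹ • q)
  set h := hfM.toLp _ with hh
  have hmem : h ∈ M.sieveX n := mem_sieveSpace_of_whiten (M.memLp_ψ _) _ _
  have hnorm : ‖h‖ = 1 := by
    have h1 := norm_toLp_whiten_sq (M.memLp_ψ _) (M.gram_ψ_posDef n) (N⁻¹ • q)
    rw [← euclNorm_sq, euclNorm_smul (inv_nonneg.2 h0.le), ← hN, inv_mul_cancel₀ h0.ne'] at h1
    rw [one_pow] at h1
    exact (pow_eq_one_iff_of_nonneg (norm_nonneg _) two_ne_zero).1 h1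
  have h2 : 1 ≤ τ * ‖M.T h‖ := hnorm ▸ norm_le_illPosedness_mul hτ hmem
  have h3 : τ * ‖(M.sieveW n).starProjection (M.T h) - M.T h‖ ≤ 1 / 4 := by
    have h4 := (mul_le_mul_right (enorm_starProjection_sub_le_projectionGap (T := M.T)
      (U := M.sieveW n) hmem hnorm) (M.tau n)).trans hgap
    have h5 := ENNReal.toReal_mono ENNReal.ofReal_ne_top h4
    rwa [ENNReal.toReal_mul, toReal_enorm, ENNReal.toReal_ofReal (by norm_num)] at h5
  have h6 : ‖(M.sieveW n).starProjection (M.T h)‖ ≤ euclNorm (S *ᵥ (N⁻¹ • q)) := by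
    have h7 := norm_starProjection_sq_le (M.memLp_b (M.K n)) (M.gram_b_posDef n) (M.T h)
    have h8 : (fun k => ∫ w, whiten M.lawW (M.b (M.K n)) w k * M.T h w ∂M.lawW)
        = S *ᵥ (N⁻¹ • q) := by
      rw [hS, crossMoment_mulVec (M.memLp_instr n) (M.memLp_regr n)]
      ext k
      rw [M.integral_whiten_mul_T n hfM k, integral_map (M.measurable_obs 0).aemeasurable]
      · rfl
      · refine ((M.measurable_instr n k).mul ?_).aestronglyMeasurable
        exact Finset.measurable_sum _ fun j _ => (M.measurable_regr n j).mul_const _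
    rw [h8, ← euclNorm_sq] at h7
    exact (pow_le_pow_iff_left₀ (norm_nonneg _) (euclNorm_nonneg _) two_ne_zero).1 h7
  have h9 : ‖M.T h‖ ≤ ‖(M.sieveW n).starProjection (M.T h)‖
      + ‖(M.sieveW n).starProjection (M.T h) - M.T h‖ := by
    have := norm_sub_le ((M.sieveW n).starProjection (M.T h))
      ((M.sieveW n).starProjection (M.T h) - M.T h)
    rwa [sub_sub_cancel] at this
  rw [mulVec_smul, euclNorm_smul (inv_nonneg.2 h0.le)] at h6
  have h10 : 3 / 4 ≤ τ * (N⁻¹ * euclNorm (S *ᵥ q)) := by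
    have := mul_le_mul_of_nonneg_left (h9.trans (add_le_add_left h6 _)) hτ0
    rw [mul_add] at this
    linarith
  calc 3 / 4 * N ≤ τ * (N⁻¹ * euclNorm (S *ᵥ q)) * N := mul_le_mul_of_nonneg_right h10 h0.le
    _ = _ := by field_simp

end Operator

/-! ### Error of the fit for arbitrary responses. -/

section Fit

theorem exists_projCoef (n : ℕ) : ∃ c : Fin (M.J n) → ℝ,
    ∑ j, c j • (M.memLp_ψ (M.J n) j).toLp (M.ψ (M.J n) j)
      = (M.sieveX n).starProjection M.h₀L :=
  (Submodule.mem_span_range_iff_exists_fun ℝ).1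
    (Submodule.starProjection_apply_mem (M.sieveX n) M.h₀L)

/-- The coefficients of `Π_J h₀`. -/
def projCoef (n : ℕ) : Fin (M.J n) → ℝ := (M.exists_projCoef n).choose

/-- The function `h₀ - Π_J h₀`. -/
def resid (n : ℕ) (x : EuclideanSpace ℝ (Fin d)) : ℝ :=
  M.h₀ x - ∑ j, M.ψ (M.J n) j x * M.projCoef n j

theorem measurable_resid (n : ℕ) : Measurable (M.resid n) :=
  M.sample.measurable_h₀.sub
    (Finset.measurable_sum _ fun j _ => (M.measurable_ψ (M.J n) j).mul_const _)

theorem memLp_sieve (n : ℕ) (c : Fin (M.J n) → ℝ) :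
    MemLp (fun x => ∑ j, M.ψ (M.J n) j x * c j) 2 M.lawX :=
  memLp_finsetSum _ fun j _ => (M.memLp_ψ (M.J n) j).mul_const _

theorem memLp_resid (n : ℕ) : MemLp (M.resid n) 2 M.lawX :=
  M.sample.memLp_h₀.sub (M.memLp_sieve n _)

theorem toLp_resid (n : ℕ) : (M.memLp_resid n).toLp (M.resid n) = M.approxError n := by
  have h := toLp_sum Finset.univ (M.memLp_ψ (M.J n)) (M.projCoef n)
    (M.memLp_sieve n (M.projCoef n)) fun _ => rfl
  rw [approxError, ← (M.exists_projCoef n).choose_spec]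
  change _ = M.h₀L - ∑ j, M.projCoef n j • _
  rw [← h]
  exact MemLp.toLp_sub M.sample.memLp_h₀ (M.memLp_sieve n (M.projCoef n))

/-- The error of the series two-stage least squares fit on the good event. -/
theorem eLpNorm_sieveFit_sub_le [IsProbabilityMeasure P] {n : ℕ} (hn : 0 < n)
    (hτ : M.tau n ≠ ⊤) (hτ1 : 1 ≤ (M.tau n).toReal)
    (hgap : M.tau n * projectionGap M.T (M.sieveX n) (M.sieveW n) ≤ ENNReal.ofReal (1 / 4))
    {ω : Ω} (hω : ω ∈ M.goodEvent n) (Z : ℕ → Ω → ℝ) :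
    eLpNorm (fun x => sieveFit M.ginv n (M.ψ (M.J n)) (M.b (M.K n)) Z M.X M.W ω x - M.h₀ x) 2
        M.lawX
      ≤ ENNReal.ofReal (4 * (M.tau n).toReal / n *
          euclNorm ((rowMatrix (M.instr n) (fun i : Fin n => M.obs i ω))ᵀ *ᵥ
            fun i : Fin n => Z i ω - M.h₀ (M.X i ω) + M.resid n (M.X i ω))
        + ‖M.approxError n‖) := by
  set Qb := invSqrt (gram M.lawW (M.b (M.K n))) with hQb
  set Qψ := invSqrt (gram M.lawX (M.ψ (M.J n))) with hQψ
  set Rψ := gram M.lawX (M.ψ (M.J n)) * Qψ with hRψ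
  have hrow : ∀ {m k : ℕ} (Q : Matrix (Fin k) (Fin k) ℝ) (A : Matrix (Fin m) (Fin k) ℝ),
      Q.IsSymm → ∀ i j, (A * Q) i j = (Q *ᵥ A i) j := by
    intro m k Q A hQ i j
    rw [Matrix.mul_apply, mulVec, dotProduct]
    exact Finset.sum_congr rfl fun l _ => by rw [← hQ.apply j l, mul_comm]
  have hB : design n (M.b (M.K n)) M.W ω * Qb
      = rowMatrix (M.instr n) (fun i : Fin n => M.obs i ω) := by
    ext i k
    rw [hrow _ _ (isSymm_invSqrt _)]
    rfl
  have hΨ : design n (M.ψ (M.J n)) M.X ω * Qψ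
      = rowMatrix (M.regr n) (fun i : Fin n => M.obs i ω) := by
    ext i k
    rw [hrow _ _ (isSymm_invSqrt _)]
    rfl
  set coef := tslsCoef M.ginv (design n (M.ψ (M.J n)) M.X ω) (design n (M.b (M.K n)) M.W ω)
    (fun i => Z i ω) with hcoef
  have hmain := tslsCoef_error_le M.isGeneralizedInverse (M.integral_instr_mul_instr n) hτ1
    (M.euclNorm_le_tau_mul_crossMoment hτ hgap) hn hω
    (invSqrt_mul_inverse (M.gram_b_posDef n)) hB (invSqrt_mul_inverse (M.gram_ψ_posDef n)) hΨ
    (fun i => Z i ω) (M.projCoef n)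
  have hres : (fun i : Fin n => Z i ω) - design n (M.ψ (M.J n)) M.X ω *ᵥ M.projCoef n
      = fun i : Fin n => Z i ω - M.h₀ (M.X i ω) + M.resid n (M.X i ω) := by
    ext i
    simp only [Pi.sub_apply, resid, mulVec, dotProduct, design, of_apply]
    ring
  rw [hres, ← hcoef] at hmain
  set a := coef - M.projCoef n with ha
  have hwa := memLp_dotProduct (memLp_whiten (M.memLp_ψ (M.J n))) (Rψ *ᵥ a)
  -- The error is an element of the sieve space, with whitened coordinates `G^{1/2} a`, minus the
  -- approximation error.
  have hfun : (fun x => sieveFit M.ginv n (M.ψ (M.J n)) (M.b (M.K n)) Z M.X M.W ω x - M.h₀ x)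
      = (fun x => whiten M.lawX (M.ψ (M.J n)) x ⬝ᵥ (Rψ *ᵥ a)) - M.resid n := by
    ext x
    rw [Pi.sub_apply, whiten_dotProduct, mulVec_mulVec, hRψ, ← hQψ,
      invSqrt_mul_inverse (M.gram_ψ_posDef n), one_mulVec]
    simp only [sieveFit, ← hcoef, resid, ha, Pi.sub_apply, mul_sub, Finset.sum_sub_distrib]
    ring
  rw [hfun]
  refine (eLpNorm_sub_le hwa.1 (M.memLp_resid n).1 one_le_two).trans ?_
  rw [← Lp.enorm_toLp hwa, ← Lp.enorm_toLp (M.memLp_resid n), M.toLp_resid, ← ofReal_norm,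
    ← ofReal_norm, ← ENNReal.ofReal_add (norm_nonneg _) (norm_nonneg _)]
  refine ENNReal.ofReal_le_ofReal (add_le_add_left ?_ _)
  have hnorm : ‖hwa.toLp _‖ = euclNorm (Rψ *ᵥ a) := by
    have := norm_toLp_whiten_sq (M.memLp_ψ _) (M.gram_ψ_posDef n) (Rψ *ᵥ a)
    rw [← euclNorm_sq] at this
    exact (pow_left_inj₀ (norm_nonneg _) (euclNorm_nonneg _) two_ne_zero).1 this
  rw [hnorm]
  exact hmain

end Fit

end Setting

namespace Setting

variable {Ω : Type*} [MeasurableSpace Ω] {P : Measure Ω} [IsProbabilityMeasure P] {d dw : ℕ}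
  (M : Setting P d dw)

/-! ### Mean square size of the instrumented residual and noise. -/

section Deviations

omit [IsProbabilityMeasure P] in
theorem ae_abs_instr_le {n : ℕ} (h : M.zetaMax n ≠ ⊤) (k : Fin (M.K n)) :
    ∀ᵐ ω ∂P, |M.instr n (M.obs 0 ω) k| ≤ (M.zetaMax n).toReal := by
  filter_upwards [M.ae_instr_le h] with ω hω
  refine abs_le_of_sq_le_sq ?_ ENNReal.toReal_nonneg
  refine le_trans ?_ hω
  rw [sq]
  exact Finset.single_le_sum (f := fun a => M.instr n (M.obs 0 ω) a * M.instr n (M.obs 0 ω) a)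
    (fun a _ => mul_self_nonneg _) (Finset.mem_univ k)

omit [IsProbabilityMeasure P] in
theorem memLp_instr_mul {n : ℕ} (h : M.zetaMax n ≠ ⊤) (k : Fin (M.K n)) {f : Ω → ℝ}
    (hf : MemLp f 2 P) : MemLp (fun ω => M.instr n (M.obs 0 ω) k * f ω) 2 P := by
  refine hf.of_le_mul (c := (M.zetaMax n).toReal)
    (((M.measurable_instr n k).comp (M.measurable_obs 0)).aestronglyMeasurable.mul hf.1) ?_
  filter_upwards [M.ae_abs_instr_le h k] with ω hω
  rw [norm_mul]
  exact mul_le_mul_of_nonneg_right hω (norm_nonneg _)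

omit [IsProbabilityMeasure P] in
theorem memLp_resid_X (n : ℕ) : MemLp (fun ω => M.resid n (M.X 0 ω)) 2 P :=
  (M.memLp_resid n).comp_measurePreserving ⟨M.sample.measurable_X 0, rfl⟩

omit [IsProbabilityMeasure P] in
theorem integral_resid_sq (n : ℕ) :
    ∫ ω, M.resid n (M.X 0 ω) ^ 2 ∂P = ‖M.approxError n‖ ^ 2 := by
  rw [← M.toLp_resid, norm_toLp_sq]
  exact integral_comp_measurePreserving ⟨M.sample.measurable_X 0, rfl⟩
    ((M.measurable_resid n).pow_const 2).aestronglyMeasurable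

/-- The generalized Fourier coefficients of `T (h₀ - Π_J h₀)`. -/
def residCoef (n : ℕ) (k : Fin (M.K n)) : ℝ :=
  ∫ ω, M.instr n (M.obs 0 ω) k * M.resid n (M.X 0 ω) ∂P

theorem euclNorm_residCoef_le (n : ℕ) :
    euclNorm (M.residCoef n) ≤ ‖M.T (M.approxError n)‖ := by
  have h := whiten_coef_dotProduct_self_le (M.memLp_b (M.K n)) (M.gram_b_posDef n)
    (M.T (M.approxError n))
  have e : (fun k => ∫ w, whiten M.lawW (M.b (M.K n)) w k * M.T (M.approxError n) w ∂M.lawW)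
      = M.residCoef n := by
    ext k
    rw [← M.toLp_resid, M.integral_whiten_mul_T n (M.memLp_resid n) k]
    rfl
  rw [e, ← euclNorm_sq] at h
  exact (pow_le_pow_iff_left₀ (euclNorm_nonneg _) (norm_nonneg _) two_ne_zero).1 h

/-- The centered instrumented approximation error. -/
def residDev (n : ℕ) (ω : Ω) (k : Fin (M.K n)) : ℝ :=
  ∑ i : Fin n, M.instr n (M.obs i ω) k * M.resid n (M.X i ω) - n * M.residCoef n k

/-- The instrumented noise. -/
def noiseDev (n : ℕ) (ω : Ω) (k : Fin (M.K n)) : ℝ :=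
  ∑ i : Fin n, M.instr n (M.obs i ω) k * (M.Y i ω - M.h₀ (M.X i ω))

/-- Summing over `k` before bounding gives `E[|b|² r²] ≤ ζ² ‖r‖²` for the whitened instrument vector
`b`, with no further factor `K`. -/
theorem measure_residDev_gt_le {n : ℕ} (h : M.zetaMax n ≠ ⊤) {L : ℝ} (hL : 0 < L) :
    P {ω | L * (n * ((M.zetaMax n).toReal ^ 2 * ‖M.approxError n‖ ^ 2))
        < M.residDev n ω ⬝ᵥ M.residDev n ω} ≤ ENNReal.ofReal (1 / L) := by
  have hF : ∀ k, Measurable fun z : ℝ × EuclideanSpace ℝ (Fin d) × EuclideanSpace ℝ (Fin dw) =>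
      M.instr n z k * M.resid n z.2.1 := fun k =>
    (M.measurable_instr n k).mul ((M.measurable_resid n).comp (by fun_prop))
  have hF2 : ∀ k, MemLp (fun ω => M.instr n (M.obs 0 ω) k * M.resid n (M.obs 0 ω).2.1) 2 P :=
    fun k => M.memLp_instr_mul h k (M.memLp_resid_X n)
  obtain ⟨hint, hle⟩ := integral_sum_sub_dotProduct_self_le M.iIndepFun_obs M.identDistrib_obs
    hF hF2 n
  refine measure_gt_mul_le (f := fun ω => M.residDev n ω ⬝ᵥ M.residDev n ω) hint
    (fun ω => Finset.sum_nonneg fun k _ => mul_self_nonneg _) (hle.trans ?_) hL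
  refine mul_le_mul_of_nonneg_left ?_ (Nat.cast_nonneg n)
  rw [← integral_finsetSum _ fun k _ => (hF2 k).integrable_sq, ← M.integral_resid_sq,
    ← integral_const_mul]
  refine integral_mono_ae (integrable_finsetSum _ fun k _ => (hF2 k).integrable_sq)
    ((M.memLp_resid_X n).integrable_sq.const_mul _) ?_
  filter_upwards [M.ae_instr_le h] with ω hω
  have : ∑ k, (M.instr n (M.obs 0 ω) k * M.resid n (M.obs 0 ω).2.1) ^ 2
      = (M.instr n (M.obs 0 ω) ⬝ᵥ M.instr n (M.obs 0 ω)) * M.resid n (M.X 0 ω) ^ 2 := by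
    rw [dotProduct, Finset.sum_mul]
    exact Finset.sum_congr rfl fun k _ => by simp only [obs]; ring
  rw [this]
  exact mul_le_mul_of_nonneg_right hω (sq_nonneg _)

/-- Conditioning on `W` makes each instrumented error centered, with variance at most `σ²` times the
unit second moment of the instrument. Hence `K` enters here in place of `ζ²`. -/
theorem measure_noiseDev_gt_le {n : ℕ} (h : M.zetaMax n ≠ ⊤) {σ : ℝ}
    (hu : MemLp (fun ω => M.Y 0 ω - M.h₀ (M.X 0 ω)) 2 P)
    (hσ : P[fun ω => (M.Y 0 ω - M.h₀ (M.X 0 ω)) ^ 2 |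
      MeasurableSpace.comap (M.W 0) inferInstance] ≤ᵐ[P] fun _ => σ ^ 2)
    {L : ℝ} (hL : 0 < L) :
    P {ω | L * (n * (σ ^ 2 * M.K n)) < M.noiseDev n ω ⬝ᵥ M.noiseDev n ω}
      ≤ ENNReal.ofReal (1 / L) := by
  have hF : ∀ k, Measurable fun z : ℝ × EuclideanSpace ℝ (Fin d) × EuclideanSpace ℝ (Fin dw) =>
      M.instr n z k * (z.1 - M.h₀ z.2.1) := fun k =>
    (M.measurable_instr n k).mul
      (measurable_fst.sub (M.sample.measurable_h₀.comp (by fun_prop)))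
  have hF2 : ∀ k, MemLp (fun ω => M.instr n (M.obs 0 ω) k *
      ((M.obs 0 ω).1 - M.h₀ (M.obs 0 ω).2.1)) 2 P :=
    fun k => M.memLp_instr_mul h k hu
  have hm : MeasurableSpace.comap (M.W 0) inferInstance ≤ (inferInstance : MeasurableSpace Ω) :=
    (M.sample.measurable_W 0).comap_le
  have hinstr : ∀ k, StronglyMeasurable[MeasurableSpace.comap (M.W 0) inferInstance]
      fun ω => M.instr n (M.obs 0 ω) k := fun k =>
    ((measurable_whiten (M.measurable_b _) k).comp (comap_measurable (M.W 0))).stronglyMeasurable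
  have hmean : ∀ k, ∫ ω, M.instr n (M.obs 0 ω) k *
      ((M.obs 0 ω).1 - M.h₀ (M.obs 0 ω).2.1) ∂P = 0 := by
    intro k
    have h1 := condExp_mul_of_stronglyMeasurable_left (μ := P) (hinstr k)
      (g := fun ω => M.Y 0 ω - M.h₀ (M.X 0 ω)) ((hF2 k).integrable one_le_two)
      (M.sample.integrable_u 0)
    have h2 := integral_condExp (μ := P) hm (f := (fun ω => M.instr n (M.obs 0 ω) k) *
      fun ω => M.Y 0 ω - M.h₀ (M.X 0 ω))
    refine h2.symm.trans ?_
    rw [← integral_zero Ω ℝ]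
    refine integral_congr_ae ?_
    filter_upwards [h1, M.sample.condExp_u 0] with ω h3 h4
    rw [h3, Pi.mul_apply, h4]
    simp
  have hvar : ∀ k, ∫ ω, (M.instr n (M.obs 0 ω) k *
      ((M.obs 0 ω).1 - M.h₀ (M.obs 0 ω).2.1)) ^ 2 ∂P ≤ σ ^ 2 := by
    intro k
    have hb2 : MemLp (fun ω => M.instr n (M.obs 0 ω) k) 2 P :=
      (M.memLp_instr n k).comp_measurePreserving M.measurePreserving_obs
    have hint : Integrable ((fun ω => M.instr n (M.obs 0 ω) k ^ 2) *
        fun ω => (M.Y 0 ω - M.h₀ (M.X 0 ω)) ^ 2) P := by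
      refine (hF2 k).integrable_sq.congr (ae_of_all _ fun ω => ?_)
      simp only [obs, Pi.mul_apply, mul_pow]
    have h1 := condExp_mul_of_stronglyMeasurable_left (μ := P) ((hinstr k).pow 2)
      (g := fun ω => (M.Y 0 ω - M.h₀ (M.X 0 ω)) ^ 2) hint hu.integrable_sq
    have h2 := integral_condExp (μ := P) hm (f := (fun ω => M.instr n (M.obs 0 ω) k ^ 2) *
      fun ω => (M.Y 0 ω - M.h₀ (M.X 0 ω)) ^ 2)
    have h3 : ∫ ω, (M.instr n (M.obs 0 ω) k * ((M.obs 0 ω).1 - M.h₀ (M.obs 0 ω).2.1)) ^ 2 ∂P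
        = ∫ ω, ((fun ω => M.instr n (M.obs 0 ω) k ^ 2) *
          fun ω => (M.Y 0 ω - M.h₀ (M.X 0 ω)) ^ 2) ω ∂P :=
      integral_congr_ae (ae_of_all _ fun ω => by simp only [obs, Pi.mul_apply, mul_pow])
    have h4 : ∫ ω, M.instr n (M.obs 0 ω) k ^ 2 ∂P = 1 := by
      have h5 := integral_comp_measurePreserving M.measurePreserving_obs
        ((M.measurable_instr n k).mul (M.measurable_instr n k)).aestronglyMeasurable
      simp only [sq]
      exact h5.trans ((M.integral_instr_mul_instr n k k).trans (Matrix.one_apply_eq k))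
    rw [h3, ← h2]
    calc _ ≤ ∫ ω, M.instr n (M.obs 0 ω) k ^ 2 * σ ^ 2 ∂P := by
          refine integral_mono_ae integrable_condExp (hb2.integrable_sq.mul_const _) ?_
          filter_upwards [h1, hσ] with ω h6 h7
          refine h6.le.trans ?_
          exact mul_le_mul_of_nonneg_left h7 (sq_nonneg _)
      _ = σ ^ 2 := by rw [integral_mul_const, h4, one_mul]
  obtain ⟨hint, hle⟩ := integral_sum_sub_dotProduct_self_le M.iIndepFun_obs M.identDistrib_obs
    hF hF2 n
  simp only [hmean, mul_zero, sub_zero] at hint hle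
  refine measure_gt_mul_le (f := fun ω => M.noiseDev n ω ⬝ᵥ M.noiseDev n ω) hint
    (fun ω => Finset.sum_nonneg fun k _ => mul_self_nonneg _) (hle.trans ?_) hL
  refine mul_le_mul_of_nonneg_left ?_ (Nat.cast_nonneg n)
  refine (Finset.sum_le_sum fun k _ => hvar k).trans (le_of_eq ?_)
  simp [mul_comm]

end Deviations

/-! ### Consequences of the rate conditions for large samples. -/

section Rates

theorem eventually_regular
    (hgap : Tendsto (fun n => M.tau n * projectionGap M.T (M.sieveX n) (M.sieveW n))
      atTop (𝓝 0))
    (hrate : Tendsto (fun n : ℕ => M.tau n * M.zetaMax n *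
      ENNReal.ofReal √(Real.log (M.J n) / n)) atTop (𝓝 0)) :
    ∀ᶠ n in atTop, 0 < n ∧ 2 ≤ M.J n ∧ M.tau n ≠ ⊤ ∧ 1 ≤ (M.tau n).toReal ∧ M.zetaMax n ≠ ⊤ ∧
      0 < (M.zetaMax n).toReal ∧
      M.tau n * projectionGap M.T (M.sieveX n) (M.sieveW n) ≤ ENNReal.ofReal (1 / 4) := by
  filter_upwards [eventually_gt_atTop 0, M.eventually_two_le_J,
    hrate.eventually (gt_mem_nhds zero_lt_one),
    hgap.eventually (ge_mem_nhds (ENNReal.ofReal_pos.2 (by norm_num : (0 : ℝ) < 1 / 4)))]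
    with n hn hJ h1 h2
  have hlog : 0 < Real.log (M.J n) := Real.log_pos (by exact_mod_cast hJ)
  -- All three factors are nonzero, the last because `J ≥ 2`, so an infinite `τ` or `ζ` would make
  -- the product `⊤`.
  have hrt : ENNReal.ofReal √(Real.log (M.J n) / n) ≠ 0 := by
    refine (ENNReal.ofReal_pos.2 (Real.sqrt_pos.2 (div_pos hlog ?_))).ne'
    exact_mod_cast hn
  have hτ1 := M.one_le_tau hJ
  have hτ0 : M.tau n ≠ 0 := (zero_lt_one.trans_le hτ1).ne'
  have hζ0 : M.zetaMax n ≠ 0 := (M.zetaMax_pos hJ).ne'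
  have hτ : M.tau n ≠ ⊤ := by
    intro h
    rw [h, ENNReal.top_mul hζ0, ENNReal.top_mul hrt] at h1
    exact absurd h1 (by simp)
  have hζ : M.zetaMax n ≠ ⊤ := by
    intro h
    rw [h, ENNReal.mul_top hτ0, ENNReal.top_mul hrt] at h1
    exact absurd h1 (by simp)
  refine ⟨hn, hJ, hτ, ?_, hζ, ENNReal.toReal_pos hζ0 hζ, h2⟩
  simpa using ENNReal.toReal_mono hτ hτ1

theorem tendsto_rate_sq
    (hrate : Tendsto (fun n : ℕ => M.tau n * M.zetaMax n *
      ENNReal.ofReal √(Real.log (M.J n) / n)) atTop (𝓝 0)) :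
    Tendsto (fun n : ℕ => (M.tau n).toReal ^ 2 * (M.zetaMax n).toReal ^ 2 *
      (Real.log (M.J n) / n)) atTop (𝓝 0) := by
  have h := ((ENNReal.tendsto_toReal ENNReal.zero_ne_top).comp hrate).pow 2
  simp only [ENNReal.toReal_zero, ne_eq, OfNat.ofNat_ne_zero, not_false_eq_true, zero_pow] at h
  refine h.congr fun n => ?_
  have h0 : 0 ≤ Real.log (M.J n) / n :=
    div_nonneg (Real.log_natCast_nonneg _) (Nat.cast_nonneg n)
  simp only [Function.comp_apply, ENNReal.toReal_mul, ENNReal.toReal_ofReal (Real.sqrt_nonneg _),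
    mul_pow, Real.sq_sqrt h0]

theorem eventually_sq_le
    (hrate : Tendsto (fun n : ℕ => M.tau n * M.zetaMax n *
      ENNReal.ofReal √(Real.log (M.J n) / n)) atTop (𝓝 0)) :
    ∀ᶠ n : ℕ in atTop, (M.tau n).toReal ^ 2 * (M.zetaMax n).toReal ^ 2 ≤ n := by
  have hl2 : 0 < Real.log 2 := Real.log_pos one_lt_two
  filter_upwards [eventually_gt_atTop 0, M.eventually_two_le_J,
    (M.tendsto_rate_sq hrate).eventually (gt_mem_nhds hl2)] with n hn hJ h
  have hn' : (0 : ℝ) < n := Nat.cast_pos.2 hn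
  have hlog : Real.log 2 ≤ Real.log (M.J n) := Real.log_le_log two_pos (by exact_mod_cast hJ)
  rw [← mul_div_assoc, div_lt_iff₀ hn'] at h
  refine le_of_mul_le_mul_right ?_ hl2
  calc _ ≤ (M.tau n).toReal ^ 2 * (M.zetaMax n).toReal ^ 2 * Real.log (M.J n) := by gcongr
    _ ≤ n * Real.log 2 := by linarith

omit [IsProbabilityMeasure P] in
theorem exists_K_le : ∃ C : ℝ, 0 ≤ C ∧ ∀ᶠ n in atTop, (M.K n : ℝ) ≤ C * M.J n := by
  obtain ⟨C, hC0, hC⟩ := M.K_isBigO.exists_nonneg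
  refine ⟨C, hC0, ?_⟩
  filter_upwards [hC.bound] with n hn
  simpa using hn

theorem eventually_measure_compl_goodEvent_le
    (hgap : Tendsto (fun n => M.tau n * projectionGap M.T (M.sieveX n) (M.sieveW n))
      atTop (𝓝 0))
    (hrate : Tendsto (fun n : ℕ => M.tau n * M.zetaMax n *
      ENNReal.ofReal √(Real.log (M.J n) / n)) atTop (𝓝 0)) {ε : ℝ} (hε : 0 < ε) :
    ∀ᶠ n in atTop, P (M.goodEvent n)ᶜ ≤ ENNReal.ofReal ε := by
  obtain ⟨C, hC0, hC⟩ := M.exists_K_le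
  have hl2 : 0 < Real.log 2 := Real.log_pos one_lt_two
  -- Chosen so that `⌈log (K + J)⌉ ≤ L log J`: `K + J ≤ (1 + C) J`, and `log J ≥ log 2` absorbs the
  -- additive constants.
  set L : ℝ := (Real.log (1 + C) + 1) / Real.log 2 + 1 with hL
  have hlC : 0 ≤ Real.log (1 + C) := Real.log_nonneg (by linarith)
  have hL0 : 0 < L := by positivity
  set ε' : ℝ := min ε 1 with hε'
  have hε'0 : 0 < ε' := lt_min hε one_pos
  have hlim : Tendsto (fun n : ℕ => 64 * ((4 * L * ((M.tau n).toReal ^ 2 *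
      (M.zetaMax n).toReal ^ 2 * (Real.log (M.J n) / n))) ^ 2 +
      8 * (4 * L * ((M.tau n).toReal ^ 2 * (M.zetaMax n).toReal ^ 2 *
        (Real.log (M.J n) / n))))) atTop (𝓝 0) := by
    have h := (M.tendsto_rate_sq hrate).const_mul (4 * L)
    have h' := ((h.pow 2).add (h.const_mul 8)).const_mul 64
    simpa using h'
  filter_upwards [M.eventually_regular hgap hrate, hC,
    hlim.eventually (ge_mem_nhds (mul_pos (Real.exp_pos (-1)) hε'0))]
    with n ⟨hn, hJ, hτ, hτ1, hζ, hζ0, _⟩ hK hsmall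
  set τ := (M.tau n).toReal
  set ζ := (M.zetaMax n).toReal
  set D : ℝ := M.K n + M.J n with hD
  have hn' : (0 : ℝ) < n := Nat.cast_pos.2 hn
  have hJ2 : (2 : ℝ) ≤ M.J n := by exact_mod_cast hJ
  have hJ0 : (0 : ℝ) < M.J n := by linarith
  have hK0 : (0 : ℝ) ≤ M.K n := Nat.cast_nonneg _
  have hD2 : 1 < D := by rw [hD]; linarith
  have hlogD : 0 < Real.log D := Real.log_pos hD2
  -- At this order the dimension factor satisfies `D ≤ e ^ p`. A ratio of at most `ε' / e` then
  -- leaves `ε' ^ p ≤ ε'`, which is why `ε'` is capped at `1`.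
  set p := ⌈Real.log D⌉₊ with hp
  have hp0 : p ≠ 0 := (Nat.ceil_pos.2 hlogD).ne'
  have hpD : Real.log D ≤ p := Nat.le_ceil _
  have hlogJ : Real.log 2 ≤ Real.log (M.J n) := Real.log_le_log two_pos hJ2
  have hpL : (p : ℝ) ≤ L * Real.log (M.J n) := by
    have h1 : (p : ℝ) ≤ Real.log D + 1 := (Nat.ceil_lt_add_one hlogD.le).le
    have h2 : Real.log D ≤ Real.log (1 + C) + Real.log (M.J n) := by
      rw [← Real.log_mul (by linarith) hJ0.ne']
      refine Real.log_le_log (by linarith) ?_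
      rw [hD]
      linarith
    have h3 : Real.log (1 + C) + 1 ≤ (Real.log (1 + C) + 1) / Real.log 2 * Real.log (M.J n) := by
      rw [div_mul_eq_mul_div, le_div_iff₀ hl2]
      exact mul_le_mul_of_nonneg_left hlogJ (by linarith)
    rw [hL, add_mul, one_mul]
    linarith
  refine (M.measure_compl_goodEvent_le hn hτ1 hζ hζ0 hp0).trans (ENNReal.ofReal_le_ofReal ?_)
  set η : ℝ := 4 * p * ζ ^ 2 / n with hη
  have hη0 : 0 ≤ η := by positivity
  have hτη : τ ^ 2 * η ≤ 4 * L * (τ ^ 2 * ζ ^ 2 * (Real.log (M.J n) / n)) := by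
    have : τ ^ 2 * η = 4 * τ ^ 2 * ζ ^ 2 / n * p := by rw [hη]; ring
    rw [this]
    calc 4 * τ ^ 2 * ζ ^ 2 / n * p ≤ 4 * τ ^ 2 * ζ ^ 2 / n * (L * Real.log (M.J n)) := by gcongr
      _ = _ := by ring
  have hratio : 64 * τ ^ 2 * (η ^ 2 + 8 * η) ≤ Real.exp (-1) * ε' := by
    refine le_trans ?_ hsmall
    have hτsq : 1 ≤ τ ^ 2 := one_le_pow₀ hτ1
    -- As `τ ≥ 1`, the quadratic term is also a function of `τ² η`, the quantity that tends to zero.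
    have h1 : τ ^ 2 * η ^ 2 ≤ (τ ^ 2 * η) ^ 2 := by
      rw [mul_pow]
      refine mul_le_mul_of_nonneg_right ?_ (sq_nonneg η)
      nlinarith
    have h2 : (τ ^ 2 * η) ^ 2
        ≤ (4 * L * (τ ^ 2 * ζ ^ 2 * (Real.log (M.J n) / n))) ^ 2 :=
      pow_le_pow_left₀ (by positivity) hτη 2
    linarith
  have hexp : D ≤ Real.exp 1 ^ p := by
    rw [← Real.exp_nat_mul, mul_one]
    exact (Real.log_le_iff_le_exp (by linarith)).1 hpD
  calc D * (64 * τ ^ 2 * (η ^ 2 + 8 * η)) ^ p ≤ Real.exp 1 ^ p * (Real.exp (-1) * ε') ^ p := by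
        gcongr
    _ = ε' ^ p := by
        rw [← mul_pow, ← mul_assoc, ← Real.exp_add]
        simp
    _ ≤ ε' := pow_le_of_le_one hε'0.le (min_le_right _ _) hp0
    _ ≤ ε := min_le_left _ _

end Rates

/-! ### Bounds on each contribution to the error outside small events. -/

section ErrorBounds

/-- The error of the noiseless fit, outside a small event. -/
theorem eLpNorm_hTilde_sub_le {n : ℕ} (hn : 0 < n) (hτ : M.tau n ≠ ⊤)
    (hτ1 : 1 ≤ (M.tau n).toReal)
    (hgap : M.tau n * projectionGap M.T (M.sieveX n) (M.sieveW n) ≤ ENNReal.ofReal (1 / 4))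
    {ω : Ω} (hω : ω ∈ M.goodEvent n) :
    eLpNorm (fun x => M.hTilde n ω x - M.h₀ x) 2 M.lawX
      ≤ ENNReal.ofReal (4 * (M.tau n).toReal / n *
          (euclNorm (M.residDev n ω) + n * euclNorm (M.residCoef n)) + ‖M.approxError n‖) := by
  have hn' : (0 : ℝ) ≤ n := Nat.cast_nonneg n
  refine (M.eLpNorm_sieveFit_sub_le hn hτ hτ1 hgap hω fun i ω => M.h₀ (M.X i ω)).trans
    (ENNReal.ofReal_le_ofReal ?_)
  gcongr
  rw [← euclNorm_smul hn']
  refine le_trans (le_of_eq ?_) (euclNorm_add_le _ _)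
  congr 1
  ext k
  rw [transpose_rowMatrix_mulVec]
  simp [residDev]

/-- The error of the fit, outside a small event. -/
theorem eLpNorm_hHat_sub_le {n : ℕ} (hn : 0 < n) (hτ : M.tau n ≠ ⊤)
    (hτ1 : 1 ≤ (M.tau n).toReal)
    (hgap : M.tau n * projectionGap M.T (M.sieveX n) (M.sieveW n) ≤ ENNReal.ofReal (1 / 4))
    {ω : Ω} (hω : ω ∈ M.goodEvent n) :
    eLpNorm (fun x => M.hHat n ω x - M.h₀ x) 2 M.lawX
      ≤ ENNReal.ofReal (4 * (M.tau n).toReal / n *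
          (euclNorm (M.noiseDev n ω) + (euclNorm (M.residDev n ω)
            + n * euclNorm (M.residCoef n))) + ‖M.approxError n‖) := by
  have hn' : (0 : ℝ) ≤ n := Nat.cast_nonneg n
  refine (M.eLpNorm_sieveFit_sub_le hn hτ hτ1 hgap hω M.Y).trans (ENNReal.ofReal_le_ofReal ?_)
  gcongr
  rw [← euclNorm_smul hn']
  refine le_trans (le_of_eq ?_) ((euclNorm_add_le _ _).trans
    (add_le_add_right (euclNorm_add_le _ _) _))
  congr 1
  ext k
  rw [transpose_rowMatrix_mulVec]
  simp [residDev, noiseDev, mul_add, Finset.sum_add_distrib]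

theorem euclNorm_le_sqrt_of_not_lt {k : ℕ} {v : Fin k → ℝ} {A : ℝ} (h : ¬A < v ⬝ᵥ v) :
    euclNorm v ≤ √A := by
  rw [not_lt, ← euclNorm_sq] at h
  exact Real.le_sqrt_of_sq_le h

/-- The deterministic part and the centered part of the approximation error. -/
theorem tau_mul_resid_le {n : ℕ} (hn : 0 < n) {C L : ℝ} (hL : 0 ≤ L)
    (hstab : (M.tau n).toReal * ‖M.T (M.approxError n)‖ ≤ C * ‖M.approxError n‖)
    (hsq : (M.tau n).toReal ^ 2 * (M.zetaMax n).toReal ^ 2 ≤ n) {ω : Ω}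
    (hω : ¬L * (n * ((M.zetaMax n).toReal ^ 2 * ‖M.approxError n‖ ^ 2))
        < M.residDev n ω ⬝ᵥ M.residDev n ω) :
    4 * (M.tau n).toReal / n * (euclNorm (M.residDev n ω) + n * euclNorm (M.residCoef n))
      ≤ 4 * (√L + C) * ‖M.approxError n‖ := by
  set τ := (M.tau n).toReal
  set ζ := (M.zetaMax n).toReal
  have hτ0 : 0 ≤ τ := ENNReal.toReal_nonneg
  have hn' : (0 : ℝ) < n := Nat.cast_pos.2 hn
  have h1 := euclNorm_le_sqrt_of_not_lt hω
  -- Here `τ² ζ² ≤ n` cancels both the ill-posedness and the size of the basis.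
  have h2 : τ * √(L * (n * (ζ ^ 2 * ‖M.approxError n‖ ^ 2))) ≤ n * (√L * ‖M.approxError n‖) := by
    refine abs_le_of_sq_le_sq' ?_ (by positivity) |>.2
    rw [mul_pow, Real.sq_sqrt (by positivity), mul_pow, mul_pow, Real.sq_sqrt hL]
    have := mul_le_mul_of_nonneg_right hsq
      (show 0 ≤ n * (L * ‖M.approxError n‖ ^ 2) by positivity)
    linarith
  have h3 := mul_le_mul_of_nonneg_left h1 hτ0
  have h4 := mul_le_mul_of_nonneg_left (M.euclNorm_residCoef_le n) hτ0
  have h5 := mul_le_mul_of_nonneg_left (h4.trans hstab) hn'.le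
  rw [div_mul_eq_mul_div, div_le_iff₀ hn']
  linarith

theorem tau_mul_noise_le {n : ℕ} (hn : 0 < n) {C σ L : ℝ} (hC : 0 ≤ C) (hL : 0 ≤ L)
    (hK : (M.K n : ℝ) ≤ C * M.J n) {ω : Ω}
    (hω : ¬L * (n * (σ ^ 2 * M.K n)) < M.noiseDev n ω ⬝ᵥ M.noiseDev n ω) :
    4 * (M.tau n).toReal / n * euclNorm (M.noiseDev n ω)
      ≤ 4 * √(L * (σ ^ 2 * C)) * ((M.tau n).toReal * √(M.J n / n)) := by
  set τ := (M.tau n).toReal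
  have hτ0 : 0 ≤ τ := ENNReal.toReal_nonneg
  have hn' : (0 : ℝ) < n := Nat.cast_pos.2 hn
  have h1 := euclNorm_le_sqrt_of_not_lt hω
  have h2 : √(L * (n * (σ ^ 2 * M.K n))) ≤ n * (√(L * (σ ^ 2 * C)) * √(M.J n / n)) := by
    rw [← Real.sqrt_mul (by positivity)]
    refine Real.sqrt_le_iff.2 ⟨by positivity, ?_⟩
    rw [mul_pow, Real.sq_sqrt (by positivity)]
    calc L * (n * (σ ^ 2 * M.K n)) ≤ L * (n * (σ ^ 2 * (C * M.J n))) := by gcongr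
      _ = _ := by field_simp
  calc 4 * τ / n * euclNorm (M.noiseDev n ω)
      ≤ 4 * τ / n * (n * (√(L * (σ ^ 2 * C)) * √(M.J n / n))) := by
        gcongr
        exact h1.trans h2
    _ = _ := by field_simp

end ErrorBounds

end Setting

/-! ### Stochastic order and the assembly of the theorem. -/

theorem IsBigOP.of_forall_exists {Ω : Type*} [MeasurableSpace Ω] {P : Measure Ω}
    {Z : ℕ → Ω → ℝ≥0∞} {a : ℕ → ℝ≥0∞}
    (h : ∀ ε : ℝ, 0 < ε → ∃ C : ℝ≥0, ∀ᶠ n in atTop, ∃ s : Set Ω, P s ≤ ENNReal.ofReal ε ∧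
      ∀ ω ∉ s, Z n ω ≤ C * a n) : IsBigOP P Z a := by
  intro ε hε
  -- The tolerance may be `⊤`; capping it at `1` makes it a positive real.
  obtain ⟨C, hC⟩ := h (min ε 1).toReal
    (ENNReal.toReal_pos (lt_min hε one_pos).ne' (ne_top_of_le_ne_top ENNReal.one_ne_top
      (min_le_right _ _)))
  refine ⟨C, ?_⟩
  filter_upwards [hC] with n ⟨s, hs, hZ⟩
  rw [ENNReal.ofReal_toReal (ne_top_of_le_ne_top ENNReal.one_ne_top (min_le_right _ _))] at hs
  refine (measure_mono fun ω hω => ?_).trans (hs.trans (min_le_left _ _))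
  by_contra hcon
  exact absurd (hZ ω hcon) (not_le.2 hω)

end NPIV

end

theorem theorem2p3 {Ω : Type*} [MeasurableSpace Ω] (P : Measure Ω) [IsProbabilityMeasure P]
    {d dw : ℕ} (M : NPIV.Setting P d dw)
    -- `T` is injective
    (hT : Function.Injective M.T)
    -- `sup_{h ∈ Ψ_J, ‖h‖ = 1} ‖(Π_K T - T) h‖ = o(1 / τ_J)`
    (hgap : Tendsto (fun n => M.tau n * NPIV.projectionGap M.T (M.sieveX n) (M.sieveW n))
      atTop (𝓝 0))
    -- `τ_J ‖T (h₀ - Π_J h₀)‖ ≤ const * ‖h₀ - Π_J h₀‖`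
    (hstab : ∃ C : ℝ≥0, ∀ n, M.tau n * ‖M.T (M.approxError n)‖ₑ ≤ C * ‖M.approxError n‖ₑ)
    -- `τ_J ζ √(log J / n) = o(1)`
    (hrate : Tendsto (fun n : ℕ => M.tau n * M.zetaMax n *
      ENNReal.ofReal √(Real.log (M.J n) / n)) atTop (𝓝 0)) :
    -- `‖h̃ - h₀‖ ≤ O_p(1) * ‖h₀ - Π_J h₀‖`
    NPIV.IsBigOP P (fun n ω => eLpNorm (fun x => M.hTilde n ω x - M.h₀ x) 2 M.lawX)
      (fun n => ‖M.approxError n‖ₑ) ∧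
    -- `‖ĥ - h₀‖ = O_p(‖h₀ - Π_J h₀‖ + τ_J √(J / n))` under bounded conditional variance
    (NPIV.BoundedCondVariance P M.Y M.X M.W M.h₀ →
      NPIV.IsBigOP P (fun n ω => eLpNorm (fun x => M.hHat n ω x - M.h₀ x) 2 M.lawX)
        (fun n => ‖M.approxError n‖ₑ + M.tau n * ENNReal.ofReal √((M.J n : ℝ) / n))) := by
  obtain ⟨C, hC⟩ := hstab
  have hstab' : ∀ n, (M.tau n).toReal * ‖M.T (M.approxError n)‖ ≤ C * ‖M.approxError n‖ := by
    intro n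
    have h := ENNReal.toReal_mono (ENNReal.mul_ne_top ENNReal.coe_ne_top enorm_ne_top) (hC n)
    simpa using h
  have hreg := M.eventually_regular hgap hrate
  have hsq := M.eventually_sq_le hrate
  refine ⟨NPIV.IsBigOP.of_forall_exists fun ε hε => ?_, fun ⟨σ, hσ⟩ =>
    NPIV.IsBigOP.of_forall_exists fun ε hε => ?_⟩
  -- Markov's inequality gives exceptional probability `1 / L = ε / 2`; the good event takes the
  -- other half.
  · set L : ℝ := 1 / (ε / 2) with hL
    have hL0 : 0 < L := by positivity
    -- The final `1` pays for the approximation error itself.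
    refine ⟨Real.toNNReal (4 * (√L + C) + 1), ?_⟩
    filter_upwards [hreg, hsq, M.eventually_measure_compl_goodEvent_le hgap hrate (half_pos hε)]
      with n ⟨hn, _, hτ, hτ1, hζ, _, hg⟩ hn2 hgood
    refine ⟨(M.goodEvent n)ᶜ ∪ {ω | L * (n * ((M.zetaMax n).toReal ^ 2 *
      ‖M.approxError n‖ ^ 2)) < M.residDev n ω ⬝ᵥ M.residDev n ω}, ?_, fun ω hω => ?_⟩
    · refine (measure_union_le _ _).trans ((add_le_add hgood
        (M.measure_residDev_gt_le hζ hL0)).trans (le_of_eq ?_))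
      rw [hL, one_div_one_div, ← ENNReal.ofReal_add (by positivity) (by positivity), add_halves]
    · rw [Set.mem_union, not_or, Set.notMem_compl_iff] at hω
      refine (M.eLpNorm_hTilde_sub_le hn hτ hτ1 hg hω.1).trans ?_
      have h1 := M.tau_mul_resid_le hn hL0.le (hstab' n) hn2 hω.2
      rw [← ofReal_norm, ENNReal.ofNNReal_toNNReal, ← ENNReal.ofReal_mul (by positivity)]
      exact ENNReal.ofReal_le_ofReal (by linarith)
  -- Three exceptional events share `ε`: the complement of the good event, a large centered residual
  -- and large noise.
  · set L : ℝ := 1 / (ε / 3) with hL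
    have hL0 : 0 < L := by positivity
    obtain ⟨CK, hCK0, hCK⟩ := M.exists_K_le
    set A : ℝ := 4 * (√L + C) + 1 with hA
    set A' : ℝ := 4 * √(L * (σ ^ 2 * CK)) with hA'
    have hA0 : 0 ≤ A := by positivity
    have hA'0 : 0 ≤ A' := by positivity
    -- One constant must multiply both terms of the rate, so the two constants are added and the
    -- nonnegative cross terms discarded.
    refine ⟨Real.toNNReal (A + A'), ?_⟩
    filter_upwards [hreg, hsq, hCK, M.eventually_measure_compl_goodEvent_le hgap hrate
      (show 0 < ε / 3 by positivity)] with n ⟨hn, _, hτ, hτ1, hζ, _, hg⟩ hn2 hK hgood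
    refine ⟨(M.goodEvent n)ᶜ ∪ ({ω | L * (n * ((M.zetaMax n).toReal ^ 2 *
      ‖M.approxError n‖ ^ 2)) < M.residDev n ω ⬝ᵥ M.residDev n ω} ∪
      {ω | L * (n * (σ ^ 2 * M.K n)) < M.noiseDev n ω ⬝ᵥ M.noiseDev n ω}), ?_, fun ω hω => ?_⟩
    · refine (measure_union_le _ _).trans ((add_le_add hgood ((measure_union_le _ _).trans
        (add_le_add (M.measure_residDev_gt_le hζ hL0)
          (M.measure_noiseDev_gt_le hζ (hσ 0).1 (hσ 0).2 hL0)))).trans (le_of_eq ?_))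
      rw [hL, one_div_one_div, ← ENNReal.ofReal_add (by positivity) (by positivity),
        ← ENNReal.ofReal_add (by positivity) (by positivity)]
      congr 1
      ring
    · rw [Set.mem_union, Set.mem_union, not_or, not_or, Set.notMem_compl_iff] at hω
      refine (M.eLpNorm_hHat_sub_le hn hτ hτ1 hg hω.1).trans ?_
      have h1 := M.tau_mul_resid_le hn hL0.le (hstab' n) hn2 hω.2.1
      have h2 := M.tau_mul_noise_le hn hCK0 hL0.le hK hω.2.2
      rw [← ofReal_norm, ENNReal.ofNNReal_toNNReal, ← ENNReal.ofReal_toReal hτ,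
        ← ENNReal.ofReal_mul ENNReal.toReal_nonneg,
        ← ENNReal.ofReal_add (norm_nonneg _) (by positivity),
        ← ENNReal.ofReal_mul (add_nonneg hA0 hA'0)]
      refine ENNReal.ofReal_le_ofReal ?_
      have h3 : 0 ≤ A' * ‖M.approxError n‖ := mul_nonneg hA'0 (norm_nonneg _)
      have h4 : 0 ≤ A * ((M.tau n).toReal * √((M.J n : ℝ) / n)) := by positivity
      rw [ENNReal.toReal_ofReal ENNReal.toReal_nonneg, mul_add (4 * (M.tau n).toReal / n)]
      rw [hA] at h4 ⊢
      rw [← hA'] at h2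
      linarith
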